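/- Let $F$ be a field, let $n\ge 1$ and $s\ge 0$, let $X\subset\mathbb P^n_F$ be a non-empty closed subscheme, and let $\phi\colon X\to\mathbb P^s_F$ be a finite morphism of $F$-schemes. Put $\mathcal L=\phi^*\mathcal O_{\mathbb P^s}(1)$, let $V\subset H^0(X,\mathcal L)$ be the image of $H^0(\mathbb P^s,\mathcal O_{\mathbb P^s}(1))$ under $\phi^*$, and write $\mathcal L^t(\epsilon)=\mathcal L^{\otimes t}\otimes\mathcal O_{\mathbb P^n}(\epsilon)|_X$. For a closed point $p\in\mathbb P^s_F$ with residue field $\kappa(p)$, regard the scheme-theoretic fiber $X_p=\phi^{-1}(p)$ as a closed subscheme of $\mathbb P^n_{\kappa(p)}$ (this is $\mathbb P^n_F$ if $\kappa(p)=F$, for instance whenever $F$ is algebraically closed). Its Castelnuovo–Mumford regularity $\operatorname{reg}X_p$ is the least integer $r$ such that $H^q(\mathbb P^n_{\kappa(p)},\mathcal I_{X_p}(r-q))=0$ for all $q>0$. Then $\operatorname{reg}X_p$ exists for every closed point $p$ of $\mathbb P^s_F$; there is a least integer $\epsilon$ such that the multiplication map $$H^0(\mathbb P^n_F,\mathcal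 O_{\mathbb P^n}(\epsilon))\otimes_F \operatorname{Sym}_t(V)\longrightarrow H^0(X,\mathcal L^t(\epsilon))$$ is surjective for all $t\gg0$; the maximum of $\operatorname{reg}X_p$ over all closed points $p\in\mathbb P^s_F$ exists; and $$\max_{p}\ \operatorname{reg}X_p=\epsilon+1 .$$ -/

import Mathlib

open CategoryTheory AlgebraicGeometry TopologicalSpace
open scoped TensorProduct

universe u

attribute [local instance] MvPolynomial.gradedAlgebra

noncomputable section

namespace FiberRegularity

/-! ### Line bundles given by transition functions -/

/-- Restriction of regular functions to a smaller open set. -/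
abbrev res {X : Scheme.{u}} {U V : X.Opens} (h : V ≤ U) : Γ(X, U) →+* Γ(X, V) :=
  (X.presheaf.map (homOfLE h).op).hom

lemma res_res {X : Scheme.{u}} {U V W : X.Opens} (h : V ≤ U) (h' : W ≤ V) (s : Γ(X, U)) :
    res h' (res h s) = res (h'.trans h) s := by
  rw [← CommRingCat.comp_apply, ← Functor.map_comp]
  rfl

/-- Pull-back of regular functions along `f : Y ⟶ X`, from `U ⊆ X` to `V ⊆ f⁻¹ U`. -/
abbrev pull {X Y : Scheme.{u}} (f : Y ⟶ X) {U : X.Opens} {V : Y.Opens} (h : V ≤ f ⁻¹ᵁ U) :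
    Γ(X, U) →+* Γ(Y, V) :=
  (f.appLE U V h).hom

lemma res_pull {X Y : Scheme.{u}} (f : Y ⟶ X) {U : X.Opens} {V W : Y.Opens} (h : V ≤ f ⁻¹ᵁ U)
    (h' : W ≤ V) (s : Γ(X, U)) : res h' (pull f h s) = pull f (h'.trans h) s := by
  rw [← CommRingCat.comp_apply, Scheme.Hom.appLE_map]

lemma pull_res {X Y : Scheme.{u}} (f : Y ⟶ X) {U U' : X.Opens} {V : Y.Opens} (h : U' ≤ U)
    (h' : V ≤ f ⁻¹ᵁ U') (s : Γ(X, U)) :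
    pull f h' (res h s) = pull f (h'.trans ((Opens.map f.base).map (homOfLE h)).le) s := by
  rw [← CommRingCat.comp_apply, Scheme.Hom.map_appLE]

lemma inf_le_preimage {X Y : Scheme.{u}} (f : Y ⟶ X) (U V : X.Opens) :
    f ⁻¹ᵁ U ⊓ f ⁻¹ᵁ V ≤ f ⁻¹ᵁ (U ⊓ V) := fun _ h ↦ h

lemma le_preimage_top {X Y : Scheme.{u}} (f : Y ⟶ X) (V : Y.Opens) : V ≤ f ⁻¹ᵁ ⊤ :=
  fun _ _ ↦ trivial

/-- A line bundle on a scheme `X`, given by an open cover `U a` on which it is trivialised, and by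
its transition functions: `g a b` is the regular function on `U a ∩ U b` such that a section of the
line bundle with local expressions `s a` on `U a` and `s b` on `U b` satisfies `s a = g a b * s b`
on `U a ∩ U b`. -/
structure LineBundle (X : Scheme.{u}) where
  /-- the index set of the cover -/
  I : Type
  /-- the cover -/
  U : I → X.Opens
  /-- the transition functions -/
  g : ∀ a b, Γ(X, U a ⊓ U b)
  cover : ⨆ a, U a = ⊤
  g_self : ∀ a, g a a = 1
  cocycle : ∀ a b c,
    res (V := U a ⊓ U b ⊓ U c) inf_le_left (g a b) *
      res (V := U a ⊓ U b ⊓ U c) (le_inf (inf_le_left.trans inf_le_right) inf_le_right) (g b c) =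
    res (V := U a ⊓ U b ⊓ U c) (le_inf (inf_le_left.trans inf_le_left) inf_le_right) (g a c)

namespace LineBundle

variable {X Y : Scheme.{u}}

/-- The pull-back `f^* L`. -/
def pullback (L : LineBundle X) (f : Y ⟶ X) : LineBundle Y where
  I := L.I
  U a := f ⁻¹ᵁ L.U a
  g a b := pull f (inf_le_preimage f _ _) (L.g a b)
  cover := by
    have h := congrArg (fun W ↦ f ⁻¹ᵁ W) L.cover
    simpa [Scheme.Hom.preimage_iSup] using h
  g_self a := (congrArg _ (L.g_self a)).trans (map_one _)
  cocycle a b c := by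
    have e : f ⁻¹ᵁ L.U a ⊓ f ⁻¹ᵁ L.U b ⊓ f ⁻¹ᵁ L.U c ≤ f ⁻¹ᵁ (L.U a ⊓ L.U b ⊓ L.U c) :=
      fun _ h ↦ h
    have h := congrArg (pull f e) (L.cocycle a b c)
    rw [map_mul, pull_res, pull_res, pull_res] at h
    rw [res_pull, res_pull, res_pull]
    exact h

/-- The tensor product `L ⊗ M`, trivialised on the sets `U a ∩ V b`. -/
def tensor (L M : LineBundle X) : LineBundle X where
  I := L.I × M.I
  U a := L.U a.1 ⊓ M.U a.2
  g a b := res (inf_le_inf inf_le_left inf_le_left) (L.g a.1 b.1) *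
    res (inf_le_inf inf_le_right inf_le_right) (M.g a.2 b.2)
  cover := by
    rw [iSup_prod]
    simp only [← inf_iSup_eq, M.cover, inf_top_eq, L.cover]
  g_self a := by rw [L.g_self, M.g_self, map_one, map_one, mul_one]
  cocycle a b c := by
    have h := L.cocycle a.1 b.1 c.1
    have h' := M.cocycle a.2 b.2 c.2
    have e : L.U a.1 ⊓ M.U a.2 ⊓ (L.U b.1 ⊓ M.U b.2) ⊓ (L.U c.1 ⊓ M.U c.2) ≤
        L.U a.1 ⊓ L.U b.1 ⊓ L.U c.1 :=
      inf_le_inf (inf_le_inf inf_le_left inf_le_left) inf_le_left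
    have e' : L.U a.1 ⊓ M.U a.2 ⊓ (L.U b.1 ⊓ M.U b.2) ⊓ (L.U c.1 ⊓ M.U c.2) ≤
        M.U a.2 ⊓ M.U b.2 ⊓ M.U c.2 :=
      inf_le_inf (inf_le_inf inf_le_right inf_le_right) inf_le_right
    have h := congrArg (res e) h
    have h' := congrArg (res e') h'
    simp only [map_mul, res_res] at h h' ⊢
    rw [← h, ← h']
    ring

/-- The tensor power `L^t`. -/
def pow (L : LineBundle X) (t : ℕ) : LineBundle X where
  I := L.I
  U := L.U
  g a b := L.g a b ^ t
  cover := L.cover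
  g_self a := by rw [L.g_self, one_pow]
  cocycle a b c := by
    simp only [map_pow]
    rw [← mul_pow, L.cocycle]

/-- Families of regular functions, one on each member of the cover of `L`. -/
def Family (L : LineBundle X) : Type u := ∀ a, Γ(X, L.U a)

instance (L : LineBundle X) : CommRing L.Family := inferInstanceAs (CommRing (∀ a, Γ(X, L.U a)))

variable {F : Type u} [Field F]

/-- The constants: the ring homomorphism from `F` to the regular functions on an open subset of an
`F`-scheme. -/
def scalar (q : X ⟶ Spec (.of F)) (U : X.Opens) : F →+* Γ(X, U) :=
  (pull q (le_preimage_top q U)).comp (Scheme.ΓSpecIso (.of F)).inv.hom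

lemma res_scalar (q : X ⟶ Spec (.of F)) {U V : X.Opens} (h : V ≤ U) (c : F) :
    res h (scalar q U c) = scalar q V c := by
  simp only [scalar, RingHom.comp_apply]
  rw [res_pull]

lemma pull_scalar (q : X ⟶ Spec (.of F)) (f : Y ⟶ X) {U : X.Opens} {V : Y.Opens}
    (h : V ≤ f ⁻¹ᵁ U) (c : F) : pull f h (scalar q U c) = scalar (f ≫ q) V c := by
  simp only [scalar, RingHom.comp_apply]
  rw [← CommRingCat.comp_apply, Scheme.Hom.appLE_comp_appLE]

instance [X.Over (Spec (.of F))] (L : LineBundle X) : Algebra F L.Family :=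
  (RingHom.pi fun a ↦ scalar (X ↘ Spec (.of F)) (L.U a)).toAlgebra

lemma smul_apply [X.Over (Spec (.of F))] (L : LineBundle X) (c : F) (s : L.Family) (a : L.I) :
    (c • s) a = scalar (X ↘ Spec (.of F)) (L.U a) c * s a := rfl

variable (F) in
/-- The `F`-vector space `H^0(X, L)` of global sections of `L`. -/
def H0 [X.Over (Spec (.of F))] (L : LineBundle X) : Submodule F L.Family where
  carrier := {s | ∀ a b, res inf_le_left (s a) = L.g a b * res inf_le_right (s b)}
  zero_mem' a b := by
    change res _ (0 : Γ(X, L.U a)) = L.g a b * res _ (0 : Γ(X, L.U b))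
    simp
  add_mem' {s t} hs ht a b := by
    change res _ (s a + t a) = L.g a b * res _ (s b + t b)
    rw [map_add, map_add, hs a b, ht a b, mul_add]
  smul_mem' c s hs a b := by
    rw [smul_apply, smul_apply, map_mul, map_mul, hs a b, res_scalar, res_scalar]
    ring

lemma pull_compat (L : LineBundle X) (f : Y ⟶ X) (s : ∀ a, Γ(X, L.U a))
    (hs : ∀ a b, res (V := L.U a ⊓ L.U b) inf_le_left (s a) = L.g a b * res inf_le_right (s b))
    (a b : L.I) :
    res (V := f ⁻¹ᵁ L.U a ⊓ f ⁻¹ᵁ L.U b) inf_le_left (pull f (V := f ⁻¹ᵁ L.U a) le_rfl (s a)) =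
      pull f (inf_le_preimage f _ _) (L.g a b) *
        res inf_le_right (pull f (V := f ⁻¹ᵁ L.U b) le_rfl (s b)) := by
  have h := congrArg (pull f (inf_le_preimage f _ _)) (hs a b)
  rw [map_mul, pull_res, pull_res] at h
  rw [res_pull, res_pull]
  exact h

/-- The pull-back of sections `H^0(X, L) → H^0(Y, f^* L)`. -/
def pullH0 [X.Over (Spec (.of F))] [Y.Over (Spec (.of F))] (L : LineBundle X) (f : Y ⟶ X)
    [f.IsOver (Spec (.of F))] : H0 F L →ₗ[F] H0 F (L.pullback f) where
  toFun s := ⟨fun a ↦ pull f le_rfl (s.1 a), pull_compat L f s.1 s.2⟩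
  map_add' s t := Subtype.ext <| funext fun a ↦ map_add (pull f le_rfl) (s.1 a) (t.1 a)
  map_smul' c s := Subtype.ext <| funext fun (a : L.I) ↦ by
    change pull f (V := f ⁻¹ᵁ L.U a) le_rfl (scalar (X ↘ Spec (.of F)) (L.U a) c * s.1 a) =
      scalar (Y ↘ Spec (.of F)) (f ⁻¹ᵁ L.U a) c * pull f le_rfl (s.1 a)
    rw [map_mul, pull_scalar, comp_over]

lemma mul_compat (L M : LineBundle X) (s : ∀ a, Γ(X, L.U a)) (t : ∀ a, Γ(X, M.U a))
    (hs : ∀ a b, res (V := L.U a ⊓ L.U b) inf_le_left (s a) = L.g a b * res inf_le_right (s b))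
    (ht : ∀ a b, res (V := M.U a ⊓ M.U b) inf_le_left (t a) = M.g a b * res inf_le_right (t b))
    (a b : L.I × M.I) :
    res (V := L.U a.1 ⊓ M.U a.2 ⊓ (L.U b.1 ⊓ M.U b.2)) inf_le_left
        (res (V := L.U a.1 ⊓ M.U a.2) inf_le_left (s a.1) * res inf_le_right (t a.2)) =
      (res (inf_le_inf inf_le_left inf_le_left) (L.g a.1 b.1) *
        res (inf_le_inf inf_le_right inf_le_right) (M.g a.2 b.2)) *
        res inf_le_right
          (res (V := L.U b.1 ⊓ M.U b.2) inf_le_left (s b.1) * res inf_le_right (t b.2)) := by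
  have e : L.U a.1 ⊓ M.U a.2 ⊓ (L.U b.1 ⊓ M.U b.2) ≤ L.U a.1 ⊓ L.U b.1 :=
    inf_le_inf inf_le_left inf_le_left
  have e' : L.U a.1 ⊓ M.U a.2 ⊓ (L.U b.1 ⊓ M.U b.2) ≤ M.U a.2 ⊓ M.U b.2 :=
    inf_le_inf inf_le_right inf_le_right
  have h := congrArg (res e) (hs a.1 b.1)
  have h' := congrArg (res e') (ht a.2 b.2)
  simp only [map_mul, res_res] at h h' ⊢
  rw [h, h']
  ring

/-- The multiplication of sections `H^0(X, L) × H^0(X, M) → H^0(X, L ⊗ M)`. -/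
def mulH0 [X.Over (Spec (.of F))] (L M : LineBundle X) :
    H0 F L →ₗ[F] H0 F M →ₗ[F] H0 F (L.tensor M) :=
  LinearMap.mk₂ F
    (fun s t ↦ ⟨fun a ↦ res inf_le_left (s.1 a.1) * res inf_le_right (t.1 a.2),
      mul_compat L M s.1 t.1 s.2 t.2⟩)
    (fun s s' t ↦ Subtype.ext <| funext fun a ↦ by
      change res _ (s.1 a.1 + s'.1 a.1) * _ = _ * _ + _ * _
      rw [map_add, add_mul])
    (fun c s t ↦ Subtype.ext <| funext fun (a : L.I × M.I) ↦ by
      change res inf_le_left (scalar (X ↘ Spec (.of F)) (L.U a.1) c * s.1 a.1) *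
          res inf_le_right (t.1 a.2) =
        scalar (X ↘ Spec (.of F)) (L.U a.1 ⊓ M.U a.2) c *
          (res inf_le_left (s.1 a.1) * res inf_le_right (t.1 a.2))
      rw [map_mul, res_scalar, mul_assoc])
    (fun s t t' ↦ Subtype.ext <| funext fun a ↦ by
      change _ * res _ (t.1 a.2 + t'.1 a.2) = _ * _ + _ * _
      rw [map_add, mul_add])
    (fun c s t ↦ Subtype.ext <| funext fun (a : L.I × M.I) ↦ by
      change res inf_le_left (s.1 a.1) *
          res inf_le_right (scalar (X ↘ Spec (.of F)) (M.U a.2) c * t.1 a.2) =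
        scalar (X ↘ Spec (.of F)) (L.U a.1 ⊓ M.U a.2) c *
          (res inf_le_left (s.1 a.1) * res inf_le_right (t.1 a.2))
      rw [map_mul, res_scalar, mul_left_comm])

end LineBundle

open LineBundle

/-! ### Symmetric powers of a linear system -/

/-- The `t`-th symmetric power `Sym_t(V)`, as the degree `t` part of the symmetric algebra. -/
def SymPow (F : Type*) [Field F] (V : Type*) [AddCommGroup V] [Module F V] (t : ℕ) :
    Submodule F (SymmetricAlgebra F V) :=
  LinearMap.range (SymmetricAlgebra.ι F V) ^ t

section symMap

variable {X : Scheme.{u}} {F : Type u} [Field F] [X.Over (Spec (.of F))]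

/-- The algebra homomorphism from the symmetric algebra of a linear system `V ⊆ H^0(X, L)` to the
ring of families of functions: it multiplies the local expressions of sections. -/
def symAlgMap (L : LineBundle X) (V : Submodule F (H0 F L)) :
    SymmetricAlgebra F V →ₐ[F] L.Family :=
  SymmetricAlgebra.lift ((H0 F L).subtype ∘ₗ V.subtype)

lemma symAlgMap_mem (L : LineBundle X) (V : Submodule F (H0 F L)) (t : ℕ)
    (x : SymmetricAlgebra F V) (hx : x ∈ SymPow F V t) :
    (symAlgMap L V x : ∀ a, Γ(X, L.U a)) ∈ H0 F (L.pow t) := by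
  suffices h : ∀ a b : L.I, res (V := L.U a ⊓ L.U b) inf_le_left (symAlgMap L V x a) =
      L.g a b ^ t * res inf_le_right (symAlgMap L V x b) from h
  induction hx using Submodule.pow_induction_on_left' with
  | algebraMap r =>
    intro a b
    have h : ∀ a, symAlgMap L V (algebraMap F _ r) a = scalar (X ↘ Spec (.of F)) (L.U a) r :=
      fun a ↦ congrFun (AlgHom.commutes (symAlgMap L V) r) a
    rw [h, h, pow_zero, one_mul, res_scalar, res_scalar]
  | add x y i hx hy h h' =>
    intro a b
    have e : ∀ a, symAlgMap L V (x + y) a = symAlgMap L V x a + symAlgMap L V y a :=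
      fun a ↦ congrFun (map_add (symAlgMap L V) x y) a
    rw [e, e, map_add, map_add, h, h', mul_add]
  | mem_mul m hm i x hx h =>
    intro a b
    obtain ⟨v, rfl⟩ := hm
    have h₁ : res (V := L.U a ⊓ L.U b) inf_le_left (v.1.1 a) =
      L.g a b * res inf_le_right (v.1.1 b) := v.1.2 a b
    have h₃ : symAlgMap L V (SymmetricAlgebra.ι F V v * x) = v.1.1 * symAlgMap L V x := by
      rw [map_mul, symAlgMap, SymmetricAlgebra.lift_ι_apply]
      rfl
    have e : ∀ a, symAlgMap L V (SymmetricAlgebra.ι F V v * x) a =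
      v.1.1 a * symAlgMap L V x a := fun a ↦ congrFun h₃ a
    rw [e, e, map_mul, map_mul, h₁, h, pow_succ]
    ring

/-- The multiplication map `Sym_t(V) → H^0(X, L^t)` of a linear system `V ⊆ H^0(X, L)`. -/
def symMap (L : LineBundle X) (V : Submodule F (H0 F L)) (t : ℕ) :
    SymPow F V t →ₗ[F] H0 F (L.pow t) where
  toFun x := ⟨symAlgMap L V x.1, symAlgMap_mem L V t x.1 x.2⟩
  map_add' x y := Subtype.ext (map_add (symAlgMap L V) x.1 y.1)
  map_smul' c x := Subtype.ext (map_smul (symAlgMap L V) c x.1)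

end symMap

/-! ### Projective space -/

/-- Projective space `P^m` over `F`. -/
abbrev PSpace (F : Type u) [Field F] (m : ℕ) : Scheme.{u} :=
  Proj (MvPolynomial.homogeneousSubmodule (Fin (m + 1)) F)

section PSpace

variable (F : Type u) [Field F] (m : ℕ)

instance : (PSpace F m).Over (Spec (.of F)) where
  hom := Proj.toSpecZero (MvPolynomial.homogeneousSubmodule (Fin (m + 1)) F) ≫
    Spec.map (CommRingCat.ofHom
      (algebraMap F (MvPolynomial.homogeneousSubmodule (Fin (m + 1)) F 0)))

variable {m}

/-- The standard open subset `D_+(x_i)` of `P^m`. -/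
def chart (i : Fin (m + 1)) : (PSpace F m).Opens :=
  Proj.basicOpen (MvPolynomial.homogeneousSubmodule (Fin (m + 1)) F) (MvPolynomial.X i)

lemma X_mem (i : Fin (m + 1)) :
    (MvPolynomial.X i : MvPolynomial (Fin (m + 1)) F) ∈
      MvPolynomial.homogeneousSubmodule (Fin (m + 1)) F 1 :=
  MvPolynomial.isHomogeneous_X F i

lemma X_mem' (i : Fin (m + 1)) :
    (MvPolynomial.X i : MvPolynomial (Fin (m + 1)) F) ∈
      MvPolynomial.homogeneousSubmodule (Fin (m + 1)) F (1 • 1) :=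
  MvPolynomial.isHomogeneous_X F i

/-- The regular function `x_j / x_i` on `D_+(x_i)`. -/
def ratio (i j : Fin (m + 1)) : Γ(PSpace F m, chart F i) :=
  (Proj.awayToSection (MvPolynomial.homogeneousSubmodule (Fin (m + 1)) F) (MvPolynomial.X i)).hom
    (HomogeneousLocalization.Away.mk (MvPolynomial.homogeneousSubmodule (Fin (m + 1)) F)
      (X_mem F i) 1 (MvPolynomial.X j) (X_mem' F j))

lemma ratio_self (i : Fin (m + 1)) : ratio F i i = 1 := by
  have h : HomogeneousLocalization.Away.mk (MvPolynomial.homogeneousSubmodule (Fin (m + 1)) F)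
      (X_mem F i) 1 (MvPolynomial.X i) (X_mem' F i) = 1 := by
    apply HomogeneousLocalization.val_injective
    rw [HomogeneousLocalization.Away.val_mk, HomogeneousLocalization.val_one,
      ← Localization.mk_self (⟨MvPolynomial.X i, 1, pow_one _⟩ : Submonoid.powers _)]
    congr 1
    exact Subtype.ext (pow_one _)
  exact (congrArg _ h).trans (map_one _)

lemma ratio_val (i j : Fin (m + 1)) (p : chart F i) :
    HomogeneousLocalization.val ((ratio F i j).1 p) =
      Localization.mk (MvPolynomial.X j) ⟨MvPolynomial.X i, p.2⟩ := by
  refine (ProjectiveSpectrum.Proj.awayToSection_apply _ _ _ p).trans ?_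
  rw [HomogeneousLocalization.Away.val_mk, Localization.mk_eq_mk', IsLocalization.map_mk',
    Localization.mk_eq_mk']
  congr 1
  exact Subtype.ext (pow_one _)

lemma ratio_cocycle (i j k : Fin (m + 1)) {V : (PSpace F m).Opens} (hi : V ≤ chart F i)
    (hj : V ≤ chart F j) :
    res hi (ratio F i j) * res hj (ratio F j k) = res hi (ratio F i k) := by
  apply Subtype.ext
  funext p
  apply HomogeneousLocalization.val_injective
  refine (HomogeneousLocalization.val_mul _ _).trans ?_
  refine (congrArg₂ (· * ·) (ratio_val F i j ⟨p.1, hi p.2⟩)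
    (ratio_val F j k ⟨p.1, hj p.2⟩)).trans (Eq.trans ?_ (ratio_val F i k ⟨p.1, hi p.2⟩).symm)
  rw [Localization.mk_mul, Localization.mk_eq_mk_iff, Localization.r_iff_exists]
  refine ⟨1, ?_⟩
  simp only [OneMemClass.coe_one, one_mul, Submonoid.coe_mul]
  ring

/-- The function `x_j / x_i` as a unit on `D_+(x_i) ∩ D_+(x_j)`. -/
def ratioUnit (i j : Fin (m + 1)) : Γ(PSpace F m, chart F i ⊓ chart F j)ˣ where
  val := res inf_le_left (ratio F i j)
  inv := res inf_le_right (ratio F j i)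
  val_inv := by rw [ratio_cocycle, ratio_self, map_one]
  inv_val := by rw [ratio_cocycle, ratio_self, map_one]

lemma iSup_chart : ⨆ i, chart F (m := m) i = ⊤ := by
  refine Proj.iSup_basicOpen_eq_top' _ _ (fun i ↦ ⟨1, X_mem F i⟩) ?_
  rw [← top_le_iff]
  intro f _
  induction f using MvPolynomial.induction_on with
  | C a =>
    exact Subalgebra.algebraMap_mem _
      (algebraMap F (MvPolynomial.homogeneousSubmodule (Fin (m + 1)) F 0) a)
  | add p q hp hq => exact add_mem (hp trivial) (hq trivial)
  | mul_X p i hp => exact mul_mem (hp trivial) (Algebra.subset_adjoin ⟨i, rfl⟩)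

variable (m) in
/-- The line bundle `O(d)` on `P^m`, for `d ∈ ℤ`: on `D_+(x_i)` it is trivialised by `x_i^d`, so a
section `s = s_i x_i^d = s_j x_j^d` satisfies `s_i = (x_j / x_i)^d s_j`. -/
def twist (d : ℤ) : LineBundle (PSpace F m) where
  I := Fin (m + 1)
  U := chart F
  g i j := ((ratioUnit F i j ^ d : Γ(PSpace F m, chart F i ⊓ chart F j)ˣ) :
    Γ(PSpace F m, chart F i ⊓ chart F j))
  cover := iSup_chart F
  g_self i := by
    have h : ratioUnit F i i = 1 := Units.ext (by
      change res _ (ratio F i i) = 1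
      rw [ratio_self, map_one])
    rw [h, one_zpow, Units.val_one]
  cocycle i j k := by
    have e : ∀ {V : (PSpace F m).Opens} (i j : Fin (m + 1)) (h : V ≤ chart F i ⊓ chart F j),
      res h ((ratioUnit F i j ^ d : Γ(PSpace F m, chart F i ⊓ chart F j)ˣ) :
        Γ(PSpace F m, chart F i ⊓ chart F j)) =
      ((Units.map (res h).toMonoidHom (ratioUnit F i j) ^ d : Γ(PSpace F m, V)ˣ) :
        Γ(PSpace F m, V)) := fun i j h ↦ by
          rw [← map_zpow]
          rfl
    rw [e, e, e, ← Units.val_mul, ← mul_zpow]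
    congr 2
    apply Units.ext
    change res _ (res _ (ratio F i j)) * res _ (res _ (ratio F j k)) =
      res _ (res _ (ratio F i k))
    rw [res_res, res_res, res_res, ratio_cocycle]

end PSpace

/-! ### The multiplication map attached to a finite morphism -/

section multMap

variable (F : Type u) [Field F] {n s : ℕ} {X : Scheme.{u}} [X.Over (Spec (.of F))]
  (i : X ⟶ PSpace F n) [i.IsOver (Spec (.of F))]
  (φ : X ⟶ PSpace F s) [φ.IsOver (Spec (.of F))]

/-- The line bundle `L = φ^* O(1)` on `X`. -/
def lineBundle : LineBundle X := (twist F s 1).pullback φ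

/-- The linear system `V = φ^* H^0(P^s, O(1)) ⊆ H^0(X, L)`. -/
def linearSystem : Submodule F (H0 F (lineBundle F φ)) :=
  LinearMap.range (pullH0 (twist F s 1) φ)

/-- The line bundle `L^t(e) = L^t ⊗ O_X(e)` on `X`, where `O_X(e) = i^* O(e)`. -/
def twistedPower (e : ℤ) (t : ℕ) : LineBundle X :=
  ((twist F n e).pullback i).tensor ((lineBundle F φ).pow t)

/-- The map `H^0(P^n, O(e)) ⊗ Sym_t(V) → H^0(X, L^t(e))`, `a ⊗ v ↦ i^* a · v`. -/
def multMap (e : ℤ) (t : ℕ) :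
    (H0 F (twist F n e) ⊗[F] SymPow F (linearSystem F φ) t) →ₗ[F] H0 F (twistedPower F i φ e t) :=
  TensorProduct.lift
    ((mulH0 ((twist F n e).pullback i) ((lineBundle F φ).pow t)).compl₁₂
      (pullH0 (twist F n e) i) (symMap (lineBundle F φ) (linearSystem F φ) t))

end multMap

/-! ### Castelnuovo-Mumford regularity -/

section regularity

variable {K : Type u} [Field K] {n : ℕ}

/-- Let `I` be a homogeneous ideal of `S = K[x_0, …, x_n]` and `σ` a set of indices. This is the
degree `d` part of the localisation of `I` at `∏_{k ∈ σ} x_k`, inside the field of fractions of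
`S`; in other words, the sections of `Ĩ(d)` over the intersection of the `D_+(x_k)`, `k ∈ σ`. -/
def locDeg (I : Ideal (MvPolynomial (Fin (n + 1)) K)) (d : ℤ) (σ : Finset (Fin (n + 1))) :
    Set (FractionRing (MvPolynomial (Fin (n + 1)) K)) :=
  {f | ∃ (N e : ℕ) (p : MvPolynomial (Fin (n + 1)) K), p ∈ I ∧ p.IsHomogeneous e ∧
    (e : ℤ) = d + N * σ.card ∧
    f * algebraMap (MvPolynomial (Fin (n + 1)) K) _ ((∏ k ∈ σ, MvPolynomial.X k) ^ N) =
      algebraMap _ _ p}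

/-- The Čech `q`-cochains of the sheaf `Ĩ(d)` on `P^n` for the standard cover: a family `c σ` of
sections over `D_+(x_{σ 0}) ∩ … ∩ D_+(x_{σ q})`, for the index sequences `σ 0 < … < σ q`. Here
`p` is the number `q + 1` of indices. -/
def IsCochain (I : Ideal (MvPolynomial (Fin (n + 1)) K)) (d : ℤ) {p : ℕ}
    (c : (Fin p ↪o Fin (n + 1)) → FractionRing (MvPolynomial (Fin (n + 1)) K)) : Prop :=
  ∀ σ, c σ ∈ locDeg I d (Finset.univ.map σ.toEmbedding)

/-- The Čech differential, `(δ c) (σ 0, …, σ p) = ∑ k, (-1) ^ k * c (σ 0, …, omit σ k, …, σ p)`. -/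
def cechD {p : ℕ} (c : (Fin p ↪o Fin (n + 1)) → FractionRing (MvPolynomial (Fin (n + 1)) K))
    (σ : Fin (p + 1) ↪o Fin (n + 1)) : FractionRing (MvPolynomial (Fin (n + 1)) K) :=
  ∑ k : Fin (p + 1), (-1) ^ (k : ℕ) * c ((Fin.succAboveOrderEmb k).trans σ)

/-- The vanishing of the Čech cohomology group `H^q(P^n, Ĩ(d))`, for `q ≥ 1`: every `q`-cocycle is
the coboundary of a `(q - 1)`-cochain. -/
def CechVanishes (I : Ideal (MvPolynomial (Fin (n + 1)) K)) (q : ℕ) (d : ℤ) : Prop :=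
  ∀ c : (Fin (q + 1) ↪o Fin (n + 1)) → FractionRing (MvPolynomial (Fin (n + 1)) K),
    IsCochain I d c → cechD c = 0 →
      ∃ b : (Fin q ↪o Fin (n + 1)) → FractionRing (MvPolynomial (Fin (n + 1)) K),
        IsCochain I d b ∧ cechD b = c

/-- `r` is the Castelnuovo-Mumford regularity of the closed subscheme of `P^n` with homogeneous
ideal `I`: the least integer `r` with `H^q(P^n, Ĩ(r - q)) = 0` for all `q > 0`, with the convention
that the regularity is `1` if the subscheme is all of `P^n`, that is, if `I = 0`. -/
def IsRegularity (I : Ideal (MvPolynomial (Fin (n + 1)) K)) (r : ℤ) : Prop :=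
  (I = ⊥ ∧ r = 1) ∨
    (I ≠ ⊥ ∧ IsLeast {r : ℤ | ∀ q : ℕ, 0 < q → CechVanishes I q (r - q)} r)

variable {F : Type u} [Field F]

/-- Let `Z` be a scheme over a field extension `K` of `F`, and `i : Z ⟶ P^n_F` a morphism over `F`;
equivalently, we are given a `K`-morphism `j : Z ⟶ P^n_K`. This is the homogeneous ideal of `j(Z)`
in `K[x_0, …, x_n]`: it is generated by the homogeneous polynomials `f` such that, for each `k`,
the function `f (x_0 / x_k, …, x_n / x_k)` vanishes on the part of `Z` over `D_+(x_k)`. -/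
def homogeneousIdeal {Z : Scheme.{u}} (i : Z ⟶ PSpace F n) (q : Z ⟶ Spec (.of K)) :
    Ideal (MvPolynomial (Fin (n + 1)) K) :=
  Ideal.span {f | (∃ d, f.IsHomogeneous d) ∧ ∀ k : Fin (n + 1),
    MvPolynomial.eval₂ (scalar q (i ⁻¹ᵁ chart F k))
      (fun l ↦ pull i le_rfl (ratio F k l)) f = 0}

/-- Let `i : X ⟶ P^n` be a closed immersion and `φ : X ⟶ P^s` a morphism of `F`-schemes. The
scheme-theoretic fiber `X_y` of `φ` over a point `y` with residue field `κ(y)` is a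
`κ(y)`-scheme, embedded in `P^n_{κ(y)}` by means of `i`. This is its homogeneous ideal in
`κ(y)[x_0, …, x_n]`. -/
def fiberIdeal {s : ℕ} {X : Scheme.{u}} (i : X ⟶ PSpace F n) (φ : X ⟶ PSpace F s)
    (y : PSpace F s) : Ideal (MvPolynomial (Fin (n + 1)) ((PSpace F s).residueField y)) :=
  homogeneousIdeal (φ.fiberι y ≫ i) (φ.fiberToSpecResidueField y)

end regularity

end FiberRegularity

end

open FiberRegularity

/-!
The proof replaces both sides of the equality by the question in which degrees `e` the sections of
a twist `O(e)` on an affine scheme in projective space are homogeneous polynomials of degree `e`.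

For an affine scheme `Y` over `B`, immersed in `P^n_B`, the rings of functions on the sets
`Y ∩ D_+(x_k)`, the evaluation of polynomials on them and the modules of sections of `O_Y(d)` form
a `SectionSystem`, and `SectionSystem.Gen e` says that every section of `O_Y(e)` is a polynomial.
As `Y` is affine, the sections `x_k ^ N` generate `O_Y(N)`; therefore `Gen e` implies `Gen (e + 1)`
(`SectionSystem.Gen.mono`). If `Y` is finite over `B`, then `Gen e` holds for large `e`
(`SectionSystem.exists_forall_gen`).

*Regularity.* If `Y` is finite over a field, its regularity is the least `r ≥ 0` for which
`Gen (r - 1)` holds (`SectionSystem.isRegularity_iff`). Indeed, the structure sheaf of `Y` has no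
higher cohomology, and that of `O(d)` on `P^n` vanishes in positive degrees for `d > -n - 1`, so
that the ideal sheaf has no cohomology in degrees `q ≥ 2`, and `H^1` of its twist by `e` is the
cokernel of the evaluation of polynomials of degree `e`
(`SectionSystem.setVanishes_of_two_le`, `SectionSystem.Gen.setVanishes_one`,
`SectionSystem.gen_of_setVanishes_one`). The bound `r ≥ 0` matters for the empty scheme only, which
satisfies `Gen e` for all `e`, but whose ideal sheaf `O` has nonzero top cohomology in degrees
`d ≤ -n - 1` (`SectionSystem.not_setVanishes`). All this takes place in the Čech complexes of graded
submodules of free modules over a polynomial ring. These are treated as complexes of cochains on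
finite sets of indices, for which contraction with one index is a homotopy (`setD_contract_add`).

*Passage to fibres.* Over `D_+(y_j)` the scheme `X` is affine and finite over the base. The functor
of sections over an affine scheme is exact, so Nakayama's lemma shows that `Gen e` holds over
`D_+(y_j)` if and only if it holds on the fibres over all closed points of `D_+(y_j)`
(`gen_xSystem`, `gen_fibreSystem`).

*The multiplication map.* It is surjective for all large `t` if and only if `Gen e` holds over all
the `D_+(y_j)` (`eventually_surjective_multMap_iff`). On the one hand, a section over `D_+(y_j)`
extends to a section of `L^t(e)` on `X` after multiplication by `y_j ^ t` for large `t`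
(`exists_extension`), and elements in the image of the multiplication map are polynomials in `x`
over `D_+(y_j)`. On the other hand, if `Gen e` holds, then the sections of `O_X(e)` over the
`D_+(y_j)` form a quotient of a free sheaf on `P^s` with basis the monomials of degree `e` in `x`,
and by Serre vanishing for the sheaf of relations between these monomials a global section of a
large twist of the quotient lifts to the free sheaf (`exists_forall_setD_eq`, `exists_forall_lift`).

Hence the degrees `e` for which the multiplication map is surjective for all large `t` are those for
which every fibre has regularity at most `e + 1`. If `ε` is the least of them, then `Gen (ε - 1)`
fails on some closed fibre, whose regularity is therefore `ε + 1`.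
-/

noncomputable section

namespace FiberRegularity

/-! ### Cochains indexed by finite sets -/

section Cochains

variable {ι : Type*} [LinearOrder ι] {A A' : Type*} [AddCommGroup A] [AddCommGroup A']

/-- The sign `(-1) ^ #{j ∈ σ | j < k}` with which `k` enters the set `σ`. -/
def cechSign (k : ι) (σ : Finset ι) : ℤ := (-1) ^ (σ.filter (· < k)).card

lemma cechSign_mul_self (k : ι) (σ : Finset ι) : cechSign k σ * cechSign k σ = 1 := by
  rw [cechSign, ← mul_pow]
  simp

lemma cechSign_erase_self (k : ι) (σ : Finset ι) : cechSign k (σ.erase k) = cechSign k σ := by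
  rw [cechSign, cechSign, Finset.filter_erase, Finset.erase_eq_of_notMem (by simp)]

lemma cechSign_insert_self (k : ι) (σ : Finset ι) : cechSign k (insert k σ) = cechSign k σ := by
  rw [cechSign, cechSign, Finset.filter_insert, if_neg (lt_irrefl k)]

lemma cechSign_insert_of_lt {k l : ι} {σ : Finset ι} (h : l < k) (hl : l ∉ σ) :
    cechSign k (insert l σ) = -cechSign k σ := by
  rw [cechSign, cechSign, Finset.filter_insert, if_pos h,
    Finset.card_insert_of_notMem (by simp [hl]), pow_succ, mul_neg_one]

lemma cechSign_insert_of_gt {k l : ι} {σ : Finset ι} (h : k < l) :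
    cechSign k (insert l σ) = cechSign k σ := by
  rw [cechSign, cechSign, Finset.filter_insert, if_neg h.not_gt]

lemma cechSign_erase_of_lt {k l : ι} {σ : Finset ι} (h : l < k) (hl : l ∈ σ) :
    cechSign k (σ.erase l) = -cechSign k σ := by
  rw [← neg_eq_iff_eq_neg, ← cechSign_insert_of_lt h (Finset.notMem_erase l σ),
    Finset.insert_erase hl]

lemma cechSign_erase_of_gt {k l : ι} {σ : Finset ι} (h : k < l) (hl : l ∈ σ) :
    cechSign k (σ.erase l) = cechSign k σ := by
  rw [← cechSign_insert_of_gt (σ := σ.erase l) h, Finset.insert_erase hl]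

/-- The Čech differential on cochains indexed by all finite sets of indices. -/
def setD (c : Finset ι → A) (σ : Finset ι) : A := ∑ k ∈ σ, cechSign k σ • c (σ.erase k)

/-- The contraction with the index `k`, a homotopy between the identity and zero. -/
def contract (k : ι) (c : Finset ι → A) (σ : Finset ι) : A :=
  if k ∈ σ then 0 else cechSign k σ • c (insert k σ)

lemma contract_of_mem {k : ι} {σ : Finset ι} (h : k ∈ σ) (c : Finset ι → A) :
    contract k c σ = 0 := if_pos h

lemma contract_of_notMem {k : ι} {σ : Finset ι} (h : k ∉ σ) (c : Finset ι → A) :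
    contract k c σ = cechSign k σ • c (insert k σ) := if_neg h

/-- Exchanging two different indices changes the product of the signs by `-1`. -/
lemma cechSign_exchange {k m : ι} {σ : Finset ι} (hm : m ∉ σ) (hk : k ∈ σ) :
    cechSign m σ * cechSign k (insert m σ) = -(cechSign k σ * cechSign m (σ.erase k)) := by
  rcases lt_trichotomy k m with h | h | h
  · rw [cechSign_insert_of_gt h, cechSign_erase_of_lt h hk]
    ring
  · exact absurd (h ▸ hk) hm
  · rw [cechSign_insert_of_lt h hm, cechSign_erase_of_gt h hk]
    ring

/-- `contract m` is a homotopy between the identity and zero. -/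
lemma setD_contract_add (m : ι) (c : Finset ι → A) (σ : Finset ι) :
    setD (contract m c) σ + contract m (setD c) σ = c σ := by
  by_cases hm : m ∈ σ
  · rw [contract_of_mem hm, add_zero, setD, Finset.sum_eq_single_of_mem m hm]
    · rw [contract_of_notMem (Finset.notMem_erase m σ), smul_smul, cechSign_erase_self,
        cechSign_mul_self, one_smul, Finset.insert_erase hm]
    · intro k _ hkm
      rw [contract_of_mem (Finset.mem_erase.2 ⟨hkm.symm, hm⟩), smul_zero]
  · rw [contract_of_notMem hm, setD, setD, Finset.sum_insert hm, Finset.erase_insert hm,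
      smul_add, smul_smul, cechSign_insert_self, cechSign_mul_self, one_smul, add_left_comm,
      add_eq_left, Finset.smul_sum, ← Finset.sum_add_distrib]
    refine Finset.sum_eq_zero fun k hk ↦ ?_
    have hkm : m ≠ k := fun h ↦ hm (h ▸ hk)
    rw [contract_of_notMem (fun h ↦ hm (Finset.mem_of_mem_erase h)), smul_smul, smul_smul,
      cechSign_exchange hm hk, Finset.erase_insert_of_ne hkm, neg_smul, add_neg_cancel]

lemma setD_sub (c c' : Finset ι → A) (σ : Finset ι) :
    setD (fun τ ↦ c τ - c' τ) σ = setD c σ - setD c' σ := by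
  simp only [setD, smul_sub, Finset.sum_sub_distrib]

lemma setD_sum {κ : Type*} (s : Finset κ) (c : κ → Finset ι → A) (σ : Finset ι) :
    setD (fun τ ↦ ∑ i ∈ s, c i τ) σ = ∑ i ∈ s, setD (c i) σ := by
  simp only [setD, Finset.smul_sum]
  exact Finset.sum_comm

lemma setD_map (f : A →+ A') (c : Finset ι → A) (σ : Finset ι) :
    setD (fun τ ↦ f (c τ)) σ = f (setD c σ) := by
  simp only [setD, map_sum, map_zsmul]

lemma contract_map (f : A →+ A') (m : ι) (c : Finset ι → A) (σ : Finset ι) :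
    contract m (fun τ ↦ f (c τ)) σ = f (contract m c σ) := by
  unfold contract
  split_ifs <;> simp

lemma setD_congr {c c' : Finset ι → A} {σ : Finset ι}
    (h : ∀ τ, τ.card + 1 = σ.card → c τ = c' τ) : setD c σ = setD c' σ :=
  Finset.sum_congr rfl fun k hk ↦ by rw [h _ (Finset.card_erase_add_one hk)]

/-- `setD ∘ setD = 0`: since `contract m` is a homotopy, `setD ∘ setD` commutes with `contract m`,
which allows an induction on the number of indices. -/
lemma setD_setD (c : Finset ι → A) (σ : Finset ι) : setD (setD c) σ = 0 := by
  induction σ using Finset.induction_on generalizing c with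
  | empty => rfl
  | insert m σ hm ih =>
    have h₁ : setD (setD (contract m c)) σ + setD (contract m (setD c)) σ = setD c σ := by
      unfold setD
      rw [← Finset.sum_add_distrib]
      refine Finset.sum_congr rfl fun k _ ↦ ?_
      rw [← smul_add]
      exact congrArg _ (setD_contract_add m c (σ.erase k))
    have h₂ := setD_contract_add m (setD c) σ
    rw [ih, zero_add] at h₁
    rw [h₁, add_eq_left, contract_of_notMem hm] at h₂
    have h₃ := congrArg (cechSign m σ • ·) h₂
    simpa [smul_smul, cechSign_mul_self] using h₃

/-- The Čech differential on ordered index sequences agrees with the one on index sets. -/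
lemma sum_orderEmb_eq_setD {m p : ℕ} (c : Finset (Fin m) → A) (σ : Fin (p + 1) ↪o Fin m) :
    ∑ k : Fin (p + 1), (-1 : ℤ) ^ (k : ℕ) •
      c (Finset.univ.map ((Fin.succAboveOrderEmb k).trans σ).toEmbedding) =
    setD c (Finset.univ.map σ.toEmbedding) := by
  rw [setD, Finset.sum_map]
  refine Finset.sum_congr rfl fun k _ ↦ ?_
  congr 1
  · rw [cechSign, Finset.filter_map, Finset.card_map]
    congr 1
    rw [← Fin.card_Iio k]
    congr 1
    ext x
    simp
  · congr 1
    ext x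
    simp only [Finset.mem_map, Finset.mem_univ, true_and, Finset.mem_erase]
    constructor
    · rintro ⟨a, rfl⟩
      refine ⟨fun h ↦ Fin.succAbove_ne k a (σ.injective h), ⟨_, rfl⟩⟩
    · rintro ⟨h, a, rfl⟩
      obtain ⟨b, hb⟩ := Fin.exists_succAbove_eq (x := a) (y := k) fun e ↦ h (by rw [e])
      exact ⟨b, congrArg σ hb⟩

lemma exists_orderEmb {m p : ℕ} (σ : Finset (Fin m)) (h : σ.card = p) :
    ∃ e : Fin p ↪o Fin m, Finset.univ.map e.toEmbedding = σ :=
  ⟨σ.orderEmbOfFin h, σ.map_orderEmbOfFin_univ h⟩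

lemma orderEmb_ext {m p : ℕ} {σ τ : Fin p ↪o Fin m}
    (h : Finset.univ.map σ.toEmbedding = Finset.univ.map τ.toEmbedding) : σ = τ := by
  have key : ∀ σ : Fin p ↪o Fin m, ∀ h, (Finset.univ.map σ.toEmbedding).orderEmbOfFin h = σ := by
    intro σ h
    ext x
    exact congrArg Fin.val (congrFun (Finset.orderEmbOfFin_unique h
      (fun x ↦ Finset.mem_map_of_mem _ (Finset.mem_univ x)) σ.strictMono) x).symm
  rw [← key σ (by simp), ← key τ (by simp)]
  simp only [h]

end Cochains

/-! ### Polynomials homogeneous of an integral degree -/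

section HomZ

open MvPolynomial

variable {σ : Type*} {B : Type*} [CommRing B]

/-- `p` is homogeneous of degree `z ∈ ℤ`. For `z < 0` this means that `p = 0`. -/
def HomZ (p : MvPolynomial σ B) (z : ℤ) : Prop := ∀ d, coeff d p ≠ 0 → (d.degree : ℤ) = z

lemma homZ_natCast {p : MvPolynomial σ B} {d : ℕ} : HomZ p d ↔ p.IsHomogeneous d := by
  constructor
  · intro h e he
    have h' : e.degree = d := by exact_mod_cast h e he
    rw [← h', Finsupp.degree_eq_weight_one]
    rfl
  · intro h e he
    by_contra hne
    exact he (h.coeff_eq_zero (by exact_mod_cast hne))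

lemma HomZ.eq_zero {p : MvPolynomial σ B} {z : ℤ} (h : HomZ p z) (hz : z < 0) : p = 0 := by
  ext d
  by_contra hd
  have := h d hd
  omega

lemma homZ_zero (z : ℤ) : HomZ (0 : MvPolynomial σ B) z := fun d h ↦ absurd (coeff_zero d) h

lemma HomZ.add {p q : MvPolynomial σ B} {z : ℤ} (hp : HomZ p z) (hq : HomZ q z) :
    HomZ (p + q) z := by
  intro d hd
  by_cases h : coeff d p = 0
  · exact hq d fun h' ↦ hd (by rw [coeff_add, h, h', add_zero])
  · exact hp d h

lemma HomZ.sum {κ : Type*} {s : Finset κ} {p : κ → MvPolynomial σ B} {z : ℤ}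
    (h : ∀ i ∈ s, HomZ (p i) z) : HomZ (∑ i ∈ s, p i) z := by
  classical
  induction s using Finset.induction_on with
  | empty => exact homZ_zero z
  | insert a s ha ih =>
    rw [Finset.sum_insert ha]
    exact (h a (by simp)).add (ih fun i hi ↦ h i (by simp [hi]))

lemma HomZ.mul {p q : MvPolynomial σ B} {z w : ℤ} (hp : HomZ p z) (hq : HomZ q w) :
    HomZ (p * q) (z + w) := by
  rcases lt_or_ge z 0 with hz | hz
  · rw [hp.eq_zero hz, zero_mul]
    exact homZ_zero _
  rcases lt_or_ge w 0 with hw | hw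
  · rw [hq.eq_zero hw, mul_zero]
    exact homZ_zero _
  lift z to ℕ using hz
  lift w to ℕ using hw
  exact_mod_cast homZ_natCast.2 ((homZ_natCast.1 hp).mul (homZ_natCast.1 hq))

lemma homZ_C (c : B) : HomZ (C c : MvPolynomial σ B) 0 :=
  homZ_natCast.2 (isHomogeneous_C σ c)

lemma homZ_X (k : σ) : HomZ (X k : MvPolynomial σ B) 1 := by
  exact_mod_cast homZ_natCast.2 (isHomogeneous_X B k)

lemma HomZ.C_mul {p : MvPolynomial σ B} {z : ℤ} (hp : HomZ p z) (c : B) : HomZ (C c * p) z := by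
  simpa using (homZ_C c).mul hp

lemma HomZ.neg {p : MvPolynomial σ B} {z : ℤ} (hp : HomZ p z) : HomZ (-p) z := by
  simpa using hp.C_mul (-1)

lemma HomZ.sub {p q : MvPolynomial σ B} {z : ℤ} (hp : HomZ p z) (hq : HomZ q z) :
    HomZ (p - q) z := by
  rw [sub_eq_add_neg]
  exact hp.add hq.neg

lemma HomZ.pow {p : MvPolynomial σ B} {z : ℤ} (hp : HomZ p z) (N : ℕ) :
    HomZ (p ^ N) (N * z) := by
  induction N with
  | zero => simpa using homZ_C (σ := σ) (1 : B)
  | succ N ih =>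
    rw [pow_succ]
    convert ih.mul hp using 1
    push_cast
    ring

lemma homZ_X_pow (k : σ) (N : ℕ) : HomZ (X k ^ N : MvPolynomial σ B) N := by
  simpa using (homZ_X (B := B) k).pow N

lemma HomZ.prod {s : Finset σ} {N : ℕ} : HomZ ((∏ k ∈ s, X k : MvPolynomial σ B) ^ N)
    (N * s.card) := by
  refine HomZ.pow ?_ N
  refine homZ_natCast.2 ?_
  simpa using IsHomogeneous.prod s (fun k ↦ (X k : MvPolynomial σ B)) (fun _ ↦ 1)
    fun k _ ↦ isHomogeneous_X B k

lemma HomZ.map {B' : Type*} [CommRing B'] {p : MvPolynomial σ B} {z : ℤ} (hp : HomZ p z)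
    (f : B →+* B') : HomZ (MvPolynomial.map f p) z := by
  intro d hd
  rw [coeff_map] at hd
  exact hp d fun h ↦ hd (by rw [h, map_zero])

lemma homZ_monomial (d : σ →₀ ℕ) (c : B) : HomZ (monomial d c) (d.degree : ℤ) := by
  classical
  intro e he
  rw [coeff_monomial] at he
  split_ifs at he with h
  · rw [h]
  · exact absurd rfl he

lemma HomZ.of_monomial_mul {p : MvPolynomial σ B} {e : σ →₀ ℕ} {z : ℤ}
    (h : HomZ (monomial e 1 * p) z) : HomZ p (z - e.degree) := by
  intro d hd
  have := h (e + d) (by rwa [coeff_monomial_mul, one_mul])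
  rw [← this, map_add]
  push_cast
  ring

/-- The component of degree `z ∈ ℤ` of a polynomial. -/
def compZ (z : ℤ) (p : MvPolynomial σ B) : MvPolynomial σ B :=
  if 0 ≤ z then homogeneousComponent z.toNat p else 0

lemma coeff_compZ (z : ℤ) (p : MvPolynomial σ B) (d : σ →₀ ℕ) [Decidable ((d.degree : ℤ) = z)] :
    coeff d (compZ z p) = if (d.degree : ℤ) = z then coeff d p else 0 := by
  unfold compZ
  split_ifs with h h' h'
  · rw [coeff_homogeneousComponent, if_pos (by omega)]
  · rw [coeff_homogeneousComponent, if_neg (by omega)]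
  · omega
  · rfl

lemma homZ_compZ (z : ℤ) (p : MvPolynomial σ B) : HomZ (compZ z p) z := by
  intro d hd
  by_contra h
  rw [coeff_compZ, if_neg h] at hd
  exact hd rfl

lemma compZ_of_homZ {p : MvPolynomial σ B} {z : ℤ} (h : HomZ p z) (w : ℤ) :
    compZ w p = if w = z then p else 0 := by
  ext d
  rw [coeff_compZ]
  split_ifs with h₁ h₂ h₂
  · rfl
  · by_contra hd
    exact h₂ (h₁.symm.trans (h d hd))
  · by_contra hd
    exact h₁ ((h d (Ne.symm hd)).trans h₂.symm)
  · rfl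

lemma compZ_sum {κ : Type*} (s : Finset κ) (p : κ → MvPolynomial σ B) (z : ℤ) :
    compZ z (∑ i ∈ s, p i) = ∑ i ∈ s, compZ z (p i) := by
  unfold compZ
  split_ifs
  · rw [map_sum]
  · simp

lemma compZ_mul {p q : MvPolynomial σ B} {z w : ℤ} (hq : HomZ q w) :
    compZ (z + w) (p * q) = compZ z p * q := by
  conv_lhs => rw [← sum_homogeneousComponent p, Finset.sum_mul]
  conv_rhs => rw [← sum_homogeneousComponent p, compZ_sum, Finset.sum_mul]
  rw [compZ_sum]
  refine Finset.sum_congr rfl fun i _ ↦ ?_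
  have hi := homZ_natCast.2 (homogeneousComponent_isHomogeneous i p)
  rw [compZ_of_homZ (hi.mul hq), compZ_of_homZ hi]
  simp only [add_left_inj]
  split_ifs <;> simp

lemma monomial_dvd_of_coeff {p : MvPolynomial σ B} {e : σ →₀ ℕ}
    (h : ∀ d, coeff d p ≠ 0 → e ≤ d) : monomial e 1 ∣ p := by
  rw [monomial_one_dvd_iff_modMonomial_eq_zero]
  ext d
  rw [coeff_zero]
  by_cases hd : e ≤ d
  · exact coeff_modMonomial_of_le _ hd
  · rw [coeff_modMonomial_of_not_le _ hd]
    by_contra h'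
    exact hd (h d h')

lemma le_of_coeff_monomial_mul {p : MvPolynomial σ B} {e d : σ →₀ ℕ}
    (h : coeff d (monomial e 1 * p) ≠ 0) : e ≤ d := by
  classical
  rw [coeff_monomial_mul'] at h
  by_contra h'
  rw [if_neg h'] at h
  exact h rfl

end HomZ

/-! ### Localisations of graded submodules of a free module -/

section LocMod

open MvPolynomial

variable {m : ℕ} {K : Type*} [Field K] {ι : Type*}

local notation "S" => MvPolynomial (Fin (m + 1)) K
local notation "Q" => FractionRing (MvPolynomial (Fin (m + 1)) K)

/-- A vector of polynomials is homogeneous of degree `z` with respect to the shifts `a` if its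
`i`-th entry is homogeneous of degree `z - a i`. -/
def HomVec (a : ι → ℤ) (p : ι → S) (z : ℤ) : Prop := ∀ i, HomZ (p i) (z - a i)

lemma HomVec.smul {a : ι → ℤ} {p : ι → S} {z w : ℤ} (hp : HomVec a p z) {g : S}
    (hg : HomZ g w) : HomVec a (g • p) (w + z) := fun i ↦ by
  have := hg.mul (hp i)
  rwa [← add_sub_assoc] at this

variable (K) in
/-- The product of the variables with index in `σ`. -/
def varProd (σ : Finset (Fin (m + 1))) : S := ∏ k ∈ σ, X k

lemma varProd_ne_zero (σ : Finset (Fin (m + 1))) : varProd K σ ≠ 0 :=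
  Finset.prod_ne_zero_iff.2 fun k _ ↦ X_ne_zero k

lemma homZ_varProd_pow (σ : Finset (Fin (m + 1))) (M : ℕ) :
    HomZ (varProd K σ ^ M) (M * σ.card) := HomZ.prod

lemma algebraMap_varProd_pow_ne_zero (σ : Finset (Fin (m + 1))) (M : ℕ) :
    algebraMap S Q (varProd K σ ^ M) ≠ 0 :=
  fun h ↦ pow_ne_zero M (varProd_ne_zero σ)
    ((map_eq_zero_iff _ (IsFractionRing.injective S Q)).1 h)

lemma varProd_pow_eq (σ : Finset (Fin (m + 1))) (M : ℕ) :
    varProd K σ ^ M = monomial (∑ k ∈ σ, Finsupp.single k M) 1 := by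
  rw [monomial_sum_one, varProd, ← Finset.prod_pow]
  simp only [X_pow_eq_monomial]

lemma sum_single_le {σ : Finset (Fin (m + 1))} {M : ℕ} {d : Fin (m + 1) →₀ ℕ} :
    ∑ k ∈ σ, Finsupp.single k M ≤ d ↔ ∀ k ∈ σ, M ≤ d k := by
  have h : ∀ k, (∑ l ∈ σ, Finsupp.single l M) k = if k ∈ σ then M else 0 := fun k ↦ by
    rw [Finsupp.finsetSum_apply]
    simp [Finsupp.single_apply]
  constructor
  · intro hd k hk
    have := hd k
    rwa [h, if_pos hk] at this
  · intro hd k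
    rw [h]
    split_ifs with hk
    · exact hd k hk
    · exact Nat.zero_le _

/-- The part of degree `t` of the localisation of `N ⊆ S^ι` at the product of the variables with
index in `σ`, where the `i`-th basis vector of `S^ι` has degree `a i`. -/
def LocMod (N : Submodule S (ι → S)) (a : ι → ℤ) (t : ℤ) (σ : Finset (Fin (m + 1))) :
    AddSubgroup (ι → Q) where
  carrier := {f | ∃ (M : ℕ) (p : ι → S), p ∈ N ∧ HomVec a p (t + M * σ.card) ∧
    ∀ i, f i * algebraMap S Q (varProd K σ ^ M) = algebraMap S Q (p i)}
  zero_mem' := ⟨0, 0, N.zero_mem, fun _ ↦ homZ_zero _, fun i ↦ by simp⟩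
  add_mem' := by
    rintro f g ⟨M, p, hp, hp', hf⟩ ⟨M', q, hq, hq', hg⟩
    refine ⟨M + M', varProd K σ ^ M' • p + varProd K σ ^ M • q,
      N.add_mem (N.smul_mem _ hp) (N.smul_mem _ hq), fun i ↦ HomZ.add ?_ ?_, fun i ↦ ?_⟩
    · convert hp'.smul (homZ_varProd_pow σ M') i using 1
      push_cast
      ring
    · convert hq'.smul (homZ_varProd_pow σ M) i using 1
      push_cast
      ring
    · simp only [Pi.add_apply, Pi.smul_apply, smul_eq_mul, map_add, map_mul, ← hf, ← hg, pow_add]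
      ring
  neg_mem' := by
    rintro f ⟨M, p, hp, hp', hf⟩
    exact ⟨M, -p, N.neg_mem hp, fun i ↦ (hp' i).neg, fun i ↦ by
      rw [Pi.neg_apply, Pi.neg_apply, neg_mul, hf, map_neg]⟩

variable {N : Submodule (MvPolynomial (Fin (m + 1)) K) (ι → MvPolynomial (Fin (m + 1)) K)}
  {a : ι → ℤ} {t : ℤ} {σ : Finset (Fin (m + 1))}

lemma LocMod.mono_left {N' : Submodule S (ι → S)} (h : ∀ p ∈ N, ∀ z, HomVec a p z → p ∈ N')
    {f : ι → Q} (hf : f ∈ LocMod N a t σ) : f ∈ LocMod N' a t σ := by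
  obtain ⟨M, p, hp, hp', hf⟩ := hf
  exact ⟨M, p, h p hp _ hp', hp', hf⟩

/-- The product of an element of the localised ring with an element of the localised module. -/
lemma LocMod.mul_mem {f : ι → Q} (hf : f ∈ LocMod N a t σ) {r : Q} {g : S} {M : ℕ} {d : ℤ}
    (hg : HomZ g (d + M * σ.card)) (hr : r * algebraMap S Q (varProd K σ ^ M) = algebraMap S Q g) :
    (fun i ↦ r * f i) ∈ LocMod N a (d + t) σ := by
  obtain ⟨M', p, hp, hp', hf⟩ := hf
  refine ⟨M + M', g • p, N.smul_mem _ hp, fun i ↦ ?_, fun i ↦ ?_⟩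
  · convert hp'.smul hg i using 1
    push_cast
    ring
  · simp only [Pi.smul_apply, smul_eq_mul, map_mul, ← hf, ← hr, pow_add]
    ring

lemma LocMod.algebraMap_mul_mem {f : ι → Q} (hf : f ∈ LocMod N a t σ) {g : S} {d : ℤ}
    (hg : HomZ g d) : (fun i ↦ algebraMap S Q g * f i) ∈ LocMod N a (d + t) σ :=
  LocMod.mul_mem hf (M := 0) (by simpa using hg) (by simp)

lemma LocMod.mono {f : ι → Q} (hf : f ∈ LocMod N a t σ) {τ : Finset (Fin (m + 1))}
    (h : σ ⊆ τ) : f ∈ LocMod N a t τ := by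
  obtain ⟨M, p, hp, hp', hf⟩ := hf
  refine ⟨M, varProd K (τ \ σ) ^ M • p, N.smul_mem _ hp, fun i ↦ ?_, fun i ↦ ?_⟩
  · convert hp'.smul (homZ_varProd_pow (τ \ σ) M) i using 1
    rw [← Finset.card_sdiff_add_card_eq_card h]
    push_cast
    ring
  · rw [Pi.smul_apply, smul_eq_mul, map_mul, ← hf, varProd, varProd, varProd,
      ← Finset.prod_sdiff h]
    simp only [map_mul, map_pow]
    ring

/-- Multiplication by a power of `x_k` clears the denominators `x_k`. -/
lemma LocMod.exists_pow_mul_mem {k : Fin (m + 1)} {f : ι → Q}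
    (hf : f ∈ LocMod N a t (insert k σ)) : ∃ M₀ : ℕ, ∀ M ≥ M₀,
      (fun i ↦ algebraMap S Q (X k ^ M) * f i) ∈ LocMod N a (M + t) σ := by
  by_cases hk : k ∈ σ
  · rw [Finset.insert_eq_of_mem hk] at hf
    exact ⟨0, fun M _ ↦ LocMod.algebraMap_mul_mem hf (homZ_X_pow k M)⟩
  obtain ⟨M, p, hp, hp', hf⟩ := hf
  refine ⟨M, fun M' hM ↦ ⟨M, X k ^ (M' - M) • p, N.smul_mem _ hp, fun i ↦ ?_, fun i ↦ ?_⟩⟩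
  · convert hp'.smul (homZ_X_pow k (M' - M)) i using 1
    rw [Finset.card_insert_of_notMem hk]
    push_cast [hM]
    ring
  · rw [Pi.smul_apply, smul_eq_mul, map_mul, ← hf, varProd, varProd, Finset.prod_insert hk]
    have : (X k : S) ^ M' = X k ^ (M' - M) * X k ^ M := by rw [← pow_add, Nat.sub_add_cancel hM]
    rw [this]
    simp only [map_mul, map_pow, mul_pow]
    ring

variable (K) in
/-- The product of all variables. -/
def allVars (m : ℕ) : MvPolynomial (Fin (m + 1)) K := varProd K Finset.univ

/-- An element of the localisation of `S^ι` at `x_σ` can be written with a power of the product of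
all variables as its denominator; the monomials of the numerator are then divisible by the powers
of the variables outside `σ`. -/
lemma LocMod.exists_numerator [Finite ι] {f : ι → Q} (hf : f ∈ LocMod N a t σ) :
    ∃ M₀ : ℕ, ∀ M ≥ M₀, ∃ P : ι → S, HomVec a P (t + M * (m + 1)) ∧
      (∀ i d, coeff d (P i) ≠ 0 → ∀ k ∉ σ, M ≤ d k) ∧
      ∀ i, f i * algebraMap S Q (allVars K m ^ M) = algebraMap S Q (P i) := by
  obtain ⟨M₀, p, hp, hp', hf⟩ := hf
  refine ⟨M₀, fun M hM ↦ ⟨varProd K σᶜ ^ M • varProd K σ ^ (M - M₀) • p, fun i ↦ ?_,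
    fun i d hd k hk ↦ ?_, fun i ↦ ?_⟩⟩
  · convert (hp'.smul (homZ_varProd_pow σ (M - M₀))).smul (homZ_varProd_pow σᶜ M) i using 1
    have : (σ.card : ℤ) + σᶜ.card = m + 1 := by
      have := Finset.card_add_card_compl σ
      rw [Fintype.card_fin] at this
      exact_mod_cast this
    rw [← this]
    push_cast [hM]
    ring
  · rw [varProd_pow_eq, Pi.smul_apply, smul_eq_mul] at hd
    exact sum_single_le.1 (le_of_coeff_monomial_mul hd) k (Finset.mem_compl.2 hk)
  · have h : allVars K m = varProd K σᶜ * varProd K σ := by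
      rw [allVars, varProd, varProd, varProd, mul_comm, Finset.prod_mul_prod_compl]
    have h' : varProd K σ ^ M = varProd K σ ^ (M - M₀) * varProd K σ ^ M₀ := by
      rw [← pow_add, Nat.sub_add_cancel hM]
    rw [Pi.smul_apply, Pi.smul_apply, smul_eq_mul, smul_eq_mul, map_mul, map_mul, ← hf, h, mul_pow,
      h', map_mul, map_mul]
    ring

lemma LocMod.of_numerator {f : ι → Q} {M : ℕ} {P : ι → S} (hP : HomVec a P (t + M * (m + 1)))
    (h : ∀ i d, coeff d (P i) ≠ 0 → ∀ k ∉ σ, M ≤ d k)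
    (hf : ∀ i, f i * algebraMap S Q (allVars K m ^ M) = algebraMap S Q (P i)) :
    f ∈ LocMod (⊤ : Submodule S (ι → S)) a t σ := by
  have hdvd : ∀ i, ∃ g, P i = varProd K σᶜ ^ M * g := fun i ↦ by
    rw [varProd_pow_eq]
    exact monomial_dvd_of_coeff fun d hd ↦
      sum_single_le.2 fun k hk ↦ h i d hd k (Finset.mem_compl.1 hk)
  choose g hg using hdvd
  refine ⟨M, g, trivial, fun i ↦ ?_, fun i ↦ ?_⟩
  · have h₁ := hP i
    rw [hg, varProd_pow_eq] at h₁
    convert h₁.of_monomial_mul using 1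
    have h₂ : ((∑ k ∈ σᶜ, Finsupp.single k M : Fin (m + 1) →₀ ℕ).degree : ℤ) = M * σᶜ.card := by
      rw [map_sum]
      simp [mul_comm]
    have : (σ.card : ℤ) + σᶜ.card = m + 1 := by
      have := Finset.card_add_card_compl σ
      rw [Fintype.card_fin] at this
      exact_mod_cast this
    rw [h₂, ← this]
    ring
  · have h' : allVars K m = varProd K σᶜ * varProd K σ := by
      rw [allVars, varProd, varProd, varProd, mul_comm, Finset.prod_mul_prod_compl]
    have h₁ := hf i
    rw [hg, h', mul_pow, map_mul, map_mul, mul_left_comm] at h₁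
    exact mul_left_cancel₀ (algebraMap_varProd_pow_ne_zero σᶜ M) h₁

/-- An element of all the localisations `(S^ι)_{x_k}` is a vector of polynomials. If there is only
one variable, the degrees have to be assumed non-negative. -/
lemma LocMod.exists_eq_algebraMap [Finite ι] {f : ι → Q}
    (hf : ∀ k, f ∈ LocMod (⊤ : Submodule S (ι → S)) a t {k}) (h : 1 ≤ m ∨ ∀ i, a i ≤ t) :
    ∃ p : ι → S, HomVec a p t ∧ ∀ i, f i = algebraMap S Q (p i) := by
  choose M₀ hM₀ using fun k ↦ LocMod.exists_numerator (hf k)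
  have hM : ∀ k, M₀ k ≤ ∑ l, M₀ l := fun k ↦
    Finset.single_le_sum (f := M₀) (fun _ _ ↦ Nat.zero_le _) (Finset.mem_univ k)
  set M := ∑ l, M₀ l
  choose P hP₁ hP₂ hP₃ using fun k ↦ hM₀ k M (hM k)
  have heq : ∀ k, P k = P 0 := fun k ↦ funext fun i ↦ IsFractionRing.injective S Q <| by
    rw [← hP₃, ← hP₃]
  obtain ⟨M', p, -, hp, hp'⟩ : f ∈ LocMod (⊤ : Submodule S (ι → S)) a t ∅ := by
    refine LocMod.of_numerator (hP₁ 0) (fun i d hd k _ ↦ ?_) (hP₃ 0)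
    rcases h with h | h
    · have : Nontrivial (Fin (m + 1)) := Fin.nontrivial_iff_two_le.2 (by omega)
      obtain ⟨l, hl⟩ := exists_ne k
      rw [← heq l] at hd
      exact hP₂ l i d hd k (by simpa using hl.symm)
    · by_cases hm : 1 ≤ m
      · have : Nontrivial (Fin (m + 1)) := Fin.nontrivial_iff_two_le.2 (by omega)
        obtain ⟨l, hl⟩ := exists_ne k
        rw [← heq l] at hd
        exact hP₂ l i d hd k (by simpa using hl.symm)
      · obtain rfl : m = 0 := by omega
        have h₁ := hP₁ 0 i d hd
        rw [Finsupp.degree_eq_sum] at h₁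
        simp only [Fin.sum_univ_succ, Finset.univ_eq_empty, Finset.sum_empty, add_zero] at h₁
        have := h i
        rw [Subsingleton.elim (α := Fin 1) k 0]
        push_cast at h₁
        zify
        linarith
  refine ⟨p, by simpa using hp, fun i ↦ ?_⟩
  simpa [varProd] using hp' i

end LocMod

/-! ### Čech cohomology of graded modules over a polynomial ring -/

section Serre

open MvPolynomial

variable {m : ℕ} {K : Type*} [Field K] {ι : Type*}

local notation "S" => MvPolynomial (Fin (m + 1)) K
local notation "Q" => FractionRing (MvPolynomial (Fin (m + 1)) K)

lemma coeff_sum_filter_monomial (P : (Fin (m + 1) →₀ ℕ) → Prop) [DecidablePred P] (p : S)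
    (e : Fin (m + 1) →₀ ℕ) :
    coeff e (∑ d ∈ p.support.filter P, monomial d (coeff d p)) = if P e then coeff e p else 0 := by
  classical
  simp only [coeff_sum, coeff_monomial, Finset.sum_ite_eq', Finset.mem_filter, mem_support_iff]
  by_cases h : coeff e p = 0 <;> by_cases h' : P e <;> simp [h, h']

/-- The part of a polynomial consisting of the monomials `d` with `κ d = k`. -/
def monomialPart (κ : (Fin (m + 1) →₀ ℕ) → Fin (m + 1)) (k : Fin (m + 1)) : S →+ S where
  toFun p := ∑ d ∈ p.support.filter (fun d ↦ κ d = k), monomial d (coeff d p)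
  map_zero' := by simp
  map_add' p q := by
    ext e
    rw [coeff_add, coeff_sum_filter_monomial, coeff_sum_filter_monomial,
      coeff_sum_filter_monomial]
    split_ifs <;> simp

lemma coeff_monomialPart (κ : (Fin (m + 1) →₀ ℕ) → Fin (m + 1)) (k : Fin (m + 1)) (p : S)
    (e : Fin (m + 1) →₀ ℕ) :
    coeff e (monomialPart κ k p) = if κ e = k then coeff e p else 0 :=
  coeff_sum_filter_monomial _ p e

/-- A monomial of degree greater than `(M - 1) (m + 1)` contains some variable to the power `M`. -/
lemma exists_le_of_degree {d : Fin (m + 1) →₀ ℕ} {M : ℕ}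
    (h : (M : ℤ) * (m + 1) < d.degree + (m + 1)) : ∃ k, M ≤ d k := by
  by_contra! hd
  have h₁ : ∑ k, (d k + 1) ≤ ∑ _k : Fin (m + 1), M := Finset.sum_le_sum fun k _ ↦ hd k
  rw [Finset.sum_add_distrib, ← Finsupp.degree_eq_sum] at h₁
  simp only [Finset.sum_const, Finset.card_univ, Fintype.card_fin, smul_eq_mul, mul_one] at h₁
  zify at h₁
  linarith [mul_comm (M : ℤ) (m + 1)]

/-- The Čech cohomology of `O(d)` vanishes in positive degrees if `d > -m - 1`: every monomial of
the numerators contains some `x_k` with a non-negative exponent, and the cochains made of the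
monomials belonging to one `k` are contracted by `contract k`. -/
lemma exists_setD_eq_of_lt [Finite ι] {a : ι → ℤ} {t : ℤ} (ht : ∀ i, a i < t + m + 1) (p : ℕ)
    (c : Finset (Fin (m + 1)) → ι → FractionRing (MvPolynomial (Fin (m + 1)) K))
    (hc : ∀ σ, σ.card = p + 1 → c σ ∈ LocMod ⊤ a t σ)
    (hD : ∀ σ, σ.card = p + 2 → setD c σ = 0) :
    ∃ b : Finset (Fin (m + 1)) → ι → FractionRing (MvPolynomial (Fin (m + 1)) K),
      (∀ τ, τ.card = p → b τ ∈ LocMod ⊤ a t τ) ∧ ∀ σ, σ.card = p + 1 → setD b σ = c σ := by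
  classical
  -- a common denominator
  have h₀ : ∀ σ : Finset (Fin (m + 1)), ∃ M₀ : ℕ, ∀ M ≥ M₀, ∃ P : ι → S, σ.card = p + 1 →
      HomVec a P (t + M * (m + 1)) ∧ (∀ i d, coeff d (P i) ≠ 0 → ∀ k ∉ σ, M ≤ d k) ∧
      ∀ i, c σ i * algebraMap S Q (allVars K m ^ M) = algebraMap S Q (P i) := by
    intro σ
    by_cases h : σ.card = p + 1
    · obtain ⟨M₀, hM₀⟩ := LocMod.exists_numerator (hc σ h)
      refine ⟨M₀, fun M hM ↦ ?_⟩
      obtain ⟨P, hP⟩ := hM₀ M hM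
      exact ⟨P, fun _ ↦ hP⟩
    · exact ⟨0, fun M _ ↦ ⟨0, fun h' ↦ absurd h' h⟩⟩
  choose M₀ hM₀ using h₀
  set M := ∑ σ, M₀ σ
  choose P hP using fun σ ↦ hM₀ σ M
    (Finset.single_le_sum (f := M₀) (fun _ _ ↦ Nat.zero_le _) (Finset.mem_univ σ))
  have hX : algebraMap S Q (allVars K m ^ M) ≠ 0 := algebraMap_varProd_pow_ne_zero _ _
  have hPD : ∀ σ : Finset (Fin (m + 1)), σ.card = p + 2 → setD P σ = 0 := by
    intro σ hσ
    funext i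
    let f : (ι → S) →+ Q := (algebraMap S Q).toAddMonoidHom.comp (Pi.evalAddMonoidHom _ i)
    let g : (ι → Q) →+ Q := (AddMonoidHom.mulRight (algebraMap S Q (allVars K m ^ M))).comp
      (Pi.evalAddMonoidHom _ i)
    have h : f (setD P σ) = g (setD c σ) := by
      rw [← setD_map, ← setD_map]
      refine setD_congr fun τ hτ ↦ ?_
      exact ((hP τ (by omega)).2.2 i).symm
    rw [hD σ hσ, map_zero] at h
    exact IsFractionRing.injective S Q (h.trans (map_zero _).symm)
  -- `κ d` is a variable whose exponent in the monomial `d` is at least `M`: the part of `P` which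
  -- belongs to `κ = k` has, divided by the denominator, no pole along `x_k`, so that `contract k`
  -- provides a primitive of it
  obtain ⟨κ, hκ⟩ : ∃ κ : (Fin (m + 1) →₀ ℕ) → Fin (m + 1),
      ∀ d : Fin (m + 1) →₀ ℕ, (∃ k, M ≤ d k) → M ≤ d (κ d) :=
    ⟨fun d ↦ if h : ∃ k, M ≤ d k then h.choose else 0, fun d h ↦ by
      simp only [dif_pos h]
      exact h.choose_spec⟩
  let π : Fin (m + 1) → (ι → S) →+ (ι → S) := fun k ↦ AddMonoidHom.mk' (fun v i ↦
    monomialPart κ k (v i)) fun v w ↦ funext fun i ↦ map_add _ _ _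
  let b : Finset (Fin (m + 1)) → ι → S := fun τ ↦ ∑ k, contract k (fun τ ↦ π k (P τ)) τ
  have hb : ∀ σ, σ.card = p + 1 → setD b σ = P σ := by
    intro σ hσ
    have h : ∀ k, setD (contract k fun τ ↦ π k (P τ)) σ = π k (P σ) := fun k ↦ by
      rw [eq_sub_of_add_eq (setD_contract_add k (fun τ ↦ π k (P τ)) σ), sub_eq_self]
      have : setD (fun τ ↦ π k (P τ)) = fun τ ↦ π k (setD P τ) := funext fun τ ↦ setD_map _ _ _
      rw [this, contract_map]
      by_cases hk : k ∈ σ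
      · rw [contract_of_mem hk, map_zero]
      · rw [contract_of_notMem hk, hPD _ (by rw [Finset.card_insert_of_notMem hk, hσ]), smul_zero,
          map_zero]
    rw [setD_sum]
    simp only [h]
    funext i
    rw [Finset.sum_apply]
    ext e
    change coeff e (∑ k, monomialPart κ k (P σ i)) = _
    simp only [coeff_sum, coeff_monomialPart, Finset.sum_ite_eq, Finset.mem_univ, if_true]
  have hb' : ∀ τ, τ.card = p → ∀ i d, coeff d (b τ i) ≠ 0 →
      ∃ k ∉ τ, κ d = k ∧ coeff d (P (insert k τ) i) ≠ 0 := by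
    intro τ hτ i d hd
    change coeff d ((∑ k, contract k (fun τ ↦ π k (P τ)) τ) i) ≠ 0 at hd
    rw [Finset.sum_apply, coeff_sum] at hd
    obtain ⟨k, -, hk⟩ := Finset.exists_ne_zero_of_sum_ne_zero hd
    by_cases hkτ : k ∈ τ
    · rw [contract_of_mem hkτ] at hk
      exact absurd (coeff_zero d) hk
    · rw [contract_of_notMem hkτ, Pi.smul_apply, coeff_smul] at hk
      have hk' : coeff d (monomialPart κ k (P (insert k τ) i)) ≠ 0 :=
        fun h ↦ hk (by rw [show π k (P (insert k τ)) i = monomialPart κ k (P (insert k τ) i) from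
          rfl, h, smul_zero])
      rw [coeff_monomialPart] at hk'
      split_ifs at hk' with h
      · exact ⟨k, hkτ, h, hk'⟩
      · exact absurd rfl hk'
  refine ⟨fun τ i ↦ algebraMap S Q (b τ i) / algebraMap S Q (allVars K m ^ M), fun τ hτ ↦ ?_,
    fun σ hσ ↦ funext fun i ↦ ?_⟩
  · have hdeg : HomVec a (b τ) (t + M * (m + 1)) := fun i d hd ↦ by
      obtain ⟨k, hk, -, h⟩ := hb' τ hτ i d hd
      exact (hP _ (by rw [Finset.card_insert_of_notMem hk, hτ])).1 i d h
    refine LocMod.of_numerator hdeg (fun i d hd l hl ↦ ?_) fun i ↦ div_mul_cancel₀ _ hX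
    obtain ⟨k, hk, hkd, h⟩ := hb' τ hτ i d hd
    by_cases hlk : l = k
    · rw [hlk, ← hkd]
      refine hκ d (exists_le_of_degree ?_)
      rw [hdeg i d hd]
      linarith [ht i]
    · exact (hP _ (by rw [Finset.card_insert_of_notMem hk, hτ])).2.1 i d h l
        (by simp [hlk, hl])
  · let f : (ι → S) →+ (ι → Q) := AddMonoidHom.mk' (fun v i ↦ algebraMap S Q (v i) /
      algebraMap S Q (allVars K m ^ M)) fun v w ↦ funext fun i ↦ by simp [add_div]
    have h : setD (fun τ ↦ f (b τ)) σ = f (setD b σ) := setD_map f b σ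
    rw [hb σ hσ] at h
    refine (congrFun h i).trans ?_
    exact (div_eq_iff hX).2 ((hP σ hσ).2.2 i).symm

/-- The top Čech cohomology of `O(t)` on `P^m` is not zero if `t ≤ -m - 1`: it contains the class
of a Laurent monomial of degree `t` all of whose exponents are negative. -/
lemma exists_not_setD {t : ℤ} (ht : t ≤ -m - 1) : ∃ f ∈ LocMod (⊤ : Submodule
    (MvPolynomial (Fin (m + 1)) K) (Unit → MvPolynomial (Fin (m + 1)) K)) 0 t Finset.univ,
    ∀ b : Finset (Fin (m + 1)) → Unit → FractionRing (MvPolynomial (Fin (m + 1)) K),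
      (∀ τ, τ.card = m → b τ ∈ LocMod ⊤ 0 t τ) → setD b Finset.univ ≠ f := by
  classical
  obtain ⟨j, hj⟩ : ∃ j : ℕ, t = -m - 1 - j := ⟨(-m - 1 - t).toNat, by omega⟩
  refine ⟨fun _ ↦ algebraMap S Q (varProd K (Finset.univ.erase 0) ^ j) /
    algebraMap S Q (varProd K Finset.univ ^ (1 + j)), ⟨1 + j, fun _ ↦ varProd K
      (Finset.univ.erase 0) ^ j, trivial, fun i ↦ ?_, fun i ↦ ?_⟩, fun b hb hbf ↦ ?_⟩
  · convert homZ_varProd_pow (Finset.univ.erase (0 : Fin (m + 1))) j using 1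
    rw [Finset.card_erase_of_mem (Finset.mem_univ _), Finset.card_univ, Fintype.card_fin, hj]
    push_cast
    simp
    ring
  · exact div_mul_cancel₀ _ (algebraMap_varProd_pow_ne_zero _ _)
  have h₀ : ∀ k : Fin (m + 1), ∃ M₀ : ℕ, ∀ M ≥ M₀, ∃ P : Unit → S,
      HomVec 0 P (t + M * (m + 1)) ∧
      (∀ i d, coeff d (P i) ≠ 0 → ∀ l ∉ Finset.univ.erase k, M ≤ d l) ∧
      ∀ i, b (Finset.univ.erase k) i * algebraMap S Q (allVars K m ^ M) = algebraMap S Q (P i) :=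
    fun k ↦ LocMod.exists_numerator (hb _ (by simp))
  choose M₀ hM₀ using h₀
  set M := ∑ k, M₀ k + (1 + j) with hM
  choose P hP₁ hP₂ hP₃ using fun k ↦ hM₀ k M
    ((Finset.single_le_sum (f := M₀) (fun _ _ ↦ Nat.zero_le _) (Finset.mem_univ k)).trans
      (Nat.le_add_right _ _))
  have hX := algebraMap_varProd_pow_ne_zero (K := K) (Finset.univ : Finset (Fin (m + 1))) (1 + j)
  have h : ∑ k, cechSign k Finset.univ • P k () =
      varProd K (Finset.univ.erase 0) ^ j * varProd K Finset.univ ^ (∑ k, M₀ k) := by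
    apply IsFractionRing.injective S Q
    have h₁ := congrArg (· * algebraMap S Q (allVars K m ^ M)) (congrFun hbf ())
    simp only [setD, Finset.sum_apply, Finset.sum_mul, Pi.smul_apply, smul_mul_assoc, hP₃] at h₁
    rw [map_sum]
    simp only [map_zsmul]
    rw [h₁, hM, allVars, pow_add _ (∑ k, M₀ k) (1 + j), map_mul, map_mul, div_mul_eq_mul_div,
      ← mul_assoc, mul_div_cancel_right₀ _ hX]
  have h₂ : varProd K (Finset.univ.erase (0 : Fin (m + 1))) ^ j *
      varProd K Finset.univ ^ (∑ k, M₀ k) = monomial (∑ k ∈ Finset.univ.erase 0,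
        Finsupp.single k j + ∑ k, Finsupp.single k (∑ k, M₀ k)) (1 : K) := by
    rw [varProd_pow_eq, varProd_pow_eq, monomial_mul, one_mul]
  rw [h₂] at h
  have h₃ := congrArg (coeff (∑ k ∈ Finset.univ.erase 0,
        Finsupp.single k j + ∑ k, Finsupp.single k (∑ k, M₀ k))) h
  rw [coeff_monomial, if_pos rfl, coeff_sum] at h₃
  obtain ⟨k, -, hk⟩ := Finset.exists_ne_zero_of_sum_ne_zero (h₃.trans_ne one_ne_zero)
  rw [coeff_smul] at hk
  have h₄ := hP₂ k () _ (right_ne_zero_of_smul hk) k (by simp)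
  have h₅ : ∀ s : Finset (Fin (m + 1)), ∀ x : ℕ, (∑ l ∈ s, Finsupp.single l x) k ≤ x := by
    intro s x
    rw [Finsupp.finsetSum_apply]
    simp only [Finsupp.single_apply, Finset.sum_ite_eq']
    split_ifs <;> omega
  have h₆ := h₅ (Finset.univ.erase 0) j
  have h₇ := h₅ Finset.univ (∑ k, M₀ k)
  rw [Finsupp.add_apply] at h₄
  omega

/-- A graded submodule of `S^ι` is generated by finitely many homogeneous vectors; homogeneous
vectors are linear combinations of them with homogeneous coefficients. -/
lemma exists_homogeneous_generators [Finite ι] (a : ι → ℤ)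
    (N : Submodule (MvPolynomial (Fin (m + 1)) K) (ι → MvPolynomial (Fin (m + 1)) K)) :
    ∃ (r : ℕ) (v : Fin r → ι → MvPolynomial (Fin (m + 1)) K) (δ : Fin r → ℤ),
      (∀ j, v j ∈ N ∧ HomVec a (v j) (δ j)) ∧ ∀ p ∈ N, ∀ z, HomVec a p z →
        ∃ g : Fin r → MvPolynomial (Fin (m + 1)) K, HomVec δ g z ∧ p = ∑ j, g j • v j := by
  classical
  let H : Set (ι → S) := {v | v ∈ N ∧ ∃ δ, HomVec a v δ}
  obtain ⟨T, hTH, hT⟩ := Submodule.fg_span_iff_fg_span_finset_subset H |>.1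
    (IsNoetherian.noetherian (Submodule.span S H))
  choose hv δ hδ using fun j : Fin T.card ↦ hTH (T.equivFin.symm j).2
  refine ⟨T.card, fun j ↦ T.equivFin.symm j, δ, fun j ↦ ⟨hv j, hδ j⟩, fun p hp z hz ↦ ?_⟩
  have hpT : p ∈ Submodule.span S (T : Set (ι → S)) := hT ▸ Submodule.subset_span ⟨hp, z, hz⟩
  obtain ⟨f, -, hf⟩ := Submodule.mem_span_finset.1 hpT
  have hf' : p = ∑ j, f (T.equivFin.symm j) • (T.equivFin.symm j : ι → S) := by
    rw [← hf, ← Finset.sum_coe_sort T (fun v ↦ f v • v)]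
    exact (Equiv.sum_comp T.equivFin.symm fun v : T ↦ f v • (v : ι → S)).symm
  refine ⟨fun j ↦ compZ (z - δ j) (f (T.equivFin.symm j)), fun j ↦ homZ_compZ _ _, ?_⟩
  funext i
  have h := compZ_of_homZ (hz i) (z - a i)
  rw [if_pos rfl] at h
  rw [← h, hf', Finset.sum_apply, Finset.sum_apply, compZ_sum]
  refine Finset.sum_congr rfl fun j _ ↦ ?_
  rw [Pi.smul_apply, Pi.smul_apply, smul_eq_mul, smul_eq_mul, ← compZ_mul (hδ j i)]
  congr 1
  ring

lemma LocMod.setD_mem {N : Submodule (MvPolynomial (Fin (m + 1)) K)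
    (ι → MvPolynomial (Fin (m + 1)) K)} {a : ι → ℤ} {t : ℤ} {σ : Finset (Fin (m + 1))}
    {c : Finset (Fin (m + 1)) → ι → FractionRing (MvPolynomial (Fin (m + 1)) K)}
    (hc : ∀ k ∈ σ, c (σ.erase k) ∈ LocMod N a t (σ.erase k)) : setD c σ ∈ LocMod N a t σ :=
  sum_mem fun k hk ↦ zsmul_mem (LocMod.mono (hc k hk) (Finset.erase_subset k σ)) _

/-- Serre vanishing: the Čech cohomology of a graded submodule `N ⊆ S^r` vanishes in positive
degrees after a large twist. One descends on the cohomological degree, lifting cocycles along a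
presentation of `N` by a free module, whose cohomology vanishes by `exists_setD_eq_of_lt`. -/
theorem exists_forall_setD_eq (q : ℕ) : ∀ (r : ℕ) (a : Fin r → ℤ)
    (N : Submodule (MvPolynomial (Fin (m + 1)) K) (Fin r → MvPolynomial (Fin (m + 1)) K)) (p : ℕ),
    m + 1 ≤ p + q → ∃ t₀ : ℤ, ∀ t ≥ t₀,
    ∀ c : Finset (Fin (m + 1)) → Fin r → FractionRing (MvPolynomial (Fin (m + 1)) K),
      (∀ σ, σ.card = p + 1 → c σ ∈ LocMod N a t σ) → (∀ σ, σ.card = p + 2 → setD c σ = 0) →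
      ∃ b : Finset (Fin (m + 1)) → Fin r → FractionRing (MvPolynomial (Fin (m + 1)) K),
        (∀ τ, τ.card = p → b τ ∈ LocMod N a t τ) ∧ ∀ σ, σ.card = p + 1 → setD b σ = c σ := by
  classical
  induction q with
  | zero =>
    intro r a N p hp
    refine ⟨0, fun t _ c _ _ ↦ ⟨0, fun τ _ ↦ zero_mem _, fun σ hσ ↦ ?_⟩⟩
    have := Finset.card_le_univ σ
    rw [Fintype.card_fin] at this
    omega
  | succ q ih =>
    intro r a N p hp
    obtain ⟨r', v, δ, hv, hgen⟩ := exists_homogeneous_generators a N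
    let ψS : (Fin r' → S) →ₗ[S] (Fin r → S) := ∑ j, (LinearMap.proj j).smulRight (v j)
    have hψS : ∀ g i, ψS g i = ∑ j, g j * v j i := fun g i ↦ by simp [ψS]
    let ψ : (Fin r' → Q) →+ (Fin r → Q) := AddMonoidHom.mk'
      (fun g i ↦ ∑ j, g j * algebraMap S Q (v j i)) fun g h ↦ funext fun i ↦ by
        simp [add_mul, Finset.sum_add_distrib]
    have hψ : ∀ {M : ℕ} {σ : Finset (Fin (m + 1))} {f : Fin r' → Q} {g : Fin r' → S},
        (∀ j, f j * algebraMap S Q (varProd K σ ^ M) = algebraMap S Q (g j)) →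
        ∀ i, ψ f i * algebraMap S Q (varProd K σ ^ M) = algebraMap S Q (ψS g i) := by
      intro M σ f g h i
      rw [hψS, map_sum]
      change (∑ j, f j * algebraMap S Q (v j i)) * _ = _
      rw [Finset.sum_mul]
      refine Finset.sum_congr rfl fun j _ ↦ ?_
      rw [map_mul, ← h]
      ring
    have hψmem : ∀ {t : ℤ} {σ : Finset (Fin (m + 1))} {f : Fin r' → Q},
        f ∈ LocMod ⊤ δ t σ → ψ f ∈ LocMod N a t σ := by
      rintro t σ f ⟨M, g, -, hg, hf⟩
      refine ⟨M, ψS g, ?_, fun i ↦ ?_, hψ hf⟩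
      · have : ψS g = ∑ j, g j • v j := by simp [ψS]
        rw [this]
        exact N.sum_mem fun j _ ↦ N.smul_mem _ (hv j).1
      · rw [hψS]
        refine HomZ.sum fun j _ ↦ ?_
        convert (hg j).mul ((hv j).2 i) using 1
        ring
    obtain ⟨t₁, ht₁⟩ := ih r' δ (LinearMap.ker ψS) (p + 1) (by omega)
    refine ⟨max t₁ (∑ j, |δ j|), fun t ht c hc hD ↦ ?_⟩
    have htδ : ∀ j, δ j < t + m + 1 := fun j ↦ by
      have h₁ := Finset.single_le_sum (f := fun j ↦ |δ j|) (fun _ _ ↦ abs_nonneg _)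
        (Finset.mem_univ j)
      have h₂ := le_abs_self (δ j)
      have h₃ := (le_max_right _ _).trans ht
      linarith [(Nat.cast_nonneg m : (0 : ℤ) ≤ m)]
    -- lift the cochain to the free module
    have hlift : ∀ σ, ∃ f : Fin r' → Q, σ.card = p + 1 → f ∈ LocMod ⊤ δ t σ ∧ ψ f = c σ := by
      intro σ
      by_cases hσ : σ.card = p + 1
      · obtain ⟨M, P, hP, hP', hf⟩ := hc σ hσ
        obtain ⟨g, hg, rfl⟩ := hgen P hP _ hP'
        have hX := algebraMap_varProd_pow_ne_zero (K := K) σ M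
        have h : ∀ j, algebraMap S Q (g j) / algebraMap S Q (varProd K σ ^ M) *
            algebraMap S Q (varProd K σ ^ M) = algebraMap S Q (g j) :=
          fun j ↦ div_mul_cancel₀ _ hX
        refine ⟨fun j ↦ algebraMap S Q (g j) / algebraMap S Q (varProd K σ ^ M),
          fun _ ↦ ⟨⟨M, g, trivial, hg, h⟩, funext fun i ↦ ?_⟩⟩
        apply mul_right_cancel₀ hX
        rw [hψ h, hf, hψS]
        simp
      · exact ⟨0, fun h ↦ absurd h hσ⟩
    choose c' hc' using hlift
    have hψD : ∀ c₀ : Finset (Fin (m + 1)) → Fin r' → Q, ∀ σ,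
        ψ (setD c₀ σ) = setD (fun τ ↦ ψ (c₀ τ)) σ := fun c₀ σ ↦ (setD_map ψ c₀ σ).symm
    -- the boundary of the lift is a cocycle of the kernel of the presentation, in degree `p + 1`
    obtain ⟨b', hb', hb'D⟩ := ht₁ t ((le_max_left _ _).trans ht) (setD c') (fun σ hσ ↦ by
      obtain ⟨M, g, -, hg, hf⟩ := LocMod.setD_mem (N := ⊤) (c := c') (σ := σ) fun k hk ↦
        (hc' _ (by rw [Finset.card_erase_of_mem hk, hσ]; rfl)).1
      refine ⟨M, g, ?_, hg, hf⟩
      have h : ψ (setD c' σ) = 0 := by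
        rw [hψD, ← hD σ hσ]
        exact setD_congr fun τ hτ ↦ (hc' τ (by omega)).2
      rw [LinearMap.mem_ker]
      funext i
      apply IsFractionRing.injective S Q
      rw [← hψ hf, h]
      simp) (fun σ _ ↦ setD_setD c' σ)
    obtain ⟨b, hb, hbD⟩ := exists_setD_eq_of_lt htδ p (fun σ ↦ c' σ - b' σ) (fun σ hσ ↦
      sub_mem (hc' σ hσ).1
        (LocMod.mono_left (N' := ⊤) (fun _ _ _ _ ↦ Submodule.mem_top) (hb' σ hσ)))
      (fun σ hσ ↦ by
        rw [setD_sub, hb'D σ hσ, sub_self])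
    refine ⟨fun τ ↦ ψ (b τ), fun τ hτ ↦ hψmem (hb τ hτ), fun σ hσ ↦ ?_⟩
    have h : ψ (b' σ) = 0 := by
      obtain ⟨M, g, hg, -, hf⟩ := hb' σ hσ
      funext i
      have h := hψ hf i
      rw [LinearMap.mem_ker.1 hg, Pi.zero_apply, map_zero] at h
      exact (mul_eq_zero.1 h).resolve_right (algebraMap_varProd_pow_ne_zero σ M)
    rw [setD_map, hbD σ hσ, map_sub, h, sub_zero, (hc' σ hσ).2]

end Serre

/-! ### Rings of twisted sections over an affine base -/

open MvPolynomial in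
/-- The algebraic data attached to an affine scheme `Y` over `B` together with an immersion of `Y`
into `P^n_B`: the ring `R` of families of functions on the sets `Y ∩ D_+(x_k)`, the evaluation of
polynomials at the families `(x_l / x_k)_k`, and the submodules `sec d` of those families which
are sections of `O_Y(d)`. The last two fields say that sections are given by polynomials on the
sets `Y ∩ D_+(x_k)`, and that the sections `x_k ^ N` of `O_Y(N)` generate it, as they do on the
affine scheme `Y`. -/
structure SectionSystem (B R : Type*) [CommRing B] [CommRing R] [Algebra B R] (n : ℕ) where
  /-- the evaluation of polynomials -/
  ev : MvPolynomial (Fin (n + 1)) B →ₐ[B] R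
  /-- the module of sections of the twist by `d` -/
  sec : ℤ → Submodule B R
  mul_mem : ∀ {d e : ℤ} {f g : R}, f ∈ sec d → g ∈ sec e → f * g ∈ sec (d + e)
  ev_mem : ∀ {d : ℤ} {p : MvPolynomial (Fin (n + 1)) B}, HomZ p d → ev p ∈ sec d
  exists_ev : ∀ {d : ℤ} {f : R}, f ∈ sec d → ∀ k, ∃ N₀ : ℕ, ∀ N ≥ N₀,
    ∃ p, HomZ p (d + N) ∧ ev p = ev (X k) ^ N * f
  partition : ∀ N : ℕ, ∃ v : Fin (n + 1) → R, (∀ k, v k ∈ sec (-N)) ∧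
    ∑ k, ev (X k) ^ N * v k = 1

namespace SectionSystem

open MvPolynomial

variable {B R : Type*} [CommRing B] [CommRing R] [Algebra B R] {n : ℕ}
  (s : SectionSystem B R n)

/-- Every section of the twist by `e` is a homogeneous polynomial of degree `e`. -/
def Gen (e : ℤ) : Prop := ∀ f ∈ s.sec e, ∃ p, HomZ p e ∧ s.ev p = f

lemma ev_X_pow_mem (k : Fin (n + 1)) (N : ℕ) : s.ev (X k) ^ N ∈ s.sec N := by
  rw [← map_pow]
  exact s.ev_mem (homZ_X_pow k N)

lemma exists_ev_all {d : ℤ} {f : R} (hf : f ∈ s.sec d) : ∃ N₀ : ℕ, ∀ N ≥ N₀, ∀ k,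
    ∃ p, HomZ p (d + N) ∧ s.ev p = s.ev (X k) ^ N * f := by
  choose N₀ hN₀ using s.exists_ev hf
  exact ⟨∑ k, N₀ k, fun N hN k ↦ hN₀ k N ((Finset.single_le_sum (f := N₀)
    (fun _ _ ↦ Nat.zero_le _) (Finset.mem_univ k)).trans hN)⟩

lemma eq_zero_of_forall {f : R} (N : ℕ) (h : ∀ k, s.ev (X k) ^ N * f = 0) : f = 0 := by
  obtain ⟨v, -, hv⟩ := s.partition N
  calc f = ∑ k, s.ev (X k) ^ N * v k * f := by rw [← Finset.sum_mul, hv, one_mul]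
    _ = 0 := Finset.sum_eq_zero fun k _ ↦ by rw [mul_right_comm, h, zero_mul]

/-- `O(e)` and `O(-e)` are generated by finitely many sections, in a compatible way. -/
lemma exists_dual (e : ℤ) : ∃ u w : Fin (n + 1) → R, (∀ k, u k ∈ s.sec e) ∧
    (∀ k, w k ∈ s.sec (-e)) ∧ ∑ k, u k * w k = 1 := by
  rcases le_total 0 e with h | h
  · lift e to ℕ using h
    obtain ⟨v, hv, hv'⟩ := s.partition e
    exact ⟨fun k ↦ s.ev (X k) ^ e, v, fun k ↦ s.ev_X_pow_mem k e, hv, hv'⟩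
  · obtain ⟨N, rfl⟩ : ∃ N : ℕ, e = -N := ⟨(-e).toNat, by omega⟩
    obtain ⟨v, hv, hv'⟩ := s.partition N
    refine ⟨v, fun k ↦ s.ev (X k) ^ N, hv, fun k ↦ ?_, ?_⟩
    · rw [neg_neg]
      exact s.ev_X_pow_mem k N
    · rw [← hv']
      exact Finset.sum_congr rfl fun k _ ↦ mul_comm _ _

lemma Gen.succ {e : ℤ} (h : s.Gen e) : s.Gen (e + 1) := by
  intro f hf
  obtain ⟨v, hv, hv'⟩ := s.partition 1
  have h₁ : ∀ k, v k * f ∈ s.sec e := fun k ↦ by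
    have := s.mul_mem (hv k) hf
    rwa [show -((1 : ℕ) : ℤ) + (e + 1) = e by push_cast; ring] at this
  choose p hp hp' using fun k ↦ h _ (h₁ k)
  refine ⟨∑ k, X k * p k, HomZ.sum fun k _ ↦ ?_, ?_⟩
  · rw [add_comm e 1]
    exact (homZ_X k).mul (hp k)
  · rw [map_sum]
    simp only [map_mul, hp', ← mul_assoc]
    rw [← Finset.sum_mul]
    simp only [pow_one] at hv'
    rw [hv', one_mul]

/-- As in the Castelnuovo–Mumford lemma, `Gen` passes to all larger degrees. -/
lemma Gen.mono {e e' : ℤ} (h : s.Gen e) (he : e ≤ e') : s.Gen e' := by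
  obtain ⟨k, rfl⟩ := Int.le.dest he
  induction k with
  | zero => simpa using h
  | succ k ih =>
    push_cast
    rw [← add_assoc]
    exact Gen.succ s (ih (by omega))

/-- In a negative degree, where there are no polynomials, only the empty scheme satisfies `Gen`. -/
lemma Gen.one_eq_zero {e : ℤ} (h : s.Gen e) (he : e < 0) : (1 : R) = 0 := by
  obtain ⟨u, w, hu, -, hw⟩ := s.exists_dual e
  rw [← hw]
  refine Finset.sum_eq_zero fun k _ ↦ ?_
  obtain ⟨p, hp, hp'⟩ := h _ (hu k)
  rw [← hp', hp.eq_zero he, map_zero, zero_mul]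

/-- Since twists are locally isomorphic to `O`, their modules of sections over an affine scheme are
finite as soon as the ring of functions is. -/
lemma sec_fg (h : (s.sec 0).FG) (e : ℤ) : (s.sec e).FG := by
  obtain ⟨u, w, hu, hw, huw⟩ := s.exists_dual e
  have : s.sec e = ⨆ k, (s.sec 0).map (LinearMap.mulLeft B (u k)) := by
    apply le_antisymm
    · intro f hf
      have h₁ : f = ∑ k, u k * (w k * f) := by
        simp only [← mul_assoc]
        rw [← Finset.sum_mul, huw, one_mul]
      rw [h₁]
      refine Submodule.sum_mem _ fun k _ ↦ Submodule.mem_iSup_of_mem k ?_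
      refine ⟨w k * f, ?_, rfl⟩
      have := s.mul_mem (hw k) hf
      rwa [neg_add_cancel] at this
    · refine iSup_le fun k ↦ ?_
      rintro _ ⟨f, hf, rfl⟩
      have := s.mul_mem (hu k) hf
      rwa [add_zero] at this
  rw [this]
  exact Submodule.fg_iSup _ fun k ↦ h.map _

/-- On a scheme which is finite over the base, the sections of large twists are polynomials: the
finitely many generators of the ring of functions have a common denominator. -/
lemma exists_forall_gen (h : (s.sec 0).FG) : ∃ e₀ : ℤ, ∀ e ≥ e₀, s.Gen e := by
  classical
  obtain ⟨T, hT⟩ := h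
  have hmem : ∀ c : T, (c : R) ∈ s.sec 0 := fun c ↦ hT ▸ Submodule.subset_span c.2
  choose N₀ hN₀ using fun c : T ↦ s.exists_ev_all (hmem c)
  refine ⟨((∑ c, N₀ c : ℕ) : ℤ), fun e he f hf ↦ ?_⟩
  lift e to ℕ using (Nat.cast_nonneg _).trans he
  have he' : ∑ c, N₀ c ≤ e := by exact_mod_cast he
  have key : ∀ g ∈ s.sec 0, ∀ k, ∃ p, HomZ p e ∧ s.ev p = s.ev (X k) ^ e * g := by
    intro g hg k
    rw [← hT] at hg
    induction hg using Submodule.span_induction with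
    | mem c hc =>
      obtain ⟨p, hp, hp'⟩ := hN₀ ⟨c, hc⟩ e ((Finset.single_le_sum (f := N₀)
        (fun _ _ ↦ Nat.zero_le _) (Finset.mem_univ _)).trans he') k
      exact ⟨p, by simpa using hp, hp'⟩
    | zero => exact ⟨0, homZ_zero _, by simp⟩
    | add x y _ _ hx hy =>
      obtain ⟨p, hp, hp'⟩ := hx
      obtain ⟨q, hq, hq'⟩ := hy
      exact ⟨p + q, hp.add hq, by rw [map_add, hp', hq', mul_add]⟩
    | smul b x _ hx =>
      obtain ⟨p, hp, hp'⟩ := hx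
      refine ⟨C b * p, hp.C_mul b, ?_⟩
      rw [← smul_eq_C_mul, map_smul, hp', mul_smul_comm]
  obtain ⟨v, hv, hv'⟩ := s.partition e
  have h₁ : ∀ k, v k * f ∈ s.sec 0 := fun k ↦ by
    have := s.mul_mem (hv k) hf
    rwa [neg_add_cancel] at this
  choose p hp hp' using fun k ↦ key _ (h₁ k) k
  refine ⟨∑ k, p k, HomZ.sum fun k _ ↦ hp k, ?_⟩
  rw [map_sum]
  simp only [hp', ← mul_assoc]
  rw [← Finset.sum_mul, hv', one_mul]

/-- The homogeneous polynomials of degree `e`, as a submodule of the sections. -/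
def polySec (e : ℤ) : Submodule B R where
  carrier := {f | ∃ p, HomZ p e ∧ s.ev p = f}
  zero_mem' := ⟨0, homZ_zero _, map_zero _⟩
  add_mem' := by
    rintro _ _ ⟨p, hp, rfl⟩ ⟨q, hq, rfl⟩
    exact ⟨p + q, hp.add hq, map_add _ _ _⟩
  smul_mem' := by
    rintro b _ ⟨p, hp, rfl⟩
    exact ⟨C b * p, hp.C_mul b, by rw [← smul_eq_C_mul, map_smul]⟩

/-- By Nakayama's lemma, `Gen e` can be checked modulo all maximal ideals of the base. -/
lemma gen_of_forall_isMaximal (e : ℤ) (h : (s.sec e).FG) (hm : ∀ I : Ideal B, I.IsMaximal →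
    s.sec e ≤ s.polySec e ⊔ I • s.sec e) : s.Gen e := by
  by_contra hgen
  let J : Ideal B := (s.polySec e).colon (s.sec e : Set R)
  have hJ : J ≠ ⊤ := fun hJ ↦ hgen fun f hf ↦ by
    have h₁ : (1 : B) ∈ J := hJ ▸ Submodule.mem_top
    have := Submodule.mem_colon.1 h₁ f hf
    rwa [one_smul] at this
  obtain ⟨I, hI, hJI⟩ := Ideal.exists_le_maximal J hJ
  obtain ⟨r, hr, hr'⟩ := Submodule.exists_sub_one_mem_and_smul_eq_zero_of_fg_of_le_smul I
    ((s.sec e).map (s.polySec e).mkQ) (h.map _) (by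
      rw [← Submodule.map_smul'']
      refine (Submodule.map_mono (hm I hI)).trans ?_
      rw [Submodule.map_sup, Submodule.mkQ_map_self, bot_sup_eq])
  have hrJ : r ∈ J := Submodule.mem_colon.2 fun f hf ↦ by
    have := hr' _ (Submodule.mem_map_of_mem hf)
    rwa [← map_smul, Submodule.mkQ_apply, Submodule.Quotient.mk_eq_zero] at this
  have h₁ := I.sub_mem (hJI hrJ) hr
  rw [sub_sub_cancel] at h₁
  exact hI.ne_top ((Ideal.eq_top_iff_one I).2 h₁)

lemma exists_homZ_map_eq {K : Type*} [CommRing K] {φ : B →+* K} (hφ : Function.Surjective φ)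
    {p : MvPolynomial (Fin (n + 1)) K} {d : ℤ} (hp : HomZ p d) :
    ∃ P : MvPolynomial (Fin (n + 1)) B, HomZ P d ∧ map φ P = p := by
  obtain ⟨P, rfl⟩ := map_surjective φ hφ p
  refine ⟨compZ d P, homZ_compZ d P, ?_⟩
  ext e
  rw [coeff_map, coeff_compZ]
  split_ifs with h
  · rw [coeff_map]
  · rw [map_zero]
    by_contra h'
    exact h (hp e (Ne.symm h'))

section Comparison

variable {K R' : Type*} [CommRing K] [CommRing R'] [Algebra K R'] (s' : SectionSystem K R' n)
  {φ : B →+* K} (hφ : Function.Surjective φ) {ρ : R →+* R'}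
  (hev : ∀ p, ρ (s.ev p) = s'.ev (map φ p))
  (hsec : ∀ d, ∀ f ∈ s.sec d, ρ f ∈ s'.sec d)

include hφ hev in
lemma exists_lift {e : ℤ} {z : R'} (hz : z ∈ s'.sec e) : ∃ f ∈ s.sec e, ρ f = z := by
  obtain ⟨N, hN⟩ := s'.exists_ev_all hz
  choose p hp hp' using hN N le_rfl
  choose P hP hP' using fun k ↦ exists_homZ_map_eq hφ (hp k)
  obtain ⟨v, hv, hv'⟩ := s.partition N
  refine ⟨∑ k, v k * s.ev (P k), Submodule.sum_mem _ fun k _ ↦ ?_, ?_⟩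
  · have := s.mul_mem (hv k) (s.ev_mem (hP k))
    rwa [show -(N : ℤ) + (e + N) = e by ring] at this
  · have h := congrArg ρ hv'
    simp only [map_sum, map_mul, map_pow, hev, map_X, map_one] at h
    rw [map_sum, ← one_mul z, ← h, Finset.sum_mul]
    refine Finset.sum_congr rfl fun k _ ↦ ?_
    rw [map_mul, hev, hP', hp']
    ring

include hφ hev in
/-- Sections over the base restrict surjectively to a closed fibre. -/
lemma Gen.of_lift {e : ℤ} (h : s.Gen e) : s'.Gen e := by
  intro z hz
  obtain ⟨f, hf, rfl⟩ := exists_lift s s' hφ hev hz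
  obtain ⟨p, hp, rfl⟩ := h f hf
  exact ⟨map φ p, hp.map φ, (hev p).symm⟩

include hφ hev hsec in
/-- If the sections on a closed fibre are polynomials, then so are the sections over the base,
modulo the maximal ideal defining the fibre. -/
lemma sec_le_of_gen (hker : ∀ {d : ℤ} {f : R}, f ∈ s.sec d → ρ f = 0 → ∀ k, ∃ N₀ : ℕ, ∀ N ≥ N₀,
      ∃ p, HomZ p (d + N) ∧ map φ p = 0 ∧ s.ev p = s.ev (X k) ^ N * f)
    {e : ℤ} (h : s'.Gen e) : s.sec e ≤ s.polySec e ⊔ RingHom.ker φ • s.sec e := by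
  have key : ∀ f ∈ s.sec e, ρ f = 0 → f ∈ RingHom.ker φ • s.sec e := by
    intro f hf hf0
    choose N₀ hN₀ using hker hf hf0
    choose p hp hp0 hp' using fun k ↦ hN₀ k (∑ k, N₀ k) (Finset.single_le_sum (f := N₀)
      (fun _ _ ↦ Nat.zero_le _) (Finset.mem_univ k))
    obtain ⟨v, hv, hv'⟩ := s.partition (∑ k, N₀ k)
    have h₁ : f = ∑ k, v k * s.ev (p k) := by
      conv_lhs => rw [← one_mul f, ← hv', Finset.sum_mul]
      refine Finset.sum_congr rfl fun k _ ↦ ?_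
      rw [hp']
      ring
    rw [h₁]
    refine Submodule.sum_mem _ fun k _ ↦ ?_
    rw [(p k).as_sum, map_sum, Finset.mul_sum]
    refine Submodule.sum_mem _ fun d hd ↦ ?_
    have hd' : (monomial d (coeff d (p k)) : MvPolynomial (Fin (n + 1)) B) =
        coeff d (p k) • monomial d 1 := by rw [smul_monomial, smul_eq_mul, mul_one]
    rw [hd', map_smul, mul_smul_comm]
    refine Submodule.smul_mem_smul ?_ ?_
    · rw [RingHom.mem_ker, ← coeff_map, hp0, coeff_zero]
    · have h₂ := hp k d (mem_support_iff.1 hd)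
      have := s.mul_mem (hv k) (s.ev_mem (homZ_monomial d (1 : B)))
      rw [h₂] at this
      rwa [show -((∑ k, N₀ k : ℕ) : ℤ) + (e + (∑ k, N₀ k : ℕ)) = e by ring] at this
  intro f hf
  obtain ⟨p, hp, hp'⟩ := h _ (hsec e f hf)
  obtain ⟨P, hP, rfl⟩ := exists_homZ_map_eq hφ hp
  rw [← sub_add_cancel f (s.ev P), add_comm]
  refine Submodule.add_mem_sup ⟨P, hP, rfl⟩ (key _ (sub_mem hf (s.ev_mem hP)) ?_)
  rw [map_sub, hev, hp', sub_self]

end Comparison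

end SectionSystem

/-! ### The regularity of a subscheme of projective space that is finite over a field -/

section FibreCech

open MvPolynomial

variable {n : ℕ} {K : Type u} [Field K]

local notation "S" => MvPolynomial (Fin (n + 1)) K
local notation "Q" => FractionRing (MvPolynomial (Fin (n + 1)) K)

lemma cechSign_pair {k l : Fin (n + 1)} (h : k ≠ l) : cechSign l {k, l} = -cechSign k {k, l} := by
  rcases lt_or_gt_of_ne h with h' | h'
  · simp [cechSign, Finset.filter_insert, Finset.filter_singleton, h', h'.not_gt]
  · simp [cechSign, Finset.filter_insert, Finset.filter_singleton, h', h'.not_gt]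

lemma setD_pair {A : Type*} [AddCommGroup A] {k l : Fin (n + 1)} (h : k ≠ l)
    (f : Finset (Fin (n + 1)) → A) :
    setD f {k, l} = cechSign k {k, l} • (f {l} - f {k}) := by
  have h₁ : ({k, l} : Finset (Fin (n + 1))).erase k = {l} := by
    rw [Finset.erase_insert (by simpa using h)]
  have h₂ : ({k, l} : Finset (Fin (n + 1))).erase l = {k} := by
    rw [Finset.pair_comm, Finset.erase_insert (by simpa using h.symm)]
  rw [setD, Finset.sum_pair h, h₁, h₂, cechSign_pair h, neg_smul, smul_sub, sub_eq_add_neg]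

lemma cechSign_eq_or {ι : Type*} [LinearOrder ι] (k : ι) (σ : Finset ι) :
    cechSign k σ = 1 ∨ cechSign k σ = -1 := neg_one_pow_eq_or ℤ _

lemma LocMod.exists_of_ge {ι : Type*} {N : Submodule (MvPolynomial (Fin (n + 1)) K)
    (ι → MvPolynomial (Fin (n + 1)) K)} {a : ι → ℤ} {t : ℤ} {σ : Finset (Fin (n + 1))}
    {f : ι → FractionRing (MvPolynomial (Fin (n + 1)) K)} (hf : f ∈ LocMod N a t σ) :
    ∃ M₀ : ℕ, ∀ M ≥ M₀, ∃ p ∈ N, HomVec a p (t + M * σ.card) ∧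
      ∀ i, f i * algebraMap S Q (varProd K σ ^ M) = algebraMap S Q (p i) := by
  obtain ⟨M₀, p, hp, hp', hf⟩ := hf
  refine ⟨M₀, fun M hM ↦ ⟨varProd K σ ^ (M - M₀) • p, N.smul_mem _ hp, fun i ↦ ?_, fun i ↦ ?_⟩⟩
  · convert hp'.smul (homZ_varProd_pow σ (M - M₀)) i using 1
    push_cast [hM]
    ring
  · have h : varProd K σ ^ M = varProd K σ ^ (M - M₀) * varProd K σ ^ M₀ := by
      rw [← pow_add, Nat.sub_add_cancel hM]
    rw [Pi.smul_apply, smul_eq_mul, map_mul, ← hf, h, map_mul]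
    ring

lemma LocMod.mul_mem_of_top {J : Submodule (MvPolynomial (Fin (n + 1)) K)
    (Unit → MvPolynomial (Fin (n + 1)) K)} {d e : ℤ} {σ : Finset (Fin (n + 1))}
    {f g : Unit → FractionRing (MvPolynomial (Fin (n + 1)) K)} (hf : f ∈ LocMod J 0 d σ)
    (hg : g ∈ LocMod ⊤ 0 e σ) : (fun i ↦ g () * f i) ∈ LocMod J 0 (e + d) σ := by
  obtain ⟨M, p, -, hp, hg⟩ := hg
  have := hp ()
  rw [Pi.zero_apply, sub_zero] at this
  exact LocMod.mul_mem hf this (hg ())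

/-- The vanishing of Čech cohomology, in terms of cochains indexed by finite sets. -/
def SetVanishes (J : Submodule (MvPolynomial (Fin (n + 1)) K)
    (Unit → MvPolynomial (Fin (n + 1)) K)) (q : ℕ) (d : ℤ) : Prop :=
  ∀ c : Finset (Fin (n + 1)) → Unit → FractionRing (MvPolynomial (Fin (n + 1)) K),
    (∀ σ, σ.card = q + 1 → c σ ∈ LocMod J 0 d σ) → (∀ σ, σ.card = q + 2 → setD c σ = 0) →
    ∃ b : Finset (Fin (n + 1)) → Unit → FractionRing (MvPolynomial (Fin (n + 1)) K),
      (∀ τ, τ.card = q → b τ ∈ LocMod J 0 d τ) ∧ ∀ σ, σ.card = q + 1 → setD b σ = c σ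

/-- The two descriptions of the homogeneous fractions in an ideal agree. As `LocMod` allows
numerators of a negative degree, which are zero, `σ` has to be non-empty for `0` to be a fraction
in the sense of `locDeg` in a negative degree. -/
lemma mem_locDeg_iff {I : Ideal (MvPolynomial (Fin (n + 1)) K)}
    {J : Submodule (MvPolynomial (Fin (n + 1)) K) (Unit → MvPolynomial (Fin (n + 1)) K)}
    (hIJ : ∀ p : Unit → MvPolynomial (Fin (n + 1)) K, ∀ z, HomZ (p ()) z → (p () ∈ I ↔ p ∈ J))
    {d : ℤ} {σ : Finset (Fin (n + 1))} (hσ : σ.Nonempty)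
    {f : Unit → FractionRing (MvPolynomial (Fin (n + 1)) K)} :
    f () ∈ locDeg I d σ ↔ f ∈ LocMod J 0 d σ := by
  constructor
  · rintro ⟨N, e, p, hp, he, hd, hf⟩
    have he' := homZ_natCast.2 he
    rw [hd] at he'
    refine ⟨N, fun _ ↦ p, (hIJ (fun _ ↦ p) _ he').1 hp, fun _ ↦ ?_, fun _ ↦ hf⟩
    rwa [Pi.zero_apply, sub_zero]
  · rintro ⟨M, p, hp, hp', hf⟩
    have h := hp' ()
    rw [Pi.zero_apply, sub_zero] at h
    rcases le_or_gt 0 (d + M * σ.card) with h₀ | h₀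
    · obtain ⟨e, he⟩ := Int.eq_ofNat_of_zero_le h₀
      refine ⟨M, e, p (), (hIJ p _ h).2 hp, ?_, he.symm, hf ()⟩
      rw [he] at h
      exact homZ_natCast.1 h
    · have h₁ := hf ()
      rw [h.eq_zero h₀, map_zero] at h₁
      have h₂ : f () = 0 :=
        (mul_eq_zero.1 h₁).resolve_right (algebraMap_varProd_pow_ne_zero σ M)
      have h₃ : (0 : ℤ) ≤ d + d.natAbs * σ.card := by
        have : (1 : ℤ) ≤ σ.card := by exact_mod_cast hσ.card_pos
        have h₄ : -d ≤ d.natAbs := by omega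
        nlinarith [(Nat.cast_nonneg d.natAbs : (0 : ℤ) ≤ d.natAbs)]
      obtain ⟨e, he⟩ := Int.eq_ofNat_of_zero_le h₃
      exact ⟨d.natAbs, e, 0, I.zero_mem, isHomogeneous_zero _ _ _, he.symm, by
        rw [h₂, zero_mul, map_zero]⟩

lemma cechD_eq_setD {p : ℕ} (c : Finset (Fin (n + 1)) →
    Unit → FractionRing (MvPolynomial (Fin (n + 1)) K)) (σ : Fin (p + 1) ↪o Fin (n + 1)) :
    cechD (fun τ ↦ c (Finset.univ.map τ.toEmbedding) ()) σ =
      setD c (Finset.univ.map σ.toEmbedding) () := by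
  rw [← sum_orderEmb_eq_setD, Finset.sum_apply, cechD]
  refine Finset.sum_congr rfl fun k _ ↦ ?_
  rw [Pi.smul_apply, zsmul_eq_mul]
  push_cast
  rfl

/-- A cochain on ordered index sequences comes from a cochain on index sets. -/
lemma exists_set_cochain {p : ℕ} (c : (Fin p ↪o Fin (n + 1)) →
    FractionRing (MvPolynomial (Fin (n + 1)) K)) :
    ∃ c' : Finset (Fin (n + 1)) → Unit → FractionRing (MvPolynomial (Fin (n + 1)) K),
      c = fun τ ↦ c' (Finset.univ.map τ.toEmbedding) () := by
  refine ⟨fun τ _ ↦ if h : τ.card = p then c (τ.orderEmbOfFin h) else 0, funext fun τ ↦ ?_⟩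
  have h : (Finset.univ.map τ.toEmbedding).card = p := by simp
  simp only [dif_pos h]
  exact congrArg c (orderEmb_ext (Finset.map_orderEmbOfFin_univ _ _)).symm

/-- The alternating Čech complex on ordered index sequences, and the complex on index sets, have the
same vanishing cohomology groups. -/
lemma cechVanishes_iff {I : Ideal (MvPolynomial (Fin (n + 1)) K)}
    {J : Submodule (MvPolynomial (Fin (n + 1)) K) (Unit → MvPolynomial (Fin (n + 1)) K)}
    (hIJ : ∀ p : Unit → MvPolynomial (Fin (n + 1)) K, ∀ z, HomZ (p ()) z → (p () ∈ I ↔ p ∈ J))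
    {q : ℕ} (hq : 0 < q) {d : ℤ} : CechVanishes I q d ↔ SetVanishes J q d := by
  have hcochain : ∀ {p : ℕ}, 0 < p → ∀ c : Finset (Fin (n + 1)) →
      Unit → FractionRing (MvPolynomial (Fin (n + 1)) K),
      IsCochain I d (fun τ : Fin p ↪o Fin (n + 1) ↦ c (Finset.univ.map τ.toEmbedding) ()) ↔
        ∀ σ, σ.card = p → c σ ∈ LocMod J 0 d σ := by
    intro p hp c
    constructor
    · intro h σ hσ
      obtain ⟨τ, rfl⟩ := exists_orderEmb σ hσ
      exact (mem_locDeg_iff hIJ (Finset.card_pos.1 (by rw [hσ]; exact hp))).1 (h τ)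
    · intro h τ
      have hτ : (Finset.univ.map τ.toEmbedding).card = p := by simp
      exact (mem_locDeg_iff hIJ (Finset.card_pos.1 (by rw [hτ]; exact hp))).2 (h _ hτ)
  have hD : ∀ {p : ℕ} (c c' : Finset (Fin (n + 1)) →
      Unit → FractionRing (MvPolynomial (Fin (n + 1)) K)),
      (cechD (fun τ : Fin p ↪o Fin (n + 1) ↦ c (Finset.univ.map τ.toEmbedding) ()) =
        fun τ ↦ c' (Finset.univ.map τ.toEmbedding) ()) ↔
        ∀ σ, σ.card = p + 1 → setD c σ = c' σ := by
    intro p c c'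
    constructor
    · intro h σ hσ
      obtain ⟨τ, rfl⟩ := exists_orderEmb σ hσ
      funext _
      rw [← cechD_eq_setD, h]
    · intro h
      funext τ
      rw [cechD_eq_setD, h _ (by simp)]
  constructor
  · intro h c hc hcD
    obtain ⟨b, hb, hbD⟩ := h _ ((hcochain (Nat.succ_pos q) c).2 hc) ((hD c 0).2 hcD)
    obtain ⟨b, rfl⟩ := exists_set_cochain b
    exact ⟨b, (hcochain hq b).1 hb, (hD b c).1 hbD⟩
  · intro h c hc hcD
    obtain ⟨c, rfl⟩ := exists_set_cochain c
    obtain ⟨b, hb, hbD⟩ := h c ((hcochain (Nat.succ_pos q) c).1 hc) ((hD c 0).1 hcD)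
    exact ⟨_, (hcochain hq b).2 hb, (hD b c).2 hbD⟩

end FibreCech

namespace SectionSystem

open MvPolynomial

variable {n : ℕ} {K R : Type*} [Field K] [CommRing R] [Algebra K R] (s : SectionSystem K R n)

local notation "S" => MvPolynomial (Fin (n + 1)) K
local notation "Q" => FractionRing (MvPolynomial (Fin (n + 1)) K)

/-- The polynomials which vanish on the subscheme, as vectors with one entry. -/
def kerVec : Submodule (MvPolynomial (Fin (n + 1)) K) (Unit → MvPolynomial (Fin (n + 1)) K) where
  carrier := {p | s.ev (p ()) = 0}
  zero_mem' := map_zero _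
  add_mem' {p q} hp hq := by
    change s.ev (p () + q ()) = 0
    rw [map_add, hp, hq, add_zero]
  smul_mem' g p hp := by
    change s.ev (g * p ()) = 0
    rw [map_mul, hp, mul_zero]

lemma mem_kerVec {p : Unit → MvPolynomial (Fin (n + 1)) K} : p ∈ s.kerVec ↔ s.ev (p ()) = 0 :=
  Iff.rfl

lemma varProd_singleton (k : Fin (n + 1)) : varProd K {k} = X k := Finset.prod_singleton _ _

lemma varProd_pair {k l : Fin (n + 1)} (h : k ≠ l) : varProd K {k, l} = X k * X l :=
  Finset.prod_pair h

/-- Polynomial expressions on the sets `D_+(x_k)` which agree on the subscheme glue to a section. -/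
lemma exists_sec_of_locMod {e : ℤ}
    (f : Finset (Fin (n + 1)) → Unit → FractionRing (MvPolynomial (Fin (n + 1)) K))
    (hf : ∀ σ, σ.card = 1 → f σ ∈ LocMod ⊤ 0 e σ)
    (hD : ∀ σ, σ.card = 2 → setD f σ ∈ LocMod s.kerVec 0 e σ) :
    ∃ m ∈ s.sec e, ∃ (N : ℕ) (p : Fin (n + 1) → MvPolynomial (Fin (n + 1)) K),
      (∀ k, HomZ (p k) (e + N)) ∧ (∀ k, f {k} () * algebraMap S Q (X k ^ N) =
        algebraMap S Q (p k)) ∧ ∀ k, s.ev (X k) ^ N * m = s.ev (p k) := by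
  choose M₀ hM₀ using fun k ↦ LocMod.exists_of_ge (hf {k} (Finset.card_singleton k))
  have h₀ : ∀ k l, ∃ L₀ : ℕ, ∀ L ≥ L₀, ∃ q, s.ev q = 0 ∧
      (f {l} () - f {k} ()) * algebraMap S Q ((X k * X l) ^ L) = algebraMap S Q q := by
    intro k l
    by_cases hkl : k = l
    · exact ⟨0, fun L _ ↦ ⟨0, map_zero _, by rw [hkl, sub_self, zero_mul, map_zero]⟩⟩
    · have h := hD {k, l} (Finset.card_pair hkl)
      have h' : f {l} - f {k} ∈ LocMod s.kerVec 0 e {k, l} := by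
        rw [setD_pair hkl] at h
        rcases cechSign_eq_or k {k, l} with h₁ | h₁
        · rwa [h₁, one_smul] at h
        · rwa [h₁, neg_smul, one_smul, neg_mem_iff] at h
      obtain ⟨L₀, hL₀⟩ := LocMod.exists_of_ge h'
      refine ⟨L₀, fun L hL ↦ ?_⟩
      obtain ⟨q, hq, -, hq'⟩ := hL₀ L hL
      have := hq' ()
      rw [varProd_pair hkl] at this
      exact ⟨q (), hq, this⟩
  choose L₀ hL₀ using h₀
  set M := ∑ k, M₀ k
  choose p _ hp hp' using fun k ↦ hM₀ k M (Finset.single_le_sum (f := M₀)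
    (fun _ _ ↦ Nat.zero_le _) (Finset.mem_univ k))
  set L := ∑ k, ∑ l, L₀ k l
  choose q hq hq' using fun k l ↦ hL₀ k l L ((Finset.single_le_sum (f := L₀ k)
    (fun _ _ ↦ Nat.zero_le _) (Finset.mem_univ l)).trans
      (Finset.single_le_sum (f := fun k ↦ ∑ l, L₀ k l) (fun _ _ ↦ Nat.zero_le _)
        (Finset.mem_univ k)))
  have hp₁ : ∀ k, HomZ (X k ^ L * p k ()) (e + (M + L : ℕ)) := fun k ↦ by
    have := (homZ_X_pow (B := K) k L).mul (hp k ())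
    rw [Pi.zero_apply, sub_zero, Finset.card_singleton] at this
    convert this using 1
    push_cast
    ring
  have hp₂ : ∀ k, f {k} () * algebraMap S Q (X k ^ (M + L)) =
      algebraMap S Q (X k ^ L * p k ()) := fun k ↦ by
    have := hp' k ()
    rw [varProd_singleton] at this
    rw [map_mul, ← this, pow_add, map_mul]
    ring
  have hp₃ : ∀ k l, s.ev (X l) ^ (M + L) * s.ev (X k ^ L * p k ()) =
      s.ev (X k) ^ (M + L) * s.ev (X l ^ L * p l ()) := by
    intro k l
    have h : X k ^ (M + L) * (X l ^ L * p l ()) - X l ^ (M + L) * (X k ^ L * p k ()) =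
        (X k * X l) ^ M * q k l := by
      apply IsFractionRing.injective S Q
      rw [map_sub, map_mul _ (X k ^ (M + L)), map_mul _ (X l ^ (M + L)),
        map_mul _ ((X k * X l) ^ M), ← hq', ← hp₂, ← hp₂]
      simp only [map_mul, map_pow, pow_add, mul_pow]
      ring
    have h' := congrArg s.ev h
    rw [map_mul s.ev _ (q k l), hq, mul_zero, map_sub, sub_eq_zero, map_mul, map_pow,
      map_mul s.ev (X l ^ (M + L)), map_pow s.ev (X l)] at h'
    exact h'.symm
  obtain ⟨v, hv, hv'⟩ := s.partition (M + L)
  refine ⟨∑ k, v k * s.ev (X k ^ L * p k ()), Submodule.sum_mem _ fun k _ ↦ ?_, M + L,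
    fun k ↦ X k ^ L * p k (), hp₁, hp₂, fun l ↦ ?_⟩
  · have := s.mul_mem (hv k) (s.ev_mem (hp₁ k))
    rwa [show -((M + L : ℕ) : ℤ) + (e + (M + L : ℕ)) = e by ring] at this
  · rw [Finset.mul_sum]
    conv_rhs => rw [← one_mul (s.ev _), ← hv', Finset.sum_mul]
    refine Finset.sum_congr rfl fun k _ ↦ ?_
    rw [mul_left_comm, hp₃]
    ring

end SectionSystem

/-! ### The ideal sheaf of a subscheme of projective space that is finite over a field -/

namespace SectionSystem

open MvPolynomial

variable {n : ℕ} {K R : Type*} [Field K] [CommRing R] [Algebra K R] (s : SectionSystem K R n)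

local notation "S" => MvPolynomial (Fin (n + 1)) K
local notation "Q" => FractionRing (MvPolynomial (Fin (n + 1)) K)

lemma LocMod.mem_top {N : Submodule (MvPolynomial (Fin (n + 1)) K)
    (Unit → MvPolynomial (Fin (n + 1)) K)} {t : ℤ} {σ : Finset (Fin (n + 1))}
    {f : Unit → FractionRing (MvPolynomial (Fin (n + 1)) K)} (hf : f ∈ LocMod N 0 t σ) :
    f ∈ LocMod ⊤ 0 t σ := LocMod.mono_left (fun _ _ _ _ ↦ Submodule.mem_top) hf

lemma algebraMap_X_pow_ne_zero (k : Fin (n + 1)) (N : ℕ) : algebraMap S Q (X k ^ N) ≠ 0 := by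
  have := algebraMap_varProd_pow_ne_zero (K := K) {k} N
  rwa [varProd_singleton] at this

/-- `H^1` of the ideal sheaf is the cokernel of the evaluation of polynomials. -/
lemma Gen.setVanishes_one {e : ℤ} (h : s.Gen e) (he : -n - 1 < e) : SetVanishes s.kerVec 1 e := by
  intro c hc hcD
  obtain ⟨f, hf, hfc⟩ := exists_setD_eq_of_lt (a := 0) (t := e)
    (fun _ ↦ by rw [Pi.zero_apply]; linarith) 1 c
    (fun σ hσ ↦ LocMod.mem_top (hc σ hσ)) hcD
  obtain ⟨m, hm, N, p, hp, hfp, hpm⟩ := exists_sec_of_locMod s f hf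
    fun σ hσ ↦ by rw [hfc σ hσ]; exact hc σ hσ
  obtain ⟨P, hP, rfl⟩ := h m hm
  refine ⟨fun τ ↦ f τ - fun _ ↦ algebraMap S Q P, fun τ hτ ↦ ?_, fun σ hσ ↦ ?_⟩
  · obtain ⟨k, rfl⟩ := Finset.card_eq_one.1 hτ
    refine ⟨N, fun _ ↦ p k - X k ^ N * P, ?_, fun _ ↦ ?_, fun _ ↦ ?_⟩
    · rw [mem_kerVec, map_sub, map_mul, map_pow, hpm, sub_self]
    · rw [Pi.zero_apply, sub_zero, Finset.card_singleton, Nat.cast_one, mul_one]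
      refine (hp k).sub ?_
      rw [add_comm e]
      exact (homZ_X_pow k N).mul hP
    · rw [varProd_singleton, map_sub, ← hfp, map_mul]
      change (f {k} () - algebraMap S Q P) * _ = _
      ring
  · obtain ⟨k, l, hkl, rfl⟩ := Finset.card_eq_two.1 hσ
    rw [← hfc _ hσ, setD_pair hkl, setD_pair hkl, sub_sub_sub_cancel_right]

/-- A section of `O_Y(e)` lifts to `O(e)` on each `D_+(x_k)`. The differences of the lifts form a
cocycle of the ideal sheaf; if it is a coboundary, the lifts can be corrected to a polynomial. -/
lemma gen_of_setVanishes_one (hn : 1 ≤ n) {e : ℤ} (h : SetVanishes s.kerVec 1 e) : s.Gen e := by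
  intro m hm
  obtain ⟨N, hN⟩ := s.exists_ev_all hm
  choose p hp hpm using hN N le_rfl
  set f : Finset (Fin (n + 1)) → Unit → Q := fun τ _ ↦
    ∑ k ∈ τ, algebraMap S Q (p k) / algebraMap S Q (X k ^ N) with hf
  have hfk : ∀ k, f {k} () * algebraMap S Q (X k ^ N) = algebraMap S Q (p k) := fun k ↦ by
    simp only [hf, Finset.sum_singleton]
    exact div_mul_cancel₀ _ (algebraMap_X_pow_ne_zero k N)
  have hf₁ : ∀ k, f {k} ∈ LocMod ⊤ 0 e {k} := fun k ↦ by
    refine ⟨N, fun _ ↦ p k, trivial, fun _ ↦ ?_, fun _ ↦ ?_⟩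
    · simpa using hp k
    · rw [varProd_singleton]
      exact hfk k
  obtain ⟨b, hb, hbf⟩ := h (setD f) (fun σ hσ ↦ by
    obtain ⟨k, l, hkl, rfl⟩ := Finset.card_eq_two.1 hσ
    rw [setD_pair hkl]
    have h₁ : f {l} - f {k} ∈ LocMod s.kerVec 0 e {k, l} := by
      refine ⟨N, fun _ ↦ p l * X k ^ N - p k * X l ^ N, ?_, fun _ ↦ ?_, fun _ ↦ ?_⟩
      · rw [mem_kerVec, map_sub, map_mul, map_mul, hpm, hpm, map_pow, map_pow]
        ring
      · rw [Pi.zero_apply, sub_zero, Finset.card_pair hkl]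
        convert ((hp l).mul (homZ_X_pow k N)).sub ((hp k).mul (homZ_X_pow l N)) using 1
        push_cast
        ring
      · rw [varProd_pair hkl, map_sub, map_mul, map_mul, ← hfk, ← hfk, Pi.sub_apply, mul_pow,
          map_mul]
        ring
    exact zsmul_mem h₁ _) fun σ _ ↦ setD_setD f σ
  -- the difference of `f` and `b` does not depend on the chart, so it is a polynomial
  have hg : ∀ k, f {k} - b {k} = f {0} - b {0} := fun k ↦ by
    by_cases hk : 0 = k
    · rw [hk]
    · have h₁ := hbf {0, k} (Finset.card_pair hk)
      rw [setD_pair hk, setD_pair hk] at h₁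
      have h₂ : b {k} - b {0} = f {k} - f {0} := by
        rcases cechSign_eq_or 0 {0, k} with h₃ | h₃
        · rwa [h₃, one_smul, one_smul] at h₁
        · rw [h₃, neg_smul, neg_smul, one_smul, one_smul] at h₁
          exact neg_injective h₁
      rw [sub_eq_sub_iff_sub_eq_sub, h₂]
  obtain ⟨P, hP, hPg⟩ := LocMod.exists_eq_algebraMap (a := 0) (t := e) (f := f {0} - b {0})
    (fun k ↦ by
      rw [← hg k]
      exact sub_mem (hf₁ k) (LocMod.mem_top (hb _ (by simp))))
    (Or.inl hn)
  refine ⟨P (), by simpa using hP (), ?_⟩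
  choose M₀ hM₀ using fun k ↦ LocMod.exists_of_ge (hb {k} (Finset.card_singleton k))
  set M := ∑ k, M₀ k
  rw [← sub_eq_zero]
  refine s.eq_zero_of_forall (M + N) fun k ↦ ?_
  obtain ⟨j, hj, -, hbj⟩ := hM₀ k M (Finset.single_le_sum (f := M₀)
    (fun _ _ ↦ Nat.zero_le _) (Finset.mem_univ k))
  have h₁ : X k ^ (M + N) * P () = X k ^ M * p k - X k ^ N * j () := by
    apply IsFractionRing.injective S Q
    have := hbj ()
    rw [varProd_singleton] at this
    rw [map_sub, map_mul, map_mul, map_mul, ← hPg, ← hg k, ← this, ← hfk, Pi.sub_apply, pow_add,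
      map_mul]
    ring
  have h₂ := congrArg s.ev h₁
  rw [map_mul, map_sub, map_mul, map_mul _ _ (j ()), s.mem_kerVec.1 hj, hpm] at h₂
  simp only [map_pow] at h₂
  rw [mul_sub, h₂, pow_add]
  ring

/-- The sections `v k` of `partition` extend to the sets `D_+(x_l)`. -/
lemma exists_locMod_partition (N : ℕ) : ∃ r : Fin (n + 1) → Fin (n + 1) → Unit → Q,
    (∀ k l, r k l ∈ LocMod ⊤ 0 (-N) {l}) ∧
    (∀ k l l', r k l - r k l' ∈ LocMod s.kerVec 0 (-N) {l, l'}) ∧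
    ∀ l, (fun _ ↦ ∑ k, r k l () * algebraMap S Q (X k ^ N) - 1) ∈ LocMod s.kerVec 0 0 {l} := by
  obtain ⟨v, hv, hv'⟩ := s.partition N
  choose M₀ hM₀ using fun k ↦ s.exists_ev_all (hv k)
  set M := ∑ k, M₀ k
  choose V hV hVv using fun k l ↦ hM₀ k M (Finset.single_le_sum (f := M₀)
    (fun _ _ ↦ Nat.zero_le _) (Finset.mem_univ k)) l
  set r : Fin (n + 1) → Fin (n + 1) → Unit → Q := fun k l _ ↦
    algebraMap S Q (V k l) / algebraMap S Q (X l ^ M) with hr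
  have hrV : ∀ k l, r k l () * algebraMap S Q (X l ^ M) = algebraMap S Q (V k l) := fun k l ↦
    div_mul_cancel₀ _ (algebraMap_X_pow_ne_zero l M)
  refine ⟨r, fun k l ↦ ⟨M, fun _ ↦ V k l, trivial, fun _ ↦ ?_, fun _ ↦ ?_⟩,
    fun k l l' ↦ ?_, fun l ↦ ⟨M, fun _ ↦ ∑ k, V k l * X k ^ N - X l ^ M, ?_, fun _ ↦ ?_,
      fun _ ↦ ?_⟩⟩
  · simpa using hV k l
  · rw [varProd_singleton]
    exact hrV k l
  · by_cases hl : l = l'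
    · rw [hl, sub_self]
      exact zero_mem _
    refine ⟨M, fun _ ↦ V k l * X l' ^ M - V k l' * X l ^ M, ?_, fun _ ↦ ?_, fun _ ↦ ?_⟩
    · rw [mem_kerVec, map_sub, map_mul, map_mul, hVv, hVv, map_pow, map_pow]
      ring
    · rw [Pi.zero_apply, sub_zero, Finset.card_pair hl]
      convert ((hV k l).mul (homZ_X_pow l' M)).sub ((hV k l').mul (homZ_X_pow l M)) using 1
      push_cast
      ring
    · rw [varProd_pair hl, map_sub, map_mul, map_mul, ← hrV, ← hrV, Pi.sub_apply, mul_pow, map_mul]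
      ring
  · rw [mem_kerVec, map_sub, map_sum, sub_eq_zero, map_pow, ← mul_one (s.ev (X l) ^ M), ← hv',
      Finset.mul_sum]
    refine Finset.sum_congr rfl fun k _ ↦ ?_
    rw [map_mul, hVv, map_pow]
    ring
  · rw [Pi.zero_apply, sub_zero, Finset.card_singleton, Nat.cast_one, mul_one, zero_add]
    refine HomZ.sub (HomZ.sum fun k _ ↦ ?_) (homZ_X_pow l M)
    convert (hV k l).mul (homZ_X_pow k N) using 1
    ring
  · rw [varProd_singleton, map_sub, map_sum, sub_mul, one_mul, Finset.sum_mul]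
    congr 1
    refine Finset.sum_congr rfl fun k _ ↦ ?_
    rw [map_mul, ← hrV]
    ring

/-- As the subscheme is affine, its structure sheaf has no higher cohomology, and the ideal sheaf
none in degrees `q ≥ 2`. A cochain of `O(d)` which is a cocycle on the subscheme is a coboundary
there by means of the contractions with the various indices and a partition of unity. -/
lemma setVanishes_of_two_le {q : ℕ} (hq : 2 ≤ q) {d : ℤ} (hd : -n - 1 < d) :
    SetVanishes s.kerVec q d := by
  intro c hc hcD
  obtain ⟨b, hb, hbc⟩ := exists_setD_eq_of_lt (a := 0) (t := d)
    (fun _ ↦ by rw [Pi.zero_apply]; linarith) q c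
    (fun σ hσ ↦ LocMod.mem_top (hc σ hσ)) hcD
  have h₁ : ∀ k (τ : Finset (Fin (n + 1))), ∃ M₀ : ℕ, ∀ M ≥ M₀, τ.card + 1 = q →
      (fun i ↦ algebraMap S Q (X k ^ M) * contract k b τ i) ∈ LocMod ⊤ 0 (M + d) τ := by
    intro k τ
    by_cases hk : k ∈ τ
    · refine ⟨0, fun M _ _ ↦ ?_⟩
      rw [contract_of_mem hk]
      simp only [Pi.zero_apply, mul_zero]
      exact zero_mem (LocMod ⊤ 0 (M + d) τ)
    by_cases hτ : τ.card + 1 = q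
    · obtain ⟨M₀, hM₀⟩ := LocMod.exists_pow_mul_mem (hb (insert k τ)
        ((Finset.card_insert_of_notMem hk).trans hτ))
      refine ⟨M₀, fun M hM _ ↦ ?_⟩
      convert zsmul_mem (hM₀ M hM) (cechSign k τ) using 1
      funext i
      rw [contract_of_notMem hk, Pi.smul_apply, Pi.smul_apply, mul_smul_comm]
    · exact ⟨0, fun _ _ h ↦ absurd h hτ⟩
  have h₂ : ∀ k (τ : Finset (Fin (n + 1))), ∃ M₀ : ℕ, ∀ M ≥ M₀, τ.card = q →
      (fun i ↦ algebraMap S Q (X k ^ M) * contract k (setD b) τ i) ∈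
        LocMod s.kerVec 0 (M + d) τ := by
    intro k τ
    by_cases hk : k ∈ τ
    · refine ⟨0, fun M _ _ ↦ ?_⟩
      rw [contract_of_mem hk]
      simp only [Pi.zero_apply, mul_zero]
      exact zero_mem (LocMod s.kerVec 0 (M + d) τ)
    by_cases hτ : τ.card = q
    · have hτ' : (insert k τ).card = q + 1 := by rw [Finset.card_insert_of_notMem hk, hτ]
      obtain ⟨M₀, hM₀⟩ := LocMod.exists_pow_mul_mem (hc (insert k τ) hτ')
      refine ⟨M₀, fun M hM _ ↦ ?_⟩
      convert zsmul_mem (hM₀ M hM) (cechSign k τ) using 1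
      funext i
      rw [contract_of_notMem hk, Pi.smul_apply, Pi.smul_apply, mul_smul_comm, hbc _ hτ']
    · exact ⟨0, fun _ _ h ↦ absurd h hτ⟩
  choose M₁ hM₁ using h₁
  choose M₂ hM₂ using h₂
  set N := ∑ k, ∑ τ, (M₁ k τ + M₂ k τ)
  have hN : ∀ k τ, M₁ k τ + M₂ k τ ≤ N := fun k τ ↦
    (Finset.single_le_sum (f := fun τ ↦ M₁ k τ + M₂ k τ)
      (fun _ _ ↦ Nat.zero_le _) (Finset.mem_univ τ)).trans
      (Finset.single_le_sum (f := fun k ↦ ∑ τ, (M₁ k τ + M₂ k τ)) (fun _ _ ↦ Nat.zero_le _)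
        (Finset.mem_univ k))
  replace hM₁ := fun k τ ↦ hM₁ k τ N ((Nat.le_add_right _ _).trans (hN k τ))
  replace hM₂ := fun k τ ↦ hM₂ k τ N ((Nat.le_add_left _ _).trans (hN k τ))
  obtain ⟨r, hr, hrr, hr1⟩ := s.exists_locMod_partition N
  let l : Finset (Fin (n + 1)) → Fin (n + 1) := fun τ ↦ if h : τ.Nonempty then h.choose else 0
  have hl : ∀ τ : Finset (Fin (n + 1)), τ.Nonempty → l τ ∈ τ := fun τ h ↦ by
    simp only [l, dif_pos h]
    exact h.choose_spec
  -- the multiple of a contraction by a member of the partition of unity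
  let w : Fin (n + 1) → Fin (n + 1) → Finset (Fin (n + 1)) → Unit → Q := fun k l τ i ↦
    r k l () * (algebraMap S Q (X k ^ N) * contract k b τ i)
  let b' : Finset (Fin (n + 1)) → Unit → Q := fun τ ↦ ∑ k, w k (l τ) τ
  have hb' : ∀ τ, τ.card + 1 = q → b' τ ∈ LocMod ⊤ 0 d τ := fun τ hτ ↦ by
    refine sum_mem fun k _ ↦ ?_
    have hτ' : τ.Nonempty := Finset.card_pos.1 (by omega)
    have := LocMod.mul_mem_of_top (hM₁ k τ hτ) (LocMod.mono (hr k (l τ))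
      (Finset.singleton_subset_iff.2 (hl τ hτ')))
    rwa [neg_add_cancel_left] at this
  refine ⟨fun τ ↦ b τ - setD b' τ, fun τ hτ ↦ ?_, fun σ hσ ↦ ?_⟩
  · have hτ' : τ.Nonempty := Finset.card_pos.1 (by omega)
    have hlτ := Finset.singleton_subset_iff.2 (hl τ hτ')
    -- up to sections of the ideal, the choice of `l` does not matter
    have h₃ : setD b' τ - setD (fun τ' ↦ ∑ k, w k (l τ) τ') τ ∈ LocMod s.kerVec 0 d τ := by
      rw [← setD_sub]
      refine sum_mem fun j hj ↦ zsmul_mem ?_ _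
      have hj' : (τ.erase j).card + 1 = q := by rw [Finset.card_erase_add_one hj, hτ]
      have hj'' : (τ.erase j).Nonempty := Finset.card_pos.1 (by omega)
      simp only [b', ← Finset.sum_sub_distrib]
      refine sum_mem fun k _ ↦ ?_
      have h₄ := LocMod.mono (hM₁ k _ hj') (Finset.erase_subset j τ)
      have h₅ := LocMod.mono (hrr k (l (τ.erase j)) (l τ)) (τ := τ)
        (Finset.insert_subset (Finset.erase_subset j τ (hl _ hj'')) hlτ)
      obtain ⟨M, p, -, hp, hpM⟩ := h₄
      have := LocMod.mul_mem h₅ (by simpa using hp ()) (hpM ())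
      rw [add_right_comm, add_neg_cancel, zero_add] at this
      convert this using 1
      funext i
      simp only [w, Pi.sub_apply]
      ring
    have h₄ : b τ - setD (fun τ' ↦ ∑ k, w k (l τ) τ') τ ∈ LocMod s.kerVec 0 d τ := by
      have h₅ : setD (fun τ' ↦ ∑ k, w k (l τ) τ') τ = ∑ k, fun i ↦ r k (l τ) () *
          (algebraMap S Q (X k ^ N) * (b τ i - contract k (setD b) τ i)) := by
        rw [setD_sum]
        refine Finset.sum_congr rfl fun k _ ↦ ?_
        have h₆ := setD_map (AddMonoidHom.mulLeft
          (fun _ ↦ r k (l τ) () * algebraMap S Q (X k ^ N) : Unit → Q)) (contract k b) τ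
        rw [← setD_contract_add k b τ]
        funext i
        rw [Pi.add_apply, add_sub_cancel_right, ← mul_assoc]
        refine Eq.trans ?_ (congrFun h₆ i)
        refine congrFun (congrArg (fun c ↦ setD c τ) ?_) i
        funext τ' i
        exact (mul_assoc _ _ _).symm
      rw [h₅]
      have h₆ : (fun i ↦ b τ i * (∑ k, r k (l τ) () * algebraMap S Q (X k ^ N) - 1)) ∈
          LocMod s.kerVec 0 d τ := by
        obtain ⟨M, p, -, hp, hpM⟩ := hb τ hτ
        have := LocMod.mul_mem (LocMod.mono (hr1 (l τ)) hlτ) (by simpa using hp ()) (hpM ())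
        rwa [add_zero] at this
      have h₇ : ∀ k, (fun i ↦ r k (l τ) () * (algebraMap S Q (X k ^ N) *
          contract k (setD b) τ i)) ∈ LocMod s.kerVec 0 d τ := fun k ↦ by
        have := LocMod.mul_mem_of_top (hM₂ k τ hτ) (LocMod.mono (hr k (l τ)) hlτ)
        rwa [neg_add_cancel_left] at this
      convert sub_mem (sum_mem fun k (_ : k ∈ Finset.univ) ↦ h₇ k) h₆ using 1
      funext i
      simp only [Pi.sub_apply, Finset.sum_apply, mul_sub, Finset.sum_sub_distrib, Finset.mul_sum]
      rw [Finset.sum_congr rfl fun k _ ↦ show b τ i * (r k (l τ) () * algebraMap S Q (X k ^ N)) =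
        r k (l τ) () * (algebraMap S Q (X k ^ N) * b τ i) by ring]
      ring
    have := sub_mem h₄ h₃
    rwa [sub_sub, add_sub_cancel] at this
  · rw [setD_sub, setD_setD, sub_zero, hbc σ hσ]

lemma setVanishes_of_lt {J : Submodule (MvPolynomial (Fin (n + 1)) K)
    (Unit → MvPolynomial (Fin (n + 1)) K)} {q : ℕ} (hq : n < q) (d : ℤ) : SetVanishes J q d :=
  fun c _ _ ↦ ⟨0, fun _ _ ↦ zero_mem _, fun σ hσ ↦ absurd (Finset.card_le_univ σ) (by
    rw [hσ, Fintype.card_fin]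
    omega)⟩

/-- The ideal sheaf of the empty subscheme is `O`, whose top cohomology does not vanish in degrees
at most `-n - 1`. -/
lemma not_setVanishes (h : (1 : R) = 0) {d : ℤ} (hd : d ≤ -n - 1) :
    ¬ SetVanishes s.kerVec n d := by
  intro hv
  have hJ : ∀ p, p ∈ s.kerVec := fun p ↦ eq_zero_of_zero_eq_one h.symm _
  obtain ⟨f, hf, hfb⟩ := exists_not_setD (K := K) hd
  have huniv : ∀ σ : Finset (Fin (n + 1)), σ.card = n + 1 → σ = Finset.univ := fun σ hσ ↦
    (Finset.card_eq_iff_eq_univ σ).1 (by rw [hσ, Fintype.card_fin])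
  obtain ⟨b, hb, hbf⟩ := hv (fun _ ↦ f) (fun σ hσ ↦ by
    rw [huniv σ hσ]
    exact LocMod.mono_left (fun p _ _ _ ↦ hJ p) hf) fun σ hσ ↦ absurd (Finset.card_le_univ σ) (by
      rw [hσ, Fintype.card_fin]
      omega)
  exact hfb b (fun τ hτ ↦ LocMod.mem_top (hb τ hτ)) (hbf _ (by simp))

/-- A subscheme which is finite over a field is not all of `P^n`: the functions on it form a space
of finite dimension. -/
lemma exists_ne_zero_of_finite (hn : 1 ≤ n) (hfg : (s.sec 0).FG) :
    ∃ p z, HomZ p z ∧ s.ev p = 0 ∧ p ≠ 0 := by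
  by_contra! hev
  have : Module.Finite K (s.sec 0) := Module.Finite.iff_fg.2 hfg
  set N := Module.finrank K (Fin (n + 1) → s.sec 0)
  obtain ⟨v, hv, hv'⟩ := s.partition N
  -- the `N + 1` monomials `x_0 ^ j * x_n ^ (N - j)` in a space of sections of dimension at most `N`
  let mono : Fin (N + 1) → (Fin (n + 1) →₀ ℕ) := fun j ↦
    Finsupp.single 0 (j : ℕ) + Finsupp.single (Fin.last n) (N - j)
  have hmono : ∀ j, (mono j).degree = N := fun j ↦ by
    have := j.2
    simp only [mono, map_add, Finsupp.degree_single]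
    omega
  have h0 : (0 : Fin (n + 1)) ≠ Fin.last n := by
    intro h
    have := congrArg Fin.val h
    simp at this
    omega
  have hinj : Function.Injective mono := fun i j hij ↦ by
    have := DFunLike.congr_fun hij 0
    simp only [mono, Finsupp.add_apply, Finsupp.single_eq_same, Finsupp.single_eq_of_ne h0,
      add_zero] at this
    exact Fin.ext this
  have hhom : ∀ j, HomZ (monomial (mono j) (1 : K)) N := fun j ↦ by
    have := homZ_monomial (mono j) (1 : K)
    rwa [hmono] at this
  have hli : LinearIndependent K (fun j : Fin (N + 1) ↦ (fun k ↦
      ⟨s.ev (monomial (mono j) 1) * v k, by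
        have := s.mul_mem (s.ev_mem (hhom j)) (hv k)
        rwa [add_neg_cancel] at this⟩ : Fin (n + 1) → s.sec 0)) := by
    rw [Fintype.linearIndependent_iff]
    intro g hg
    have h₁ : ∀ k, s.ev (∑ j, C (g j) * monomial (mono j) 1) * v k = 0 := fun k ↦ by
      have h₂ := congrArg Subtype.val (congrFun hg k)
      simp only [Finset.sum_apply, Pi.smul_apply, Submodule.coe_sum, Submodule.coe_smul,
        Pi.zero_apply, Submodule.coe_zero] at h₂
      rw [map_sum, Finset.sum_mul, ← h₂]
      refine Finset.sum_congr rfl fun j _ ↦ ?_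
      rw [← smul_eq_C_mul, map_smul, smul_mul_assoc]
    have h₃ : ∑ j, C (g j) * monomial (mono j) 1 = 0 := by
      refine hev _ N (HomZ.sum fun j _ ↦ (hhom j).C_mul _) ?_
      rw [← mul_one (s.ev _), ← hv', Finset.mul_sum]
      refine Finset.sum_eq_zero fun k _ ↦ ?_
      rw [mul_left_comm, h₁, mul_zero]
    intro j
    have h₄ := congrArg (coeff (mono j)) h₃
    rw [coeff_sum, coeff_zero, Finset.sum_eq_single_of_mem j (Finset.mem_univ _)] at h₄
    · simpa using h₄
    · intro i _ hij
      rw [coeff_C_mul, coeff_monomial, if_neg fun h ↦ hij (hinj h), mul_zero]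
  have := hli.fintype_card_le_finrank
  rw [Fintype.card_fin] at this
  omega

end SectionSystem

open MvPolynomial in
/-- The regularity of a subscheme that is finite over a field depends only on whether its sections
are polynomials. -/
lemma SectionSystem.isRegularity_iff {n : ℕ} {K : Type u} {R : Type*} [Field K] [CommRing R]
    [Algebra K R] (s : SectionSystem K R n) (hn : 1 ≤ n) (hfg : (s.sec 0).FG)
    {I : Ideal (MvPolynomial (Fin (n + 1)) K)} (hI : ∀ p z, HomZ p z → (p ∈ I ↔ s.ev p = 0))
    {r : ℤ} : IsRegularity I r ↔ IsLeast {r : ℤ | 0 ≤ r ∧ s.Gen (r - 1)} r := by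
  have hbot : I ≠ ⊥ := by
    rintro rfl
    obtain ⟨p, z, hp, hp0, hne⟩ := s.exists_ne_zero_of_finite hn hfg
    exact hne ((hI p z hp).2 hp0)
  have hset : {r : ℤ | ∀ q : ℕ, 0 < q → CechVanishes I q (r - q)} =
      {r : ℤ | 0 ≤ r ∧ s.Gen (r - 1)} := by
    have hiff : ∀ {q : ℕ} (_ : 0 < q) {d : ℤ}, CechVanishes I q d ↔ SetVanishes s.kerVec q d :=
      fun hq ↦ cechVanishes_iff (fun p z hp ↦ hI _ z hp) hq
    ext r
    constructor
    · intro h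
      have hgen : s.Gen (r - 1) :=
        s.gen_of_setVanishes_one hn ((hiff one_pos).1 (by simpa using h 1 one_pos))
      refine ⟨?_, hgen⟩
      -- for `r < 0` only the empty subscheme satisfies `Gen (r - 1)`, and its ideal sheaf is `O`
      by_contra! hr
      exact s.not_setVanishes (SectionSystem.Gen.one_eq_zero s hgen (by omega)) (by omega)
        ((hiff hn).1 (h n hn))
    · rintro ⟨hr, hgen⟩ q hq
      rw [hiff hq]
      rcases lt_or_ge n q with hqn | hqn
      · exact SectionSystem.setVanishes_of_lt hqn _
      rcases (show 1 ≤ q from hq).eq_or_lt with rfl | hq2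
      · exact SectionSystem.Gen.setVanishes_one s (by simpa using hgen) (by push_cast; omega)
      · exact s.setVanishes_of_two_le hq2 (by omega)
  rw [IsRegularity, hset]
  exact ⟨fun h ↦ (h.resolve_left fun h ↦ hbot h.1).2, fun h ↦ Or.inr ⟨hbot, h⟩⟩

/-! ### Extending sections of line bundles from the locus where another section does not vanish -/

section Extension

variable {Y : Scheme.{u}}

lemma res_self {U : Y.Opens} (x : Γ(Y, U)) : res le_rfl x = x := by
  have h : homOfLE (le_refl U) = 𝟙 U := rfl
  rw [res, h, op_id, CategoryTheory.Functor.map_id]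
  rfl

lemma basicOpen_res' {U V D : Y.Opens} (h : V ≤ U) {f : Γ(Y, U)} (hD : Y.basicOpen f = D) :
    Y.basicOpen (res h f) = V ⊓ D := by
  rw [← hD]
  exact Scheme.basicOpen_res Y f (homOfLE h).op

lemma exists_pow_mul_eq_zero {U D : Y.Opens} (hU : IsAffineOpen U) {f : Γ(Y, U)}
    (hD : Y.basicOpen f = D) (hDU : D ≤ U) {x : Γ(Y, U)} (h : res hDU x = 0) :
    ∃ N₀ : ℕ, ∀ N ≥ N₀, f ^ N * x = 0 := by
  subst hD
  obtain ⟨N₀, h₀⟩ := exists_pow_mul_eq_zero_of_res_basicOpen_eq_zero_of_isAffineOpen Y hU x f h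
  refine ⟨N₀, fun N hN ↦ ?_⟩
  rw [← Nat.sub_add_cancel hN, pow_add, mul_assoc, h₀, mul_zero]

lemma exists_res_eq_pow_mul {U D : Y.Opens} (hU : IsAffineOpen U) {f : Γ(Y, U)}
    (hD : Y.basicOpen f = D) (hDU : D ≤ U) (z : Γ(Y, D)) :
    ∃ N₀ : ℕ, ∀ N ≥ N₀, ∃ y, res hDU y = res hDU f ^ N * z := by
  subst hD
  obtain ⟨N₀, y, h₀⟩ := exists_eq_pow_mul_of_isAffineOpen Y U hU f z
  refine ⟨N₀, fun N hN ↦ ⟨f ^ (N - N₀) * y, ?_⟩⟩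
  have h₁ : res hDU y = res hDU f ^ N₀ * z := h₀
  rw [map_mul, map_pow, h₁, ← mul_assoc, ← pow_add, Nat.sub_add_cancel hN]

/-- Let `M` and `H` be line bundles on `Y`, with transition functions `g` and `h`, and `τ` a section
of `H`. A section of `M` over the open set where `τ ≠ 0` extends to `Y` as a section of `M ⊗ H^N`
after multiplication by `τ ^ N`. -/
theorem exists_extension {ι : Type*} [Finite ι] {U : ι → Y.Opens} {D : Y.Opens}
    (hU : ∀ a, IsAffineOpen (U a)) (hUU : ∀ a b, IsAffineOpen (U a ⊓ U b))
    (g h : ∀ a b, Γ(Y, U a ⊓ U b)) (τ : ∀ a, Γ(Y, U a))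
    (hτ : ∀ a b, res (V := U a ⊓ U b) inf_le_left (τ a) = h a b * res inf_le_right (τ b))
    (hD : ∀ a, Y.basicOpen (τ a) = U a ⊓ D) (m : ∀ a, Γ(Y, U a ⊓ D))
    (hm : ∀ a b, res (V := U a ⊓ U b ⊓ D) (inf_le_inf_right D inf_le_left) (m a) =
      res inf_le_left (g a b) * res (inf_le_inf_right D inf_le_right) (m b)) :
    ∃ N₀ : ℕ, ∀ N ≥ N₀, ∃ w : ∀ a, Γ(Y, U a),
      (∀ a, res (V := U a ⊓ D) inf_le_left (w a) = res inf_le_left (τ a) ^ N * m a) ∧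
      ∀ a b, res (V := U a ⊓ U b) inf_le_left (w a) =
        g a b * h a b ^ N * res inf_le_right (w b) := by
  have := Fintype.ofFinite ι
  choose M₀ hM₀ using fun a ↦ exists_res_eq_pow_mul (hU a) (hD a) inf_le_left (m a)
  set M := ∑ a, M₀ a
  choose w hw using fun a ↦ hM₀ a M (Finset.single_le_sum (f := M₀)
    (fun _ _ ↦ Nat.zero_le _) (Finset.mem_univ a))
  have h₀ : ∀ a b, ∃ L₀ : ℕ, ∀ L ≥ L₀, res (V := U a ⊓ U b) inf_le_left (τ a) ^ L *
      (res (V := U a ⊓ U b) inf_le_left (w a) - g a b * h a b ^ M * res inf_le_right (w b)) =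
        0 := by
    intro a b
    have hD' : Y.basicOpen (res (V := U a ⊓ U b) inf_le_left (τ a)) = U a ⊓ U b ⊓ D := by
      rw [basicOpen_res' _ (hD a), ← inf_assoc, inf_eq_left.2 inf_le_left]
    refine exists_pow_mul_eq_zero (hUU a b) hD' inf_le_left ?_
    have h₁ := congrArg (res (V := U a ⊓ U b ⊓ D) (inf_le_inf_right D inf_le_left)) (hw a)
    have h₂ := congrArg (res (V := U a ⊓ U b ⊓ D) (inf_le_inf_right D inf_le_right)) (hw b)
    have h₃ := congrArg (res (V := U a ⊓ U b ⊓ D) inf_le_left) (hτ a b)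
    simp only [map_mul, map_pow, res_res, map_sub] at h₁ h₂ h₃ ⊢
    rw [h₁, h₂, h₃, hm]
    ring
  choose L₀ hL₀ using h₀
  set L := ∑ a, ∑ b, L₀ a b
  have hL : ∀ a b, L₀ a b ≤ L := fun a b ↦ (Finset.single_le_sum (f := L₀ a)
    (fun _ _ ↦ Nat.zero_le _) (Finset.mem_univ b)).trans
      (Finset.single_le_sum (f := fun a ↦ ∑ b, L₀ a b) (fun _ _ ↦ Nat.zero_le _)
        (Finset.mem_univ a))
  refine ⟨M + L, fun N hN ↦ ⟨fun a ↦ τ a ^ (N - M) * w a, fun a ↦ ?_, fun a b ↦ ?_⟩⟩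
  · rw [map_mul, map_pow, hw, ← mul_assoc, ← pow_add, Nat.sub_add_cancel (by omega)]
  · have h₁ := hL₀ a b (N - M) ((hL a b).trans (by omega))
    rw [mul_sub, sub_eq_zero] at h₁
    rw [map_mul, map_pow, h₁, hτ, map_mul, map_pow, mul_pow]
    rw [show h a b ^ N = h a b ^ (N - M) * h a b ^ M by
      rw [← pow_add, Nat.sub_add_cancel (by omega)]]
    ring

end Extension

/-! ### Morphisms to projective space -/

section Morphism

variable {F : Type u} [Field F] {n : ℕ}

lemma isAffineOpen_chart (k : Fin (n + 1)) : IsAffineOpen (chart F k) :=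
  Proj.isAffineOpen_basicOpen _ _ (X_mem F k) one_pos

lemma basicOpen_ratio (l k : Fin (n + 1)) :
    (PSpace F n).basicOpen (ratio F l k) = chart F l ⊓ chart F k := by
  apply le_antisymm
  · refine le_inf (Scheme.basicOpen_le _ _) fun p hp ↦ ?_
    have hpl : p ∈ chart F l := Scheme.basicOpen_le _ _ hp
    obtain ⟨t, ht⟩ := (RingedSpace.isUnit_res_basicOpen _ (ratio F l k)).exists_right_inv
    have h₁ := congrArg (fun z : Γ(PSpace F n, (PSpace F n).basicOpen (ratio F l k)) ↦
      HomogeneousLocalization.val (z.1 ⟨p, hp⟩)) ht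
    have h₂ : IsUnit (HomogeneousLocalization.val ((ratio F l k).1 ⟨p, hpl⟩)) := by
      refine IsUnit.of_mul_eq_one (HomogeneousLocalization.val (t.1 ⟨p, hp⟩)) ?_
      refine (HomogeneousLocalization.val_mul _ _).symm.trans (h₁.trans ?_)
      exact HomogeneousLocalization.val_one
    have h₃ := (congrArg IsUnit (ratio_val F l k ⟨p, hpl⟩)).mp h₂
    rw [Localization.mk_eq_mk'] at h₃
    have := p.isPrime
    exact (IsLocalization.AtPrime.isUnit_mk'_iff _ p.asHomogeneousIdeal.toIdeal _ _).1 h₃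
  · intro p hp
    rw [Scheme.mem_basicOpen _ _ _ hp.1]
    have h := ((ratioUnit F l k).isUnit).map
      ((PSpace F n).presheaf.germ (chart F l ⊓ chart F k) p hp).hom
    have e : (PSpace F n).presheaf.germ (chart F l ⊓ chart F k) p hp
      (res inf_le_left (ratio F l k)) = (PSpace F n).presheaf.germ (chart F l) p hp.1
        (ratio F l k) := TopCat.Presheaf.germ_res_apply _ _ _ _ _
    rw [← e]
    exact h

variable {Y : Scheme.{u}} (g : Y ⟶ PSpace F n)

lemma isAffineOpen_preimage_chart_inf {U : Y.Opens} (hU : IsAffineOpen U) (k : Fin (n + 1)) :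
    IsAffineOpen (g ⁻¹ᵁ chart F k ⊓ U) := by
  have : IsAffine U := hU
  have : IsAffineHom (U.ι ≫ g ≫ Limits.terminal.from _) := isAffineHom_of_isAffine _
  have : IsAffineHom (U.ι ≫ g) := by
    rw [← Category.assoc] at this
    exact IsAffineHom.of_comp _ (Limits.terminal.from _)
  have h := ((isAffineOpen_chart (F := F) k).preimage (U.ι ≫ g)).image_of_isOpenImmersion U.ι
  convert h using 1
  rw [Scheme.Hom.comp_preimage, Scheme.Hom.image_preimage_eq_opensRange_inf,
    Scheme.Opens.opensRange_ι, inf_comm]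

variable {g}

/-- The function `x_l / x_k` on an open set which maps to `D_+(x_k) ∩ D_+(x_l)`. -/
def ratU {W : Y.Opens} {k l : Fin (n + 1)} (hk : W ≤ g ⁻¹ᵁ chart F k) (hl : W ≤ g ⁻¹ᵁ chart F l) :
    Γ(Y, W)ˣ where
  val := pull g hk (ratio F k l)
  inv := pull g hl (ratio F l k)
  val_inv := by
    have h := congrArg (pull g (le_inf hk hl : W ≤ g ⁻¹ᵁ (chart F k ⊓ chart F l)))
      (ratioUnit F k l).val_inv
    rw [map_mul, map_one] at h
    rw [← h]
    exact congrArg₂ _ (pull_res g _ _ _).symm (pull_res g _ _ _).symm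
  inv_val := by
    have h := congrArg (pull g (le_inf hk hl : W ≤ g ⁻¹ᵁ (chart F k ⊓ chart F l)))
      (ratioUnit F k l).inv_val
    rw [map_mul, map_one] at h
    rw [← h]
    exact congrArg₂ _ (pull_res g _ _ _).symm (pull_res g _ _ _).symm

lemma val_ratU {W : Y.Opens} {k l : Fin (n + 1)} (hk : W ≤ g ⁻¹ᵁ chart F k)
    (hl : W ≤ g ⁻¹ᵁ chart F l) : (ratU hk hl : Γ(Y, W)) = pull g hk (ratio F k l) := rfl

lemma ratU_self {W : Y.Opens} {k : Fin (n + 1)} (hk : W ≤ g ⁻¹ᵁ chart F k) :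
    ratU hk hk = 1 := Units.ext (by rw [val_ratU, ratio_self, map_one, Units.val_one])

lemma ratU_mul {W : Y.Opens} {k l m : Fin (n + 1)} (hk : W ≤ g ⁻¹ᵁ chart F k)
    (hl : W ≤ g ⁻¹ᵁ chart F l) (hm : W ≤ g ⁻¹ᵁ chart F m) :
    ratU hk hl * ratU hl hm = ratU hk hm := Units.ext (by
  have hW : W ≤ g ⁻¹ᵁ (chart F k ⊓ chart F l) := fun _ hx ↦ ⟨hk hx, hl hx⟩
  have h := congrArg (pull g hW)
    (ratio_cocycle F k l m (V := chart F k ⊓ chart F l) inf_le_left inf_le_right)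
  rw [map_mul, pull_res, pull_res, pull_res] at h
  exact h)

lemma res_ratU_zpow {W W' : Y.Opens} {k l : Fin (n + 1)} (hk : W ≤ g ⁻¹ᵁ chart F k)
    (hl : W ≤ g ⁻¹ᵁ chart F l) (h : W' ≤ W) (d : ℤ) :
    res h ((ratU hk hl ^ d : Γ(Y, W)ˣ) : Γ(Y, W)) =
      ((ratU (h.trans hk) (h.trans hl) ^ d : Γ(Y, W')ˣ) : Γ(Y, W')) := by
  have e : Units.map (res h).toMonoidHom (ratU hk hl) = ratU (h.trans hk) (h.trans hl) :=
    Units.ext (res_pull g hk h _)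
  rw [← e, ← map_zpow]
  rfl

lemma pull_ratU_zpow {Z : Scheme.{u}} (f : Z ⟶ Y) {W : Y.Opens} {W' : Z.Opens} {k l : Fin (n + 1)}
    (hk : W ≤ g ⁻¹ᵁ chart F k) (hl : W ≤ g ⁻¹ᵁ chart F l) (h : W' ≤ f ⁻¹ᵁ W)
    (hk' : W' ≤ (f ≫ g) ⁻¹ᵁ chart F k) (hl' : W' ≤ (f ≫ g) ⁻¹ᵁ chart F l) (d : ℤ) :
    pull f h ((ratU hk hl ^ d : Γ(Y, W)ˣ) : Γ(Y, W)) =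
      ((ratU hk' hl' ^ d : Γ(Z, W')ˣ) : Γ(Z, W')) := by
  have e : Units.map (pull f h).toMonoidHom (ratU hk hl) = ratU hk' hl' :=
    Units.ext (by
      change pull f h (pull g hk _) = pull (f ≫ g) hk' _
      rw [← CommRingCat.comp_apply, Scheme.Hom.appLE_comp_appLE])
  rw [← e, ← map_zpow]
  rfl

lemma pull_twist {W : Y.Opens} {k l : Fin (n + 1)}
    (h : W ≤ g ⁻¹ᵁ (chart F k ⊓ chart F l)) (d : ℤ) :
    pull g h ((twist F n d).g k l) =
      ((ratU (h.trans fun _ hx ↦ hx.1) (h.trans fun _ hx ↦ hx.2) ^ d : Γ(Y, W)ˣ) : Γ(Y, W)) := by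
  have e : Units.map (pull g h).toMonoidHom (ratioUnit F k l) =
      ratU (h.trans fun _ hx ↦ hx.1) (h.trans fun _ hx ↦ hx.2) := Units.ext (pull_res g _ h _)
  rw [← e, ← map_zpow]
  rfl

lemma basicOpen_pull_ratio {W : Y.Opens} {k l : Fin (n + 1)} (hl : W ≤ g ⁻¹ᵁ chart F l) :
    Y.basicOpen (pull g hl (ratio F l k)) = W ⊓ g ⁻¹ᵁ chart F k := by
  have h : pull g hl (ratio F l k) = res hl (pull g le_rfl (ratio F l k)) := by rw [res_pull]
  have h' : Y.basicOpen (pull g (V := g ⁻¹ᵁ chart F l) le_rfl (ratio F l k)) =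
      g ⁻¹ᵁ (chart F l ⊓ chart F k) := by
    rw [← basicOpen_ratio, pull, ← Scheme.Hom.app_eq_appLE, Scheme.preimage_basicOpen]
  rw [h, basicOpen_res' hl h']
  ext x
  exact ⟨fun hx ↦ ⟨hx.1, hx.2.2⟩, fun hx ↦ ⟨hx.1, hl hx.1, hx.2⟩⟩

lemma iSup_preimage_chart (g : Y ⟶ PSpace F n) : ⨆ k, g ⁻¹ᵁ chart F k = ⊤ := by
  rw [← Scheme.Hom.preimage_iSup, iSup_chart]
  rfl

end Morphism

/-! ### Sections of `O(d)` on an affine scheme with a morphism to projective space -/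

section Gluing

variable {Y : Scheme.{u}}

lemma exists_gluing {ι : Type*} {U : ι → Y.Opens} {V : Y.Opens} (hUV : ∀ a, U a ≤ V)
    (hV : V ≤ ⨆ a, U a) (s : ∀ a, Γ(Y, U a))
    (hs : ∀ a b, res (V := U a ⊓ U b) inf_le_left (s a) = res inf_le_right (s b)) :
    ∃ c : Γ(Y, V), ∀ a, res (hUV a) c = s a := by
  obtain ⟨c, hc, -⟩ := Y.sheaf.existsUnique_gluing' U V (fun a ↦ homOfLE (hUV a)) hV s hs
  exact ⟨c, hc⟩

end Gluing

section TwistSec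

variable {F : Type u} [Field F] {n : ℕ} {Y : Scheme.{u}} (g : Y ⟶ PSpace F n) (U : Y.Opens)

/-- The part of `U` which maps to `D_+(x_k)`. -/
abbrev patch (k : Fin (n + 1)) : Y.Opens := g ⁻¹ᵁ chart F k ⊓ U

lemma iSup_patch : ⨆ k, patch g U k = U := by
  rw [← iSup_inf_eq, iSup_preimage_chart, top_inf_eq]

variable {g U}

/-- The function `x_l / x_k`. -/
abbrev rat {W : Y.Opens} {k : Fin (n + 1)} (hk : W ≤ g ⁻¹ᵁ chart F k) (l : Fin (n + 1)) : Γ(Y, W) :=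
  pull g hk (ratio F k l)

lemma basicOpen_rat {k : Fin (n + 1)} (l : Fin (n + 1)) :
    Y.basicOpen (rat (W := patch g U k) (g := g) inf_le_left l) =
      patch g U k ⊓ g ⁻¹ᵁ chart F l := basicOpen_pull_ratio _

lemma isAffineOpen_patch_inf (hU : IsAffineOpen U) (k l : Fin (n + 1)) :
    IsAffineOpen (patch g U k ⊓ patch g U l) := by
  have h : patch g U k ⊓ patch g U l = patch g U k ⊓ g ⁻¹ᵁ chart F l := by
    ext x
    exact ⟨fun h ↦ ⟨h.1, h.2.1⟩, fun h ↦ ⟨h.1, h.2, h.1.2⟩⟩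
  rw [h, ← basicOpen_rat]
  exact (isAffineOpen_preimage_chart_inf g hU k).basicOpen _

/-- The sections of the pull-back of `O(d)` to `U`. -/
def IsTwistSec (d : ℤ) (s : ∀ k, Γ(Y, patch g U k)) : Prop :=
  ∀ k l, res (V := patch g U k ⊓ patch g U l) inf_le_left (s k) =
    ((ratU (g := g) (inf_le_left.trans inf_le_left) (inf_le_right.trans inf_le_left) ^ d :
      Γ(Y, patch g U k ⊓ patch g U l)ˣ) : Γ(Y, patch g U k ⊓ patch g U l)) * res inf_le_right (s l)

namespace IsTwistSec

variable {d e : ℤ} {s t : ∀ k, Γ(Y, patch g U k)}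

lemma res_eq (hs : IsTwistSec d s) {k l : Fin (n + 1)} {W : Y.Opens} (hk : W ≤ patch g U k)
    (hl : W ≤ patch g U l) : res hk (s k) =
      ((ratU (g := g) (hk.trans inf_le_left) (hl.trans inf_le_left) ^ d : Γ(Y, W)ˣ) : Γ(Y, W)) *
        res hl (s l) := by
  have h := congrArg (res (le_inf hk hl)) (hs k l)
  rw [map_mul, res_res, res_res, res_ratU_zpow] at h
  exact h

lemma add (hs : IsTwistSec d s) (ht : IsTwistSec d t) : IsTwistSec d (s + t) := fun k l ↦ by
  rw [Pi.add_apply, Pi.add_apply, map_add, map_add, hs, ht, mul_add]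

lemma sub (hs : IsTwistSec d s) (ht : IsTwistSec d t) : IsTwistSec d (s - t) := fun k l ↦ by
  rw [Pi.sub_apply, Pi.sub_apply, map_sub, map_sub, hs, ht, mul_sub]

lemma zero : IsTwistSec (g := g) (U := U) d 0 := fun k l ↦ by
  rw [Pi.zero_apply, Pi.zero_apply, map_zero, map_zero, mul_zero]

lemma mul (hs : IsTwistSec d s) (ht : IsTwistSec e t) : IsTwistSec (d + e) (s * t) := fun k l ↦ by
  rw [Pi.mul_apply, Pi.mul_apply, map_mul, map_mul, hs, ht, zpow_add, Units.val_mul]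
  ring

lemma const (a : Γ(Y, U)) : IsTwistSec (g := g) 0 fun k ↦ res (V := patch g U k) inf_le_right a :=
  fun k l ↦ by rw [zpow_zero, Units.val_one, one_mul, res_res, res_res]

lemma const_mul (hs : IsTwistSec d s) (a : Γ(Y, U)) :
    IsTwistSec d fun k ↦ res (V := patch g U k) inf_le_right a * s k := by
  have := (const a).mul hs
  rwa [zero_add] at this

/-- The variable `x_m`, as a section of `O(1)`. -/
lemma var (m : Fin (n + 1)) :
    IsTwistSec (g := g) (U := U) 1 fun k ↦ rat (W := patch g U k) inf_le_left m := fun k l ↦ by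
  rw [zpow_one, val_ratU, res_pull, res_pull]
  have hW : patch g U k ⊓ patch g U l ≤ g ⁻¹ᵁ (chart F k ⊓ chart F l) :=
    fun _ hx ↦ ⟨hx.1.1, hx.2.1⟩
  have h := congrArg (pull g hW)
    (ratio_cocycle F k l m (V := chart F k ⊓ chart F l) inf_le_left inf_le_right)
  rw [map_mul, pull_res, pull_res, pull_res] at h
  exact h.symm

lemma pow (hs : IsTwistSec d s) (N : ℕ) : IsTwistSec (d * N) (s ^ N) := fun k l ↦ by
  rw [Pi.pow_apply, Pi.pow_apply, map_pow, map_pow, hs, mul_pow, zpow_mul, zpow_natCast,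
    Units.val_pow_eq_pow_val]

lemma var_pow (m : Fin (n + 1)) (N : ℕ) :
    IsTwistSec (g := g) (U := U) N fun k ↦ rat (W := patch g U k) inf_le_left m ^ N := by
  have := (var (g := g) (U := U) m).pow N
  rwa [one_mul] at this

lemma exists_const (hs : IsTwistSec 0 s) : ∃ a : Γ(Y, U), ∀ k, res inf_le_right a = s k :=
  exists_gluing (fun _ ↦ inf_le_right) (iSup_patch g U).ge s fun k l ↦ by
    rw [hs, zpow_zero, Units.val_one, one_mul]

end IsTwistSec

/-- On an affine open set, `O(N)` is generated by the sections `x_k ^ N`. -/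
lemma exists_partition (hU : IsAffineOpen U) (N : ℕ) :
    ∃ v : Fin (n + 1) → ∀ l, Γ(Y, patch g U l), (∀ k, IsTwistSec (-N) (v k)) ∧
      ∀ l, ∑ k, rat (W := patch g U l) inf_le_left k ^ N * v k l = 1 := by
  let T : Ideal Γ(Y, U) :=
    { carrier := {a | ∃ v : Fin (n + 1) → ∀ l, Γ(Y, patch g U l), (∀ k, IsTwistSec (-N) (v k)) ∧
        ∀ l, ∑ k, rat (W := patch g U l) inf_le_left k ^ N * v k l = res inf_le_right a}
      zero_mem' := ⟨0, fun _ ↦ IsTwistSec.zero, fun l ↦ by simp⟩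
      add_mem' := by
        rintro a b ⟨v, hv, hva⟩ ⟨w, hw, hwb⟩
        refine ⟨v + w, fun k ↦ (hv k).add (hw k), fun l ↦ ?_⟩
        rw [map_add, ← hva, ← hwb, ← Finset.sum_add_distrib]
        exact Finset.sum_congr rfl fun k _ ↦ mul_add _ _ _
      smul_mem' := by
        rintro c a ⟨v, hv, hva⟩
        refine ⟨fun k l ↦ res inf_le_right c * v k l, fun k ↦ (hv k).const_mul c, fun l ↦ ?_⟩
        rw [smul_eq_mul, map_mul, ← hva, Finset.mul_sum]
        exact Finset.sum_congr rfl fun k _ ↦ mul_left_comm _ _ _ }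
  suffices h : T = ⊤ by
    obtain ⟨v, hv, h1⟩ := (Ideal.eq_top_iff_one T).1 h
    exact ⟨v, hv, fun l ↦ (h1 l).trans (map_one _)⟩
  have hcov : ⨆ a : T, Y.basicOpen (a : Γ(Y, U)) = U := by
    refine le_antisymm (iSup_le fun a ↦ Scheme.basicOpen_le _ _) fun y hy ↦ ?_
    obtain ⟨k, hk⟩ := Opens.mem_iSup.1 ((iSup_patch g U).ge hy)
    obtain ⟨a, ha, hya⟩ := hU.exists_basicOpen_le ⟨y, hk⟩ hy
    have hD : ∀ l, Y.basicOpen (res (V := patch g U l) inf_le_right a) =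
        patch g U l ⊓ Y.basicOpen a := fun l ↦ basicOpen_res' _ rfl
    have hD₁ : ∀ l, patch g U l ⊓ Y.basicOpen a ≤ g ⁻¹ᵁ chart F l := fun l ↦
      inf_le_left.trans inf_le_left
    have hD₂ : ∀ l, patch g U l ⊓ Y.basicOpen a ≤ g ⁻¹ᵁ chart F k := fun l ↦
      inf_le_right.trans (ha.trans inf_le_left)
    obtain ⟨M, hM⟩ := exists_extension (fun l ↦ isAffineOpen_preimage_chart_inf g hU l)
      (fun l m ↦ isAffineOpen_patch_inf hU l m)
      (fun l m ↦ ((ratU (g := g) (inf_le_left.trans inf_le_left) (inf_le_right.trans inf_le_left) ^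
        (-N : ℤ) : Γ(Y, patch g U l ⊓ patch g U m)ˣ) : Γ(Y, patch g U l ⊓ patch g U m)))
      (fun _ _ ↦ 1) (fun l ↦ res inf_le_right a) (fun l m ↦ by rw [one_mul, res_res, res_res]) hD
      (fun l ↦ ((ratU (hD₁ l) (hD₂ l) ^ (-N : ℤ) : Γ(Y, patch g U l ⊓ Y.basicOpen a)ˣ) :
        Γ(Y, patch g U l ⊓ Y.basicOpen a)))
      (fun l m ↦ by
        rw [res_ratU_zpow, res_ratU_zpow, res_ratU_zpow, ← Units.val_mul, ← mul_zpow, ratU_mul])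
    obtain ⟨w, hw, hwM⟩ := hM M le_rfl
    have hw' : IsTwistSec (-N) w := fun l m ↦ by rw [hwM, one_pow, mul_one]
    have h₀ : ∀ l, ∃ L₀ : ℕ, ∀ L ≥ L₀, res (V := patch g U l) inf_le_right a ^ L *
        (rat (W := patch g U l) inf_le_left k ^ N * w l - res inf_le_right a ^ M) = 0 := by
      refine fun l ↦ exists_pow_mul_eq_zero (isAffineOpen_preimage_chart_inf g hU l) (hD l)
        inf_le_left ?_
      rw [map_sub, map_mul, hw, map_pow, map_pow, res_res, res_pull, ← val_ratU (hD₁ l) (hD₂ l),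
        mul_left_comm, zpow_neg, zpow_natCast, ← Units.val_pow_eq_pow_val, Units.mul_inv, mul_one,
        sub_self]
    choose L₀ hL₀ using h₀
    set L := ∑ l, L₀ l
    refine Opens.mem_iSup.2 ⟨⟨a ^ (L + M + 1), Pi.single k fun l ↦ res inf_le_right (a ^ (L + 1)) *
      w l, fun m ↦ ?_, fun l ↦ ?_⟩, ?_⟩
    · rcases eq_or_ne m k with rfl | hm
      · rw [Pi.single_eq_same]
        exact hw'.const_mul _
      · rw [Pi.single_eq_of_ne hm]
        exact IsTwistSec.zero
    · rw [Finset.sum_eq_single k (fun m _ hm ↦ by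
        rw [Pi.single_eq_of_ne hm, Pi.zero_apply, mul_zero]) (by simp), Pi.single_eq_same]
      have h₁ := hL₀ l (L + 1) ((Finset.single_le_sum (f := L₀)
        (fun _ _ ↦ Nat.zero_le _) (Finset.mem_univ l)).trans (Nat.le_succ _))
      rw [mul_sub, sub_eq_zero] at h₁
      rw [map_pow, map_pow, show L + M + 1 = L + 1 + M by ring, pow_add _ (L + 1) M, ← h₁]
      ring
    · rwa [Scheme.basicOpen_pow _ _ (Nat.succ_pos _)]
  have h := (hU.iSup_basicOpen_eq_self_iff (s := (T : Set Γ(Y, U)))).1 hcov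
  rwa [Ideal.span_eq] at h

/-- Functions on the part of an affine `U` over `D_+(x_j)` are generated by the functions on `U` and
by the functions `x_l / x_j`. -/
lemma exists_eq_sum_rat (hU : IsAffineOpen U) (j : Fin (n + 1)) (f : Γ(Y, patch g U j)) :
    ∃ (N : ℕ) (c : Fin (n + 1) → Γ(Y, U)),
      f = ∑ l, res inf_le_right (c l) * rat (W := patch g U j) inf_le_left l ^ N := by
  have hj : ∀ l, patch g U l ⊓ g ⁻¹ᵁ chart F j ≤ patch g U j := fun l x hx ↦ ⟨hx.2, hx.1.2⟩
  obtain ⟨N, hN⟩ := exists_extension (fun l ↦ isAffineOpen_preimage_chart_inf g hU l)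
    (fun l m ↦ isAffineOpen_patch_inf hU l m) (fun _ _ ↦ 1)
    (fun l m ↦ ((ratU (g := g) (inf_le_left.trans inf_le_left) (inf_le_right.trans inf_le_left) ^
      (1 : ℤ) : Γ(Y, patch g U l ⊓ patch g U m)ˣ) : Γ(Y, patch g U l ⊓ patch g U m)))
    (fun l ↦ rat (W := patch g U l) inf_le_left j) (IsTwistSec.var j)
    (fun l ↦ basicOpen_rat j) (fun l ↦ res (hj l) f)
    (fun l m ↦ by rw [map_one, one_mul, res_res, res_res])
  obtain ⟨w, hw, hwN⟩ := hN N le_rfl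
  have hw' : IsTwistSec N w := fun l m ↦ by
    rw [hwN, one_mul, zpow_one, zpow_natCast, Units.val_pow_eq_pow_val]
  obtain ⟨v, hv, hv1⟩ := exists_partition (g := g) hU N
  choose c hc using fun l ↦ IsTwistSec.exists_const (s := v l * w) (by
    have := (hv l).mul hw'
    rwa [neg_add_cancel] at this)
  refine ⟨N, c, ?_⟩
  have hjw : w j = f := by
    have h : patch g U j ≤ patch g U j ⊓ g ⁻¹ᵁ chart F j := le_inf le_rfl inf_le_left
    have h₁ := congrArg (res h) (hw j)
    have h₂ : rat (g := g) (W := patch g U j) inf_le_left j = 1 := by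
      rw [rat, ratio_self, map_one]
    rw [map_mul, res_res, res_res, res_self, res_self, map_pow, res_res, h₂, map_one, one_pow,
      one_mul] at h₁
    exact h₁
  rw [← hjw, ← one_mul (w j), ← hv1 j, Finset.sum_mul]
  refine Finset.sum_congr rfl fun l _ ↦ ?_
  rw [hc, Pi.mul_apply]
  ring

end TwistSec

/-! ### The ring of twisted sections on an affine scheme in projective space -/

section Homogenization

open MvPolynomial

variable {B : Type*} [CommRing B] {n : ℕ}

/-- The homogenisation of a polynomial with respect to the variable `x_k`. -/
lemma exists_homogenization (q : MvPolynomial (Fin (n + 1)) B) (k : Fin (n + 1)) {z : ℤ}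
    (hz : (q.totalDegree : ℤ) ≤ z) : ∃ p, HomZ p z ∧
      (∀ I : Ideal B, (∀ m, coeff m q ∈ I) → ∀ m, coeff m p ∈ I) ∧
      ∀ {A : Type u} [CommRing A] (φ : B →+* A) (x : Fin (n + 1) → A), x k = 1 →
        eval₂ φ x p = eval₂ φ x q := by
  lift z to ℕ using (Nat.cast_nonneg _).trans hz
  have hz' : q.totalDegree ≤ z := by exact_mod_cast hz
  refine ⟨∑ m ∈ q.support, monomial m (coeff m q) * X k ^ (z - m.degree),
    HomZ.sum fun m hm ↦ ?_, fun I hI m ↦ ?_, fun φ x hx ↦ ?_⟩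
  · have h : m.degree ≤ z := (le_totalDegree hm).trans hz'
    have := (homZ_monomial m (coeff m q)).mul (homZ_X_pow (B := B) k (z - m.degree))
    rwa [← Nat.cast_add, Nat.add_sub_cancel' h] at this
  · rw [coeff_sum]
    refine I.sum_mem fun e _ ↦ ?_
    rw [show (monomial e (coeff e q) : MvPolynomial (Fin (n + 1)) B) = C (coeff e q) * monomial e 1
      by rw [C_mul_monomial, mul_one], mul_assoc, coeff_C_mul]
    exact I.mul_mem_right _ (hI e)
  · conv_rhs => rw [q.as_sum]
    rw [eval₂_sum, eval₂_sum]
    refine Finset.sum_congr rfl fun m _ ↦ ?_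
    rw [eval₂_mul, eval₂_pow, eval₂_X, hx, one_pow, mul_one]

lemma HomZ.eval₂_mul_units {A : Type*} [CommRing A] {p : MvPolynomial (Fin (n + 1)) B} {d : ℤ}
    (hp : HomZ p d) (φ : B →+* A) (v : Aˣ) (x : Fin (n + 1) → A) :
    eval₂ φ (fun m ↦ v * x m) p = ((v ^ d : Aˣ) : A) * eval₂ φ x p := by
  rw [eval₂_eq, eval₂_eq, Finset.mul_sum]
  refine Finset.sum_congr rfl fun m hm ↦ ?_
  have h := hp m (mem_support_iff.1 hm)
  rw [← h, zpow_natCast, Units.val_pow_eq_pow_val]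
  simp only [mul_pow, Finset.prod_mul_distrib]
  rw [Finset.prod_pow_eq_pow_sum, Finsupp.degree_apply]
  ring

end Homogenization

section GeomSystem

open MvPolynomial

variable {F : Type u} [Field F] {n : ℕ} {Y : Scheme.{u}} {g : Y ⟶ PSpace F n} {U : Y.Opens}
  {B : Type u} [CommRing B] {b : B →+* Γ(Y, U)}

/-- The coefficients in `B`, as functions on a part of `U`. -/
def coeffMap (b : B →+* Γ(Y, U)) {W : Y.Opens} (hW : W ≤ U) : B →+* Γ(Y, W) := (res hW).comp b

/-- The value of a polynomial at the functions `x_l / x_k`. -/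
def evAt (g : Y ⟶ PSpace F n) (b : B →+* Γ(Y, U)) (k : Fin (n + 1)) :
    MvPolynomial (Fin (n + 1)) B →+* Γ(Y, patch g U k) :=
  eval₂Hom (coeffMap b inf_le_right) (rat inf_le_left)

lemma evAt_apply (k : Fin (n + 1)) (p : MvPolynomial (Fin (n + 1)) B) :
    evAt g b k p = eval₂ (coeffMap b inf_le_right) (rat inf_le_left) p := rfl

lemma evAt_X (k l : Fin (n + 1)) : evAt g b k (X l) = rat inf_le_left l := eval₂_X _ _ _

lemma evAt_C (k : Fin (n + 1)) (c : B) : evAt g b k (C c) = res inf_le_right (b c) := eval₂_C _ _ _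

lemma rat_self {W : Y.Opens} {k : Fin (n + 1)} (hk : W ≤ g ⁻¹ᵁ chart F k) : rat hk k = 1 := by
  rw [rat, ratio_self, map_one]

lemma isTwistSec_evAt {d : ℤ} {p : MvPolynomial (Fin (n + 1)) B} (hp : HomZ p d) :
    IsTwistSec d fun k ↦ evAt g b k p := by
  intro k l
  have h : ∀ m, res (V := patch g U k ⊓ patch g U l) inf_le_left (rat inf_le_left m) =
      ((ratU (g := g) (inf_le_left.trans inf_le_left) (inf_le_right.trans inf_le_left) :
        Γ(Y, patch g U k ⊓ patch g U l)ˣ) : Γ(Y, patch g U k ⊓ patch g U l)) *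
          res inf_le_right (rat inf_le_left m) := fun m ↦ by
    have := IsTwistSec.var (g := g) (U := U) m k l
    rwa [zpow_one] at this
  have h' : ∀ {W : Y.Opens} (m : Fin (n + 1)) (hW : W ≤ patch g U m),
      res hW (evAt g b m p) = eval₂ (coeffMap b (hW.trans inf_le_right))
        (fun i ↦ res hW (rat inf_le_left i)) p := fun m hW ↦ by
    rw [evAt_apply, eval₂_comp_left (res hW)]
    have : (res hW).comp (coeffMap b inf_le_right) = coeffMap b (hW.trans inf_le_right) :=
      RingHom.ext fun x ↦ res_res _ _ _
    rw [this]
    rfl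
  rw [h', h']
  simp only [h]
  exact hp.eval₂_mul_units _ _ _

/-- A section of `O(d)` which is given by a polynomial `q` over `D_+(x_k)` is given by a homogeneous
polynomial after multiplication by a power of `x_k`. -/
lemma IsTwistSec.exists_evAt (hU : IsAffineOpen U) {d : ℤ} {f : ∀ k, Γ(Y, patch g U k)}
    (hf : IsTwistSec d f) {k : Fin (n + 1)} {q : MvPolynomial (Fin (n + 1)) B}
    (hq : evAt g b k q = f k) : ∃ N₀ : ℕ, ∀ N ≥ N₀, ∃ p, HomZ p (d + N) ∧
      (∀ I : Ideal B, (∀ m, coeff m q ∈ I) → ∀ m, coeff m p ∈ I) ∧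
      ∀ l, evAt g b l p = rat inf_le_left k ^ N * f l := by
  obtain ⟨M, hM⟩ : ∃ M : ℕ, (q.totalDegree : ℤ) ≤ d + M :=
    ⟨(q.totalDegree + d.natAbs), by push_cast; linarith [neg_abs_le d]⟩
  obtain ⟨p, hp, hpI, hpq⟩ := exists_homogenization.{u} q k hM
  have hδ : IsTwistSec (d + M) fun l ↦ evAt g b l p - rat inf_le_left k ^ M * f l := by
    refine (isTwistSec_evAt hp).sub ?_
    rw [add_comm d]
    exact (var_pow k M).mul hf
  have hδk : evAt g b k p - rat inf_le_left k ^ M * f k = 0 := by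
    rw [rat_self, one_pow, one_mul, ← hq, evAt_apply, evAt_apply, hpq _ _ (rat_self _), sub_self]
  have h₀ : ∀ l, ∃ L₀ : ℕ, ∀ L ≥ L₀, rat (W := patch g U l) (g := g) inf_le_left k ^ L *
      (evAt g b l p - rat inf_le_left k ^ M * f l) = 0 := fun l ↦ by
    refine exists_pow_mul_eq_zero (isAffineOpen_preimage_chart_inf g hU l) (basicOpen_rat k)
      inf_le_left ?_
    have h := hδ.res_eq (l := k) (W := patch g U l ⊓ g ⁻¹ᵁ chart F k) inf_le_left
      (fun x hx ↦ ⟨hx.2, hx.1.2⟩)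
    rw [hδk, map_zero, mul_zero] at h
    exact h
  choose L₀ hL₀ using h₀
  refine ⟨M + ∑ l, L₀ l, fun N hN ↦ ⟨X k ^ (N - M) * p, ?_, fun I hI m ↦ ?_, fun l ↦ ?_⟩⟩
  · convert (homZ_X_pow k (N - M)).mul hp using 1
    push_cast [show M ≤ N by omega]
    ring
  · classical
    rw [coeff_mul]
    exact I.sum_mem fun x _ ↦ I.mul_mem_left _ (hpI I hI _)
  · have h := hL₀ l (N - M) ((Finset.single_le_sum (f := L₀)
      (fun _ _ ↦ Nat.zero_le _) (Finset.mem_univ l)).trans (by omega))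
    rw [mul_sub, sub_eq_zero] at h
    rw [map_mul, map_pow, evAt_X, h, ← mul_assoc, ← pow_add, Nat.sub_add_cancel (by omega)]

/-- Families of functions on the sets `U ∩ D_+(x_k)`, as an algebra over `B`. -/
def Fam (g : Y ⟶ PSpace F n) {U : Y.Opens} {B : Type u} [CommRing B] (_ : B →+* Γ(Y, U)) : Type u :=
  ∀ k, Γ(Y, patch g U k)

instance : CommRing (Fam g b) := inferInstanceAs (CommRing (∀ k, Γ(Y, patch g U k)))

instance : Algebra B (Fam g b) :=
  (RingHom.pi fun k ↦ coeffMap b (inf_le_right : patch g U k ≤ U)).toAlgebra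

/-- The section system of an affine open set `U` over `B` with an immersion into `P^n_B`, that is,
for which functions on `U ∩ D_+(x_k)` are polynomials over `B` in the functions `x_l / x_k`. -/
def geomSystem (g : Y ⟶ PSpace F n) (b : B →+* Γ(Y, U)) (hU : IsAffineOpen U)
    (hb : ∀ k, Function.Surjective (evAt g b k)) : SectionSystem B (Fam g b) n where
  ev :=
    { RingHom.pi fun k ↦ evAt g b k with
      commutes' := fun c ↦ funext fun k ↦ evAt_C k c }
  sec d :=
    { carrier := {f | IsTwistSec d f}
      zero_mem' := IsTwistSec.zero
      add_mem' := IsTwistSec.add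
      smul_mem' := fun c _ hf ↦ IsTwistSec.const_mul hf (b c) }
  mul_mem := IsTwistSec.mul
  ev_mem := isTwistSec_evAt
  exists_ev {d f} hf k := by
    obtain ⟨q, hq⟩ := hb k (f k)
    obtain ⟨N₀, hN₀⟩ := IsTwistSec.exists_evAt hU hf hq
    refine ⟨N₀, fun N hN ↦ ?_⟩
    obtain ⟨p, hp, -, hpf⟩ := hN₀ N hN
    refine ⟨p, hp, funext fun l ↦ (hpf l).trans ?_⟩
    rw [← evAt_X (b := b)]
    rfl
  partition N := by
    obtain ⟨v, hv, hv1⟩ := exists_partition (g := g) hU N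
    refine ⟨v, hv, funext fun l ↦ ?_⟩
    refine (Finset.sum_apply l _ _).trans ((Finset.sum_congr rfl fun k _ ↦ ?_).trans (hv1 l))
    rw [← evAt_X (b := b)]
    rfl

variable {hU : IsAffineOpen U} {hb : ∀ k, Function.Surjective (evAt g b k)}

/-- The functions on a finite `B`-scheme form a finite `B`-module. -/
lemma geomSystem_sec_zero_fg (hfin : b.Finite) : ((geomSystem g b hU hb).sec 0).FG := by
  let := b.toAlgebra
  have : Module.Finite B Γ(Y, U) := hfin
  let ψ : Γ(Y, U) →ₗ[B] Fam g b :=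
    { toFun := fun a k ↦ res inf_le_right a
      map_add' := fun x y ↦ funext fun k ↦ map_add _ x y
      map_smul' := fun c x ↦ funext fun k ↦ map_mul (res inf_le_right) (b c) x }
  have h : (geomSystem g b hU hb).sec 0 = LinearMap.range ψ := by
    apply le_antisymm
    · intro f hf
      obtain ⟨a, ha⟩ := IsTwistSec.exists_const hf
      exact ⟨a, funext ha⟩
    · rintro _ ⟨a, rfl⟩
      exact IsTwistSec.const a
  rw [h, LinearMap.range_eq_map]
  exact Module.Finite.fg_top.map ψ

end GeomSystem

/-! ### Functions and sections on projective space -/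

section ProjectiveSpace

open MvPolynomial LineBundle

variable {F : Type u} [Field F] {n : ℕ}

lemma scalar_eq_of_toSpecΓ {X : Scheme.{u}} (q : X ⟶ Spec (.of F)) {U : X.Opens}
    (ψ : CommRingCat.of F ⟶ Γ(X, U)) (h : U.ι ≫ q = U.toSpecΓ ≫ Spec.map ψ) :
    scalar q U = ψ.hom := by
  have h₁ : q.appTop ≫ U.ι.appTop = (Spec.map ψ).appTop ≫ U.toSpecΓ.appTop := by
    rw [← Scheme.Hom.comp_appTop, h, Scheme.Hom.comp_appTop]
  rw [Scheme.Opens.toSpecΓ_appTop, Scheme.ΓSpecIso_naturality_assoc, ← Iso.inv_comp_eq] at h₁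
  have h₂ : U.ι.appTop ≫ U.topIso.hom = X.presheaf.map (homOfLE le_top).op := by
    rw [Scheme.Opens.topIso_hom, Scheme.Opens.ι_appTop]
    exact (X.presheaf.map_comp _ _).symm
  have h₃ := congrArg (· ≫ U.topIso.hom) h₁
  simp only [Category.assoc, Iso.inv_hom_id, Category.comp_id] at h₃
  rw [h₂] at h₃
  exact congrArg CommRingCat.Hom.hom h₃

lemma specMap_comp_comp {R S T W : CommRingCat.{u}} (a : R ⟶ S) (b : S ⟶ T) (c : T ⟶ W) :
    Spec.map c ≫ Spec.map b ≫ Spec.map a = Spec.map (a ≫ b ≫ c) := by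
  rw [Spec.map_comp, Spec.map_comp, Category.assoc]

/-- The constants of `P^n`, in terms of homogeneous fractions. -/
lemma scalar_chart (k : Fin (n + 1)) (c : F) : scalar (PSpace F n ↘ Spec (.of F)) (chart F k) c =
    (Proj.awayToSection (homogeneousSubmodule (Fin (n + 1)) F) (X k)).hom
      (HomogeneousLocalization.fromZeroRingHom (homogeneousSubmodule (Fin (n + 1)) F)
        (Submonoid.powers (X k)) (algebraMap F (homogeneousSubmodule (Fin (n + 1)) F 0) c)) := by
  have h := scalar_eq_of_toSpecΓ (PSpace F n ↘ Spec (.of F)) (U := chart F k)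
    (CommRingCat.ofHom (algebraMap F (homogeneousSubmodule (Fin (n + 1)) F 0)) ≫
      CommRingCat.ofHom (HomogeneousLocalization.fromZeroRingHom _ (Submonoid.powers (X k))) ≫
      Proj.awayToSection (homogeneousSubmodule (Fin (n + 1)) F) (X k)) (by
    have h₁ := Proj.awayι_toSpecZero (homogeneousSubmodule (Fin (n + 1)) F) (X k) (X_mem F k)
      one_pos
    rw [Proj.awayι, Category.assoc, Iso.inv_comp_eq, Proj.basicOpenIsoSpec_hom,
      Proj.basicOpenToSpec] at h₁
    have h₂ := congrArg (· ≫ Spec.map (CommRingCat.ofHom (algebraMap F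
      (homogeneousSubmodule (Fin (n + 1)) F 0)))) h₁
    simp only [Category.assoc] at h₂
    exact h₂.trans (congrArg ((chart F k).toSpecΓ ≫ ·) (specMap_comp_comp _ _ _)))
  rw [h]
  rfl

/-- The value of a homogeneous polynomial at the functions `x_l / x_k`, as a fraction. -/
lemma eval₂_ratio (k : Fin (n + 1)) {p : MvPolynomial (Fin (n + 1)) F} {N : ℕ}
    (hp : p.IsHomogeneous N) (hp' : p ∈ homogeneousSubmodule (Fin (n + 1)) F (N • 1)) :
    eval₂ (scalar (PSpace F n ↘ Spec (.of F)) (chart F k)) (ratio F k) p =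
      (Proj.awayToSection (homogeneousSubmodule (Fin (n + 1)) F) (X k)).hom
        (HomogeneousLocalization.Away.mk _ (X_mem F k) N p hp') := by
  let 𝒜 := homogeneousSubmodule (Fin (n + 1)) F
  let c : F →+* HomogeneousLocalization.Away 𝒜 (X k) :=
    (HomogeneousLocalization.fromZeroRingHom 𝒜 (Submonoid.powers (X k))).comp
      (algebraMap F (𝒜 0))
  let x : Fin (n + 1) → HomogeneousLocalization.Away 𝒜 (X k) := fun l ↦
    HomogeneousLocalization.Away.mk 𝒜 (X_mem F k) 1 (X l) (X_mem' F l)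
  have h₁ : eval₂ (scalar (PSpace F n ↘ Spec (.of F)) (chart F k)) (ratio F k) p =
      (Proj.awayToSection 𝒜 (X k)).hom (eval₂ c x p) := by
    rw [eval₂_comp_left]
    congr 1
    exact RingHom.ext fun a ↦ scalar_chart k a
  rw [h₁]
  congr 1
  apply HomogeneousLocalization.val_injective
  let L := Localization (Submonoid.powers (X k : MvPolynomial (Fin (n + 1)) F))
  let d : Submonoid.powers (X k : MvPolynomial (Fin (n + 1)) F) := ⟨X k, 1, pow_one _⟩
  let α : MvPolynomial (Fin (n + 1)) F →+* L := algebraMap _ L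
  have h₂ : HomogeneousLocalization.val (eval₂ c x p) =
      eval₂ (α.comp C) (fun l ↦ (Localization.mk (X l) d : L)) p := by
    rw [← HomogeneousLocalization.algebraMap_apply, eval₂_comp_left]
    congr 1
    funext l
    refine (HomogeneousLocalization.Away.val_mk 𝒜 1 (X_mem F k) (X l) (X_mem' F l)).trans ?_
    congr 1
    exact Subtype.ext (pow_one _)
  obtain ⟨v, hv⟩ := IsLocalization.map_units L d
  have h₃ := (homZ_natCast.2 hp).eval₂_mul_units
    (α.comp C) v
    (fun l ↦ (Localization.mk (X l) d : L))
  have h₄ : ∀ l, (v : L) * (Localization.mk (X l) d : L) = α (X l) := fun l ↦ by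
    rw [hv, Localization.mk_eq_mk']
    exact IsLocalization.mk'_spec' L (X l) d
  simp only [h₄] at h₃
  have h₅ : eval₂ (α.comp C) (fun l ↦ α (X l)) p = α p := by
    conv_rhs => rw [← eval₂_eta p]
    rw [eval₂_comp_left]
    rfl
  rw [HomogeneousLocalization.Away.val_mk, h₂, ← v.isUnit.pow N |>.mul_right_inj]
  rw [zpow_natCast, Units.val_pow_eq_pow_val] at h₃
  rw [← h₃, h₅, hv, Localization.mk_eq_mk', ← map_pow]
  exact (IsLocalization.mk'_spec' L p (⟨X k ^ N, N, rfl⟩ :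
    Submonoid.powers (X k : MvPolynomial (Fin (n + 1)) F))).symm

lemma exists_eval₂_ratio (k : Fin (n + 1)) (f : Γ(PSpace F n, chart F k)) :
    ∃ (N : ℕ) (p : MvPolynomial (Fin (n + 1)) F), p.IsHomogeneous N ∧
      eval₂ (scalar (PSpace F n ↘ Spec (.of F)) (chart F k)) (ratio F k) p = f := by
  have h := (ConcreteCategory.bijective_of_isIso (Proj.basicOpenIsoAway
    (homogeneousSubmodule (Fin (n + 1)) F) (X k) (X_mem F k) one_pos).hom).2 f
  obtain ⟨a, rfl⟩ := h
  obtain ⟨N, p, hp, rfl⟩ := HomogeneousLocalization.Away.mk_surjective _ (X_mem F k) a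
  have hp' : p.IsHomogeneous N := by simpa using hp
  exact ⟨N, p, hp', eval₂_ratio k hp' hp⟩

lemma eq_zero_of_eval₂_ratio (k : Fin (n + 1)) {p : MvPolynomial (Fin (n + 1)) F} {z : ℤ}
    (hp : HomZ p z)
    (h : eval₂ (scalar (PSpace F n ↘ Spec (.of F)) (chart F k)) (ratio F k) p = 0) : p = 0 := by
  rcases lt_or_ge z 0 with hz | hz
  · exact hp.eq_zero hz
  lift z to ℕ using hz
  have hp' := homZ_natCast.1 hp
  have hp'' : p ∈ homogeneousSubmodule (Fin (n + 1)) F (z • 1) := by simpa using hp'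
  rw [eval₂_ratio k hp' hp''] at h
  have h₁ := (ConcreteCategory.bijective_of_isIso (Proj.basicOpenIsoAway
    (homogeneousSubmodule (Fin (n + 1)) F) (X k) (X_mem F k) one_pos).hom).1
    (a₁ := HomogeneousLocalization.Away.mk _ (X_mem F k) z p hp'') (a₂ := 0)
    (h.trans (map_zero _).symm)
  have h₂ := congrArg HomogeneousLocalization.val h₁
  rw [HomogeneousLocalization.Away.val_mk, HomogeneousLocalization.val_zero,
    Localization.mk_eq_mk', IsLocalization.mk'_eq_zero_iff] at h₂
  obtain ⟨⟨_, M, rfl⟩, hM⟩ := h₂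
  exact (mul_eq_zero.1 hM).resolve_left (pow_ne_zero _ (X_ne_zero k))

instance (s : ℕ) : JacobsonSpace (PSpace F s) := by
  classical
  let 𝒜 := homogeneousSubmodule (Fin (s + 1)) F
  have h₁ : Function.Surjective (algebraMap F (𝒜 0)) := fun p ↦ by
    have h : p.1.IsHomogeneous 0 := p.2
    obtain ⟨c, hc⟩ : ∃ c, p.1 = C c := ⟨coeff 0 p.1, totalDegree_eq_zero_iff_eq_C.1
      (Nat.le_zero.1 h.totalDegree_le)⟩
    exact ⟨c, Subtype.ext hc.symm⟩
  have : IsJacobsonRing (𝒜 0) := isJacobsonRing_of_surjective ⟨_, h₁⟩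
  have : Algebra.FiniteType (𝒜 0) (MvPolynomial (Fin (s + 1)) F) := by
    refine ⟨⟨Finset.univ.image X, top_le_iff.1 fun f _ ↦ ?_⟩⟩
    induction f using MvPolynomial.induction_on with
    | C a => exact Subalgebra.algebraMap_mem _ (algebraMap F (𝒜 0) a)
    | add p q hp hq => exact add_mem (hp trivial) (hq trivial)
    | mul_X p i hp => exact mul_mem (hp trivial) (Algebra.subset_adjoin (by simp))
  exact LocallyOfFiniteType.jacobsonSpace (Proj.toSpecZero 𝒜)

end ProjectiveSpace

/-! ### Sections of `O(e)` on projective space -/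

section TwistSections

open MvPolynomial LineBundle

variable {F : Type u} [Field F] {n : ℕ}

/-- The value of a polynomial on `D_+(x_k)`, at the functions `x_l / x_k`. -/
def evChart (k : Fin (n + 1)) : MvPolynomial (Fin (n + 1)) F →+* Γ(PSpace F n, chart F k) :=
  eval₂Hom (scalar (PSpace F n ↘ Spec (.of F)) (chart F k)) (ratio F k)

lemma evChart_apply (k : Fin (n + 1)) (p : MvPolynomial (Fin (n + 1)) F) : evChart k p =
    eval₂ (scalar (PSpace F n ↘ Spec (.of F)) (chart F k)) (ratio F k) p := rfl

lemma evChart_X (k l : Fin (n + 1)) : evChart k (X l) = ratio F k l := eval₂_X _ _ _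

lemma evChart_C (k : Fin (n + 1)) (c : F) :
    evChart k (C c) = scalar (PSpace F n ↘ Spec (.of F)) (chart F k) c := eval₂_C _ _ _

/-- Homogeneous polynomials of degree `z` are sections of `O(z)`. -/
lemma res_evChart {p : MvPolynomial (Fin (n + 1)) F} {z : ℤ} (hp : HomZ p z) (k l : Fin (n + 1)) :
    res (V := chart F k ⊓ chart F l) inf_le_left (evChart k p) =
      ((ratioUnit F k l ^ z : Γ(PSpace F n, chart F k ⊓ chart F l)ˣ) :
        Γ(PSpace F n, chart F k ⊓ chart F l)) * res inf_le_right (evChart l p) := by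
  have h : ∀ {W : (PSpace F n).Opens} (m : Fin (n + 1)) (hW : W ≤ chart F m),
      res hW (evChart m p) = eval₂ (scalar (PSpace F n ↘ Spec (.of F)) W)
        (fun i ↦ res hW (ratio F m i)) p := fun m hW ↦ by
    rw [evChart_apply, eval₂_comp_left (res hW)]
    congr 1
  rw [h, h, ← hp.eval₂_mul_units]
  congr 1
  funext m
  exact (ratio_cocycle F k l m _ _).symm

/-- The sections of `O(e)` on `P^n` are the homogeneous polynomials of degree `e`. For `e < 0` this
requires `n ≥ 1`. -/
lemma exists_homZ_of_mem_H0 (hn : 1 ≤ n) {e : ℤ} (a : H0 F (twist F n e)) :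
    ∃ P : MvPolynomial (Fin (n + 1)) F, HomZ P e ∧ ∀ k : Fin (n + 1), a.1 k = evChart k P := by
  have ha : ∀ k l : Fin (n + 1), res (V := chart F k ⊓ chart F l) inf_le_left (a.1 k) =
      ((ratioUnit F k l ^ e : Γ(PSpace F n, chart F k ⊓ chart F l)ˣ) :
        Γ(PSpace F n, chart F k ⊓ chart F l)) * res inf_le_right (a.1 l) := a.2
  choose N₀ p₀ hp₀ hpa₀ using fun k : Fin (n + 1) ↦ exists_eval₂_ratio k (a.1 k)
  set N := ∑ k, N₀ k + e.natAbs with hN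
  have hN₀ : ∀ k, N₀ k ≤ N := fun k ↦ (Finset.single_le_sum (f := N₀)
    (fun _ _ ↦ Nat.zero_le _) (Finset.mem_univ k)).trans (Nat.le_add_right _ _)
  obtain ⟨r, hr⟩ : ∃ r : ℕ, (N : ℤ) = e + r := ⟨(N - e).toNat, by omega⟩
  set p : Fin (n + 1) → MvPolynomial (Fin (n + 1)) F := fun k ↦ X k ^ (N - N₀ k) * p₀ k
  have hp : ∀ k, HomZ (p k) N := fun k ↦ by
    have := (homZ_X_pow (B := F) k (N - N₀ k)).mul (homZ_natCast.2 (hp₀ k))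
    rwa [← Nat.cast_add, Nat.sub_add_cancel (hN₀ k)] at this
  have hpa : ∀ k, evChart k (p k) = a.1 k := fun k ↦ by
    rw [map_mul, map_pow, evChart_X, ratio_self, one_pow, one_mul]
    exact hpa₀ k
  have key : ∀ k l, X l ^ r * p k = X k ^ r * p l := by
    intro k l
    set δ := X l ^ r * p k - X k ^ r * p l with hδ
    have hδz : HomZ δ (r + N) :=
      ((homZ_X_pow l r).mul (hp k)).sub ((homZ_X_pow k r).mul (hp l))
    have h₁ : res (V := chart F k ⊓ chart F l) inf_le_left (evChart k δ) = 0 := by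
      rw [hδ, map_sub, map_mul _ (X l ^ r), map_mul _ (X k ^ r), map_pow, map_pow, evChart_X,
        evChart_X, ratio_self, one_pow, one_mul, map_sub, map_mul _ (ratio F k l ^ r), map_pow,
        res_evChart (hp l), hpa, hpa, ha, hr, zpow_add, zpow_natCast, Units.val_mul,
        Units.val_pow_eq_pow_val]
      have h₂ : ((ratioUnit F k l : Γ(PSpace F n, chart F k ⊓ chart F l)ˣ) :
        Γ(PSpace F n, chart F k ⊓ chart F l)) = res inf_le_left (ratio F k l) := rfl
      rw [h₂, mul_assoc, mul_left_comm]
      exact sub_self _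
    obtain ⟨M, hM⟩ := exists_pow_mul_eq_zero (isAffineOpen_chart k) (basicOpen_ratio k l)
      inf_le_left h₁
    have h₂ := hM M le_rfl
    rw [← evChart_X, ← map_pow, ← map_mul] at h₂
    have h₃ := eq_zero_of_eval₂_ratio k ((homZ_X_pow l M).mul hδz) h₂
    exact sub_eq_zero.1 ((mul_eq_zero.1 h₃).resolve_left (pow_ne_zero _ (X_ne_zero l)))
  let Q := FractionRing (MvPolynomial (Fin (n + 1)) F)
  let α : MvPolynomial (Fin (n + 1)) F →+* Q := algebraMap _ Q
  have hα : ∀ k : Fin (n + 1), α (X k ^ r) ≠ 0 := fun k ↦ SectionSystem.algebraMap_X_pow_ne_zero k r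
  have hf : ∀ k, α (p 0) / α (X 0 ^ r) * α (X k ^ r) = α (p k) := fun k ↦ by
    rw [div_mul_eq_mul_div, div_eq_iff (hα 0), ← map_mul, ← map_mul, mul_comm, key 0 k, mul_comm]
  obtain ⟨P, hP, hPf⟩ := LocMod.exists_eq_algebraMap (a := 0) (t := e)
    (f := fun _ : Unit ↦ α (p 0) / α (X 0 ^ r)) (fun k ↦ ⟨r, fun _ ↦ p k, Submodule.mem_top,
      fun _ ↦ by
        rw [Pi.zero_apply, sub_zero, Finset.card_singleton, Nat.cast_one, mul_one, ← hr]
        exact hp k,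
      fun _ ↦ by
        rw [SectionSystem.varProd_singleton]
        exact hf k⟩) (Or.inl hn)
  refine ⟨P (), by simpa using hP (), fun k ↦ ?_⟩
  have h₁ : p k = P () * X k ^ r := by
    apply IsFractionRing.injective _ Q
    rw [map_mul _ (P ()), ← hPf ()]
    exact (hf k).symm
  rw [← hpa, h₁, map_mul, map_pow, evChart_X, ratio_self, one_pow, mul_one]

variable (F) in
/-- A homogeneous polynomial, as a section of `O(e)` on `P^n`. -/
def polySection {p : MvPolynomial (Fin (n + 1)) F} {e : ℤ} (hp : HomZ p e) : H0 F (twist F n e) :=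
  ⟨fun k : Fin (n + 1) ↦ evChart k p, res_evChart hp⟩

end TwistSections

/-! ### The section systems of a finite morphism and of its fibres -/

section AffineFacts

lemma pull_pull {X Y Z : Scheme.{u}} (f : Y ⟶ X) (g : Z ⟶ Y) {U : X.Opens} {V : Y.Opens}
    {W : Z.Opens} (h : V ≤ f ⁻¹ᵁ U) (h' : W ≤ g ⁻¹ᵁ V) (s : Γ(X, U)) :
    pull g h' (pull f h s) = pull (g ≫ f) (h'.trans fun _ hx ↦ h hx) s := by
  rw [← CommRingCat.comp_apply, Scheme.Hom.appLE_comp_appLE]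

lemma pull_congr {X Y : Scheme.{u}} {f f' : Y ⟶ X} (e : f = f') {U : X.Opens} {V : Y.Opens}
    (h : V ≤ f ⁻¹ᵁ U) (s : Γ(X, U)) : pull f h s = pull f' (e ▸ h) s := by
  subst e
  rfl

lemma pull_surjective {X Y : Scheme.{u}} (f : Y ⟶ X) [IsClosedImmersion f] {U : X.Opens}
    (hU : IsAffineOpen U) {V : Y.Opens} (hV : V = f ⁻¹ᵁ U) :
    Function.Surjective (pull f hV.le) := by
  subst hV
  have := f.app_surjective U hU
  rwa [Scheme.Hom.app_eq_appLE] at this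

/-- The kernel of `B → B ⊗_A A/I` is `I B`. -/
lemma mem_map_ker_of_isPushout {A B C D : CommRingCat.{u}} {f : A ⟶ B} {g : A ⟶ C} {f' : B ⟶ D}
    {g' : C ⟶ D} (h : IsPushout f g f' g') (hg : Function.Surjective g.hom) {x : B}
    (hx : f'.hom x = 0) : x ∈ (RingHom.ker g.hom).map f.hom := by
  let I := (RingHom.ker g.hom).map f.hom
  let ψ : C →+* B ⧸ I := RingHom.liftOfSurjective g.hom hg
    ⟨(Ideal.Quotient.mk I).comp f.hom, fun a ha ↦
      Ideal.Quotient.eq_zero_iff_mem.2 (Ideal.mem_map_of_mem f.hom ha)⟩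
  have hψ : ∀ a, ψ (g.hom a) = Ideal.Quotient.mk I (f.hom a) := fun a ↦
    RingHom.liftOfRightInverse_comp_apply _ _ _ _ _
  have hw : f ≫ CommRingCat.ofHom (Ideal.Quotient.mk I) = g ≫ CommRingCat.ofHom ψ :=
    CommRingCat.hom_ext (RingHom.ext fun a ↦ (hψ a).symm)
  have h₁ := congrArg (fun k ↦ k.hom x) (h.inl_desc _ _ hw)
  change (h.desc _ _ hw).hom (f'.hom x) = Ideal.Quotient.mk I x at h₁
  rw [hx, map_zero] at h₁
  exact Ideal.Quotient.eq_zero_iff_mem.1 h₁.symm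

end AffineFacts

section Systems

open MvPolynomial LineBundle

variable {F : Type u} [Field F] {n s : ℕ} {X : Scheme.{u}} [X.Over (Spec (.of F))]
  (i : X ⟶ PSpace F n) [i.IsOver (Spec (.of F))] (φ : X ⟶ PSpace F s) [φ.IsOver (Spec (.of F))]

lemma pull_evChart {k : Fin (n + 1)} {W : X.Opens} (hW : W ≤ i ⁻¹ᵁ chart F k)
    (p : MvPolynomial (Fin (n + 1)) F) : pull i hW (evChart k p) =
      eval₂ (scalar (X ↘ Spec (.of F)) W) (rat hW) p := by
  rw [evChart_apply, eval₂_comp_left]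
  congr 1
  refine RingHom.ext fun c ↦ ?_
  rw [RingHom.comp_apply, pull_scalar, comp_over]

variable (F) in
/-- The functions on `D_+(y_j)`, as functions on its inverse image. -/
abbrev baseMap (j : Fin (s + 1)) : Γ(PSpace F s, chart F j) →+* Γ(X, φ ⁻¹ᵁ chart F j) :=
  pull φ le_rfl

lemma evAt_map_scalar (j : Fin (s + 1)) (k : Fin (n + 1)) (p : MvPolynomial (Fin (n + 1)) F) :
    evAt i (baseMap F φ j) k (map (scalar (PSpace F s ↘ Spec (.of F)) (chart F j)) p) =
      pull i inf_le_left (evChart k p) := by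
  rw [pull_evChart, evAt_apply, eval₂_map]
  congr 1
  refine RingHom.ext fun c ↦ ?_
  change res _ (pull φ _ _) = _
  rw [pull_scalar, res_scalar, comp_over]

/-- As `X` is closed in `P^n`, functions on `X ∩ D_+(x_k)` are polynomials over `F`; by
`exists_eq_sum_rat`, functions on the part over `D_+(y_j)` are polynomials with coefficients in the
functions on `D_+(y_j)`. -/
lemma surjective_evAt [IsClosedImmersion i] (j : Fin (s + 1)) (k : Fin (n + 1)) :
    Function.Surjective (evAt i (baseMap F φ j) k) := by
  intro f
  have hk : IsAffineOpen (i ⁻¹ᵁ chart F k) := (isAffineOpen_chart k).preimage i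
  obtain ⟨N, c, hc⟩ := exists_eq_sum_rat (g := φ) hk j (res (inf_comm _ _).le f)
  have hp : ∀ l, ∃ p, pull i le_rfl (evChart k p) = c l := fun l ↦ by
    obtain ⟨a, ha⟩ := pull_surjective i (isAffineOpen_chart k) rfl (c l)
    obtain ⟨-, p, -, rfl⟩ := exists_eval₂_ratio k a
    exact ⟨p, ha⟩
  choose p hp using hp
  refine ⟨∑ l, map (scalar (PSpace F s ↘ Spec (.of F)) (chart F j)) (p l) * C (ratio F j l ^ N), ?_⟩
  have h := congrArg (res ((inf_comm _ _).le : patch i (φ ⁻¹ᵁ chart F j) k ≤ _)) hc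
  rw [res_res, res_self, map_sum] at h
  rw [h, map_sum]
  refine Finset.sum_congr rfl fun l _ ↦ ?_
  rw [map_mul, map_mul, evAt_map_scalar, evAt_C, ← hp, res_res, res_pull, map_pow, map_pow,
    res_pull, res_pull]

omit [X.Over (Spec (.of F))] [φ.IsOver (Spec (.of F))] in
lemma finite_baseMap [IsFinite φ] (j : Fin (s + 1)) : (baseMap F φ j).Finite := by
  have := φ.finite_app (chart F j) (isAffineOpen_chart j)
  rwa [Scheme.Hom.app_eq_appLE] at this

/-- The section system of the part of `X` over `D_+(y_j)`. -/
def xSystem [IsClosedImmersion i] [IsFinite φ] (j : Fin (s + 1)) :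
    SectionSystem Γ(PSpace F s, chart F j) (Fam i (baseMap F φ j)) n :=
  geomSystem i (baseMap F φ j) ((isAffineOpen_chart j).preimage φ) (surjective_evAt i φ j)

end Systems

section Fibre

open MvPolynomial LineBundle

variable {F : Type u} [Field F] {n s : ℕ} {X : Scheme.{u}}
  (i : X ⟶ PSpace F n) (φ : X ⟶ PSpace F s) {y : PSpace F s} {j : Fin (s + 1)}

lemma top_le_fromSpecResidueField (hyj : y ∈ chart F j) :
    ⊤ ≤ (PSpace F s).fromSpecResidueField y ⁻¹ᵁ chart F j := fun x _ ↦ by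
  change (PSpace F s).fromSpecResidueField y x ∈ chart F j
  rwa [Scheme.fromSpecResidueField_apply]

/-- The evaluation at a point `y` of `D_+(y_j)`. -/
def evalPt (hyj : y ∈ chart F j) :
    Γ(PSpace F s, chart F j) →+* (PSpace F s).residueField y :=
  (Scheme.ΓSpecIso ((PSpace F s).residueField y)).hom.hom.comp
    (pull ((PSpace F s).fromSpecResidueField y) (top_le_fromSpecResidueField hyj))

lemma evalPt_surjective (hyj : y ∈ chart F j) (hy : IsClosed {y}) :
    Function.Surjective (evalPt hyj) := by
  have := isClosed_singleton_iff_isClosedImmersion.1 hy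
  have h : Function.Surjective (Scheme.ΓSpecIso ((PSpace F s).residueField y)).hom.hom :=
    (ConcreteCategory.bijective_of_isIso (Scheme.ΓSpecIso ((PSpace F s).residueField y)).hom).2
  exact h.comp (pull_surjective ((PSpace F s).fromSpecResidueField y) (isAffineOpen_chart j)
    (le_antisymm (top_le_fromSpecResidueField hyj) le_top))

lemma evalPt_ne_zero (hyj : y ∈ chart F j) {c : Γ(PSpace F s, chart F j)}
    (hc : y ∈ (PSpace F s).basicOpen c) : evalPt hyj c ≠ 0 := by
  intro h
  have h₀ : Function.Injective (Scheme.ΓSpecIso ((PSpace F s).residueField y)).hom.hom :=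
    (ConcreteCategory.bijective_of_isIso (Scheme.ΓSpecIso ((PSpace F s).residueField y)).hom).1
  have h₁ : pull ((PSpace F s).fromSpecResidueField y) (top_le_fromSpecResidueField hyj) c = 0 :=
    h₀ (h.trans (map_zero _).symm)
  obtain ⟨x⟩ : Nonempty (Spec ((PSpace F s).residueField y)) := inferInstance
  have h₂ : x ∈ (PSpace F s).fromSpecResidueField y ⁻¹ᵁ (PSpace F s).basicOpen c := by
    change (PSpace F s).fromSpecResidueField y x ∈ (PSpace F s).basicOpen c
    rwa [Scheme.fromSpecResidueField_apply]
  have h₃ : (Spec ((PSpace F s).residueField y)).basicOpen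
      (res (top_le_fromSpecResidueField hyj)
        (pull ((PSpace F s).fromSpecResidueField y) le_rfl c)) =
      ⊤ ⊓ (PSpace F s).fromSpecResidueField y ⁻¹ᵁ (PSpace F s).basicOpen c := by
    refine basicOpen_res' _ ?_
    rw [Scheme.preimage_basicOpen, pull, Scheme.Hom.app_eq_appLE]
  rw [res_pull, h₁, Scheme.basicOpen_zero] at h₃
  exact (h₃.ge ⟨trivial, h₂⟩ : x ∈ (⊥ : Opens _))

variable (y) in
/-- The embedding of the fibre in projective space. -/
abbrev fibreMap : φ.fiber y ⟶ PSpace F n := φ.fiberι y ≫ i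

variable (y) in
/-- The constants on the fibre. -/
abbrev fibreConst : (PSpace F s).residueField y →+* Γ(φ.fiber y, ⊤) :=
  scalar (φ.fiberToSpecResidueField y) ⊤

lemma fiberι_le (hyj : y ∈ chart F j) (V : (φ.fiber y).Opens) :
    V ≤ φ.fiberι y ⁻¹ᵁ (φ ⁻¹ᵁ chart F j) := fun x _ ↦ by
  have h : φ.fiberι y x ∈ φ ⁻¹' {y} := by
    rw [← φ.range_fiberι y]
    exact ⟨x, rfl⟩
  change φ (φ.fiberι y x) ∈ chart F j
  rwa [show φ (φ.fiberι y x) = y from h]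

lemma fibreConst_evalPt (hyj : y ∈ chart F j) (c : Γ(PSpace F s, chart F j)) :
    fibreConst φ y (evalPt hyj c) = pull (φ.fiberι y) (fiberι_le φ hyj ⊤) (baseMap F φ j c) := by
  change pull (φ.fiberToSpecResidueField y) _
    ((Scheme.ΓSpecIso ((PSpace F s).residueField y)).inv.hom
      ((Scheme.ΓSpecIso ((PSpace F s).residueField y)).hom.hom (pull _ _ c))) = _
  have h := ConcreteCategory.congr_hom (Scheme.ΓSpecIso ((PSpace F s).residueField y)).hom_inv_id
    (pull ((PSpace F s).fromSpecResidueField y) (top_le_fromSpecResidueField hyj) c)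
  refine (congrArg (pull (φ.fiberToSpecResidueField y) (le_preimage_top _ _)) h).trans ?_
  refine (pull_pull _ _ _ _ _).trans ((pull_congr ?_ _ _).trans (pull_pull _ _ _ _ _).symm)
  exact (φ.fiber_fac y).symm

lemma patch_fibre_eq (hyj : y ∈ chart F j) (k : Fin (n + 1)) :
    patch (fibreMap i φ y) ⊤ k = φ.fiberι y ⁻¹ᵁ patch i (φ ⁻¹ᵁ chart F j) k ⊓
      φ.fiberToSpecResidueField y ⁻¹ᵁ ⊤ := by
  ext x
  exact ⟨fun hx ↦ ⟨⟨hx.1, fiberι_le φ hyj ⊤ trivial⟩, trivial⟩, fun hx ↦ ⟨hx.1.1, trivial⟩⟩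

lemma patch_fibre_eq' (hyj : y ∈ chart F j) (k : Fin (n + 1)) :
    patch (fibreMap i φ y) ⊤ k = φ.fiberι y ⁻¹ᵁ patch i (φ ⁻¹ᵁ chart F j) k :=
  (patch_fibre_eq i φ hyj k).trans (inf_top_eq _)

/-- The restriction of functions from `X` to the fibre. -/
def toFibre (hyj : y ∈ chart F j) :
    Fam i (baseMap F φ j) →+* Fam (fibreMap i φ y) (fibreConst φ y) :=
  RingHom.pi fun k ↦ (pull (φ.fiberι y) (patch_fibre_eq' i φ hyj k).le).comp (Pi.evalRingHom _ k)

lemma toFibre_apply (hyj : y ∈ chart F j) (f : Fam i (baseMap F φ j)) (k : Fin (n + 1)) :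
    toFibre i φ hyj f k = pull (φ.fiberι y) (patch_fibre_eq' i φ hyj k).le (f k) := rfl

lemma pull_evAt (hyj : y ∈ chart F j) (k : Fin (n + 1))
    (p : MvPolynomial (Fin (n + 1)) Γ(PSpace F s, chart F j)) :
    pull (φ.fiberι y) (patch_fibre_eq' i φ hyj k).le (evAt i (baseMap F φ j) k p) =
      evAt (fibreMap i φ y) (fibreConst φ y) k (map (evalPt hyj) p) := by
  rw [evAt_apply, evAt_apply, eval₂_comp_left, eval₂_map]
  congr 1
  · refine RingHom.ext fun c ↦ ?_
    change pull (φ.fiberι y) _ (res _ (baseMap F φ j c)) = res _ (fibreConst φ y (evalPt hyj c))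
    rw [fibreConst_evalPt]
    exact (pull_res _ _ _ _).trans (res_pull _ _ _ _).symm
  · funext l
    exact pull_pull _ _ _ _ _

variable [IsFinite φ]

lemma pull_fiberι_surjective (hyj : y ∈ chart F j) (hy : IsClosed {y}) (k : Fin (n + 1)) :
    Function.Surjective (pull (φ.fiberι y) (patch_fibre_eq' i φ hyj k).le) := by
  have := isClosed_singleton_iff_isClosedImmersion.1 hy
  have hst : MorphismProperty.IsStableUnderBaseChange @IsClosedImmersion.{u} := inferInstance
  have : IsClosedImmersion (φ.fiberι y) :=
    hst.of_isPullback (IsPullback.of_hasPullback φ ((PSpace F s).fromSpecResidueField y)).flip this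
  exact pull_surjective _ (isAffineOpen_preimage_chart_inf i ((isAffineOpen_chart j).preimage φ) k)
    (patch_fibre_eq' i φ hyj k)

/-- A function on `X` which vanishes on the fibre is a combination of functions on the base which
vanish at the point. -/
lemma mem_map_ker (hyj : y ∈ chart F j) (hy : IsClosed {y}) (k : Fin (n + 1))
    {f : Γ(X, patch i (φ ⁻¹ᵁ chart F j) k)}
    (hf : pull (φ.fiberι y) (patch_fibre_eq' i φ hyj k).le f = 0) :
    f ∈ (RingHom.ker (evalPt hyj)).map (pull φ (inf_le_right :
      patch i (φ ⁻¹ᵁ chart F j) k ≤ φ ⁻¹ᵁ chart F j)) := by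
  have h := (isIso_pushoutSection_iff (IsPullback.of_hasPullback φ _)
    (UX := patch i (φ ⁻¹ᵁ chart F j) k)
    (top_le_fromSpecResidueField hyj) inf_le_right (patch_fibre_eq i φ hyj k)).1
    (isIso_pushoutSection_of_isAffineOpen _ _ _ _ (isAffineOpen_chart j) (isAffineOpen_top _)
      (isAffineOpen_preimage_chart_inf i ((isAffineOpen_chart j).preimage φ) k))
  have hs : Function.Surjective (pull ((PSpace F s).fromSpecResidueField y)
      (top_le_fromSpecResidueField hyj)) := by
    have := isClosed_singleton_iff_isClosedImmersion.1 hy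
    exact pull_surjective _ (isAffineOpen_chart j)
      (le_antisymm (top_le_fromSpecResidueField hyj) le_top)
  refine Ideal.map_mono (fun c hc ↦ ?_) (mem_map_ker_of_isPushout h hs hf)
  rw [RingHom.mem_ker] at hc ⊢
  change (Scheme.ΓSpecIso ((PSpace F s).residueField y)).hom.hom (pull _ _ c) = 0
  exact (congrArg _ hc).trans (map_zero _)

end Fibre

/-! ### Closed fibres -/

section FibreSystem

open MvPolynomial LineBundle

variable {F : Type u} [Field F] {n s : ℕ} {X : Scheme.{u}} (i : X ⟶ PSpace F n)
  (φ : X ⟶ PSpace F s) {y : PSpace F s} {j : Fin (s + 1)}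

lemma finite_fibreConst [IsFinite φ] : (fibreConst φ y).Finite := by
  have hst : MorphismProperty.IsStableUnderBaseChange @IsFinite.{u} := inferInstance
  have : IsFinite (φ.fiberToSpecResidueField y) :=
    hst.of_isPullback (IsPullback.of_hasPullback φ ((PSpace F s).fromSpecResidueField y))
      inferInstance
  have h := (φ.fiberToSpecResidueField y).finite_app ⊤ (isAffineOpen_top _)
  rw [Scheme.Hom.app_eq_appLE] at h
  exact h.comp (RingHom.Finite.of_surjective _
    (ConcreteCategory.bijective_of_isIso (Scheme.ΓSpecIso ((PSpace F s).residueField y)).inv).2)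

/-- The homogeneous elements of `homogeneousIdeal`, which is defined as a span, are the polynomials
which vanish on the scheme. -/
lemma mem_homogeneousIdeal_iff {K : Type u} [Field K] {Z : Scheme.{u}} (g : Z ⟶ PSpace F n)
    (q : Z ⟶ Spec (.of K)) {p : MvPolynomial (Fin (n + 1)) K} {z : ℤ} (hp : HomZ p z) :
    p ∈ homogeneousIdeal g q ↔ ∀ k, evAt g (scalar q ⊤) k p = 0 := by
  have key : ∀ k (p : MvPolynomial (Fin (n + 1)) K), evAt g (scalar q ⊤) k p =
      res (V := patch g ⊤ k) inf_le_left (eval₂ (scalar q (g ⁻¹ᵁ chart F k))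
        (fun l ↦ pull g le_rfl (ratio F k l)) p) := fun k p ↦ by
    rw [evAt_apply, eval₂_comp_left]
    congr 1
    · refine RingHom.ext fun c ↦ ?_
      exact (res_scalar _ _ _).trans (res_scalar _ _ _).symm
    · funext l
      exact (res_pull _ _ _ _).symm
  constructor
  · intro h k
    have h₁ : homogeneousIdeal g q ≤ RingHom.ker (evAt g (scalar q ⊤) k) := by
      refine Ideal.span_le.2 fun f hf ↦ ?_
      rw [SetLike.mem_coe, RingHom.mem_ker, key, hf.2 k, map_zero]
    exact h₁ h
  · intro h
    rcases lt_or_ge z 0 with hz | hz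
    · rw [hp.eq_zero hz]
      exact zero_mem _
    · lift z to ℕ using hz
      refine Ideal.subset_span ⟨⟨z, homZ_natCast.1 hp⟩, fun k ↦ ?_⟩
      have h₁ := congrArg (res (V := g ⁻¹ᵁ chart F k) (le_inf le_rfl le_top)) (h k)
      rwa [key, res_res, res_self, map_zero] at h₁

variable [X.Over (Spec (.of F))] [i.IsOver (Spec (.of F))] [φ.IsOver (Spec (.of F))]
  [IsClosedImmersion i] [IsFinite φ] (hyj : y ∈ chart F j) (hy : IsClosed {y})

include hyj hy in
lemma surjective_evAt_fibre (k : Fin (n + 1)) :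
    Function.Surjective (evAt (fibreMap i φ y) (fibreConst φ y) k) := fun f ↦ by
  obtain ⟨g, rfl⟩ := pull_fiberι_surjective i φ hyj hy k f
  obtain ⟨p, rfl⟩ := surjective_evAt i φ j k g
  exact ⟨map (evalPt hyj) p, (pull_evAt i φ hyj k p).symm⟩

/-- The section system of the fibre over a closed point. -/
def fibreSystem : SectionSystem ((PSpace F s).residueField y)
    (Fam (fibreMap i φ y) (fibreConst φ y)) n :=
  geomSystem (fibreMap i φ y) (fibreConst φ y) (isAffineOpen_top _)
    (surjective_evAt_fibre i φ hyj hy)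

/-- The regularity of a fibre is determined by the degrees in which the sections of the
twists of its structure sheaf are polynomials. -/
lemma isRegularity_fiberIdeal_iff (hn : 1 ≤ n) (r : ℤ) : IsRegularity (fiberIdeal i φ y) r ↔
    IsLeast {r : ℤ | 0 ≤ r ∧ (fibreSystem i φ hyj hy).Gen (r - 1)} r :=
  (fibreSystem i φ hyj hy).isRegularity_iff hn (geomSystem_sec_zero_fg (finite_fibreConst φ))
    fun _ _ hp ↦ (mem_homogeneousIdeal_iff _ _ hp).trans funext_iff.symm

lemma toFibre_ev (p : MvPolynomial (Fin (n + 1)) Γ(PSpace F s, chart F j)) :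
    toFibre i φ hyj ((xSystem i φ j).ev p) = (fibreSystem i φ hyj hy).ev (map (evalPt hyj) p) :=
  funext fun k ↦ pull_evAt i φ hyj k p

/-- Polynomiality of sections passes to the closed fibres. -/
lemma gen_fibreSystem {e : ℤ} (h : (xSystem i φ j).Gen e) : (fibreSystem i φ hyj hy).Gen e :=
  SectionSystem.Gen.of_lift (xSystem i φ j) (fibreSystem i φ hyj hy) (evalPt_surjective hyj hy)
    (toFibre_ev i φ hyj hy) h

lemma toFibre_mem_sec (d : ℤ) (f : Fam i (baseMap F φ j)) (hf : f ∈ (xSystem i φ j).sec d) :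
    toFibre i φ hyj f ∈ (fibreSystem i φ hyj hy).sec d := by
  intro k l
  have hW : patch (fibreMap i φ y) ⊤ k ⊓ patch (fibreMap i φ y) ⊤ l ≤
      φ.fiberι y ⁻¹ᵁ (patch i (φ ⁻¹ᵁ chart F j) k ⊓ patch i (φ ⁻¹ᵁ chart F j) l) := fun x hx ↦
    ⟨(patch_fibre_eq' i φ hyj k).le hx.1, (patch_fibre_eq' i φ hyj l).le hx.2⟩
  have h := congrArg (pull (φ.fiberι y) hW) (hf k l)
  rw [map_mul, pull_res, pull_res, pull_ratU_zpow] at h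
  · rw [toFibre_apply, toFibre_apply, res_pull, res_pull]
    exact h

include hy in
/-- A section which vanishes on the fibre is locally a polynomial whose coefficients vanish at the
point. -/
lemma exists_ev_of_toFibre_eq_zero {d : ℤ} {f : Fam i (baseMap F φ j)}
    (hf : f ∈ (xSystem i φ j).sec d) (hf0 : toFibre i φ hyj f = 0) (k : Fin (n + 1)) :
    ∃ N₀ : ℕ, ∀ N ≥ N₀, ∃ p, HomZ p (d + N) ∧ map (evalPt hyj) p = 0 ∧
      (xSystem i φ j).ev p = (xSystem i φ j).ev (MvPolynomial.X k) ^ N * f := by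
  have h₁ := mem_map_ker i φ hyj hy k (congrFun hf0 k)
  have h₂ : pull φ (inf_le_right : patch i (φ ⁻¹ᵁ chart F j) k ≤ φ ⁻¹ᵁ chart F j) =
      (evAt i (baseMap F φ j) k).comp C := RingHom.ext fun c ↦ by
    rw [RingHom.comp_apply, evAt_C]
    exact (res_pull _ _ _ _).symm
  rw [h₂, ← Ideal.map_map, Ideal.mem_map_iff_of_surjective _ (surjective_evAt i φ j k)] at h₁
  obtain ⟨q, hq, hqf⟩ := h₁
  rw [mem_map_C_iff] at hq
  obtain ⟨N₀, hN₀⟩ := IsTwistSec.exists_evAt ((isAffineOpen_chart j).preimage φ) hf hqf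
  refine ⟨N₀, fun N hN ↦ ?_⟩
  obtain ⟨p, hp, hpI, hpf⟩ := hN₀ N hN
  refine ⟨p, hp, ?_, funext fun l ↦ (hpf l).trans ?_⟩
  · ext m
    rw [coeff_map, coeff_zero]
    exact hpI _ hq m
  · rw [← evAt_X (b := baseMap F φ j)]
    rfl

end FibreSystem

section ClosedPoints

open MvPolynomial LineBundle

variable {F : Type u} [Field F] {n s : ℕ} {X : Scheme.{u}} [X.Over (Spec (.of F))]
  (i : X ⟶ PSpace F n) [i.IsOver (Spec (.of F))] [IsClosedImmersion i]
  (φ : X ⟶ PSpace F s) [φ.IsOver (Spec (.of F))] [IsFinite φ] {j : Fin (s + 1)}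

/-- Every maximal ideal of the ring of functions on a chart is the ideal of a closed point. -/
lemma exists_ker_evalPt_le (I : Ideal Γ(PSpace F s, chart F j)) [hI : I.IsMaximal] :
    ∃ (y : PSpace F s) (hyj : y ∈ chart F j), IsClosed {y} ∧ RingHom.ker (evalPt hyj) ≤ I := by
  let x : Spec Γ(PSpace F s, chart F j) := ⟨I, hI.isPrime⟩
  let f := (isAffineOpen_chart (F := F) j).fromSpec
  have hfj : f x ∈ chart F j := by
    have h : f x ∈ Set.range f := ⟨x, rfl⟩
    rwa [(isAffineOpen_chart (F := F) j).range_fromSpec] at h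
  refine ⟨f x, hfj, ?_, fun c hc ↦ ?_⟩
  · have h := (f.isOpenEmbedding).preimage_closedPoints
    have hx : x ∈ closedPoints (Spec Γ(PSpace F s, chart F j)) :=
      (PrimeSpectrum.isClosed_singleton_iff_isMaximal _).2 hI
    rw [← h] at hx
    exact hx
  · by_contra hcI
    refine evalPt_ne_zero hfj ?_ hc
    have h : x ∈ f ⁻¹ᵁ (PSpace F s).basicOpen c := by
      rw [(isAffineOpen_chart (F := F) j).fromSpec_preimage_basicOpen]
      exact hcI
    exact h

/-- Polynomiality of sections over `D_+(y_j)` can be checked on the closed fibres. -/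
lemma gen_xSystem {e : ℤ} (h : ∀ (y : PSpace F s) (hyj : y ∈ chart F j) (hy : IsClosed {y}),
    (fibreSystem i φ hyj hy).Gen e) : (xSystem i φ j).Gen e := by
  refine (xSystem i φ j).gen_of_forall_isMaximal e
    ((xSystem i φ j).sec_fg (geomSystem_sec_zero_fg (finite_baseMap φ j)) e) fun I hI ↦ ?_
  obtain ⟨y, hyj, hy, hle⟩ := exists_ker_evalPt_le I
  refine (SectionSystem.sec_le_of_gen (xSystem i φ j) (fibreSystem i φ hyj hy)
    (evalPt_surjective hyj hy) (toFibre_ev i φ hyj hy) (toFibre_mem_sec i φ hyj hy)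
    (exists_ev_of_toFibre_eq_zero i φ hyj hy) (h y hyj hy)).trans ?_
  exact sup_le_sup_left (Submodule.smul_mono_left hle) _

end ClosedPoints

/-! ### Global sections of high twists -/

section Globalization

open MvPolynomial SectionSystem

variable {m : ℕ} {K : Type*} [Field K]

local notation "S" => MvPolynomial (Fin (m + 1)) K
local notation "Q" => FractionRing (MvPolynomial (Fin (m + 1)) K)

/-- By Serre vanishing for `H^1` of the sheaf defined by `N ⊆ S^r`, a global section of a large
twist of the sheaf defined by `S^r / N` lifts to a vector of polynomials. The section is given by
its local lifts `q j / x_j ^ M`. -/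
theorem exists_forall_lift (r : ℕ) (N : Submodule (MvPolynomial (Fin (m + 1)) K)
    (Fin r → MvPolynomial (Fin (m + 1)) K)) : ∃ t₀ : ℤ, ∀ t ≥ t₀, 0 ≤ t →
    ∀ (M : ℕ) (q : Fin (m + 1) → Fin r → MvPolynomial (Fin (m + 1)) K),
      (∀ j i, HomZ (q j i) (t + M)) →
      (∀ j l, ∃ M', (X j * X l : MvPolynomial (Fin (m + 1)) K) ^ M' •
        ((X l : MvPolynomial (Fin (m + 1)) K) ^ M • q j -
          (X j : MvPolynomial (Fin (m + 1)) K) ^ M • q l) ∈ N) →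
      ∃ P : Fin r → MvPolynomial (Fin (m + 1)) K, (∀ i, HomZ (P i) t) ∧
        ∀ j, ∃ M', (X j : MvPolynomial (Fin (m + 1)) K) ^ M' •
          (q j - (X j : MvPolynomial (Fin (m + 1)) K) ^ M • P) ∈ N := by
  obtain ⟨t₀, ht₀⟩ := exists_forall_setD_eq m r 0 N 1 (by omega)
  refine ⟨t₀, fun t ht ht0 M q hq hqN ↦ ?_⟩
  let f : Finset (Fin (m + 1)) → Fin r → Q := fun τ i ↦
    ∑ j ∈ τ, algebraMap S Q (q j i) / algebraMap S Q (X j ^ M)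
  have hf : ∀ j i, f {j} i * algebraMap S Q (X j ^ M) = algebraMap S Q (q j i) := fun j i ↦ by
    simp only [f, Finset.sum_singleton]
    exact div_mul_cancel₀ _ (algebraMap_X_pow_ne_zero j M)
  -- the differences of the local lifts form a cocycle with values in the sheaf defined by `N`
  obtain ⟨b, hb, hbf⟩ := ht₀ t ht (setD f) (fun σ hσ ↦ by
    obtain ⟨k, l, hkl, rfl⟩ := Finset.card_eq_two.1 hσ
    rw [setD_pair hkl]
    refine zsmul_mem ?_ _
    obtain ⟨M', hM'⟩ := hqN l k
    refine ⟨M + M', _, hM', fun i ↦ ?_, fun i ↦ ?_⟩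
    · have h₁ : HomZ ((X k : S) ^ M * q l i - X l ^ M * q k i) (M + (t + M)) :=
        ((homZ_X_pow k M).mul (hq l i)).sub ((homZ_X_pow l M).mul (hq k i))
      have h₂ := (((homZ_X_pow l M').mul (homZ_X_pow (B := K) k M')).mul h₁)
      rw [← mul_pow] at h₂
      rw [Pi.zero_apply, sub_zero, Finset.card_pair hkl]
      rwa [show (M' : ℤ) + M' + (M + (t + M)) = t + (M + M' : ℕ) * (2 : ℕ) by push_cast; ring] at h₂
    · have h₁ : ((X l * X k : S) ^ M' • ((X k : S) ^ M • q l - (X l : S) ^ M • q k)) i =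
        (X l * X k) ^ M' * (X k ^ M * q l i - X l ^ M * q k i) := rfl
      rw [h₁, varProd_pair hkl, map_mul _ ((X l * X k : S) ^ M'), map_sub, map_mul _ (X k ^ M),
        map_mul _ (X l ^ M), ← hf, ← hf, Pi.sub_apply]
      simp only [map_mul, map_pow, pow_add, mul_pow]
      ring) fun σ _ ↦ setD_setD f σ
  have hg : ∀ k, f {k} - b {k} = f {0} - b {0} := fun k ↦ by
    rcases eq_or_ne 0 k with rfl | hk
    · rfl
    · have h₁ := hbf {0, k} (Finset.card_pair hk)
      rw [setD_pair hk, setD_pair hk] at h₁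
      have h₂ : b {k} - b {0} = f {k} - f {0} := by
        rcases cechSign_eq_or 0 {0, k} with h | h
        · rwa [h, one_smul, one_smul] at h₁
        · rwa [h, neg_smul, neg_smul, one_smul, one_smul, neg_inj] at h₁
      rw [sub_eq_sub_iff_sub_eq_sub, h₂]
  obtain ⟨P, hP, hPf⟩ := LocMod.exists_eq_algebraMap (a := 0) (t := t) (f := f {0} - b {0})
    (fun k ↦ by
      rw [← hg k]
      refine sub_mem ⟨M, q k, Submodule.mem_top, fun i ↦ ?_, fun i ↦ ?_⟩
        (LocMod.mono_left (fun _ _ _ _ ↦ Submodule.mem_top) (hb {k} (Finset.card_singleton k)))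
      · rw [Pi.zero_apply, sub_zero, Finset.card_singleton, Nat.cast_one, mul_one]
        exact hq k i
      · rw [varProd_singleton]
        exact hf k i) (Or.inr fun _ ↦ ht0)
  refine ⟨P, fun i ↦ by simpa using hP i, fun j ↦ ?_⟩
  obtain ⟨M', p, hp, -, hp'⟩ := hb {j} (Finset.card_singleton j)
  refine ⟨M', ?_⟩
  have h : (X j : S) ^ M' • (q j - (X j : S) ^ M • P) = (X j : S) ^ M • p := by
    funext i
    apply IsFractionRing.injective S Q
    change algebraMap S Q (X j ^ M' * (q j i - X j ^ M * P i)) = algebraMap S Q (X j ^ M * p i)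
    rw [map_mul _ (X j ^ M'), map_sub, map_mul _ (X j ^ M), map_mul _ (X j ^ M), ← hp', ← hf,
      ← hPf, ← hg j, varProd_singleton, Pi.sub_apply]
    ring
  rw [h]
  exact N.smul_mem _ hp

end Globalization

/-! ### The multiplication map in local terms -/

section MultMap

open MvPolynomial LineBundle

variable {F : Type u} [Field F] {n s : ℕ} {X : Scheme.{u}} [X.Over (Spec (.of F))]
  (i : X ⟶ PSpace F n) [i.IsOver (Spec (.of F))] (φ : X ⟶ PSpace F s) [φ.IsOver (Spec (.of F))]

/-- The local expression of a section of `L^t(e)` over `D_+(x_k)` and `D_+(y_j)`. -/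
def localSec {e : ℤ} {t : ℕ} (w : H0 F (twistedPower F i φ e t)) (k : Fin (n + 1))
    (j : Fin (s + 1)) : Γ(X, patch i (φ ⁻¹ᵁ chart F j) k) := w.1 (k, j)

variable {i φ} in
omit [i.IsOver (Spec (.of F))] [φ.IsOver (Spec (.of F))] in
lemma H0_ext {e : ℤ} {t : ℕ} {w w' : H0 F (twistedPower F i φ e t)}
    (h : ∀ k j, localSec i φ w k j = localSec i φ w' k j) : w = w' :=
  Subtype.ext (funext fun a ↦ h a.1 a.2)

omit [i.IsOver (Spec (.of F))] [φ.IsOver (Spec (.of F))] in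
lemma localSec_add {e : ℤ} {t : ℕ} (w w' : H0 F (twistedPower F i φ e t)) (k : Fin (n + 1))
    (j : Fin (s + 1)) : localSec i φ (w + w') k j = localSec i φ w k j + localSec i φ w' k j := rfl

omit [X.Over (Spec (.of F))] [i.IsOver (Spec (.of F))] [φ.IsOver (Spec (.of F))] in
lemma twistedPower_g (e : ℤ) (t : ℕ) (a b : Fin (n + 1) × Fin (s + 1)) :
    (twistedPower F i φ e t).g a b =
      ((ratU (g := i) (inf_le_left.trans inf_le_left) (inf_le_right.trans inf_le_left) ^ e :
        Γ(X, patch i (φ ⁻¹ᵁ chart F a.2) a.1 ⊓ patch i (φ ⁻¹ᵁ chart F b.2) b.1)ˣ) :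
          Γ(X, patch i (φ ⁻¹ᵁ chart F a.2) a.1 ⊓ patch i (φ ⁻¹ᵁ chart F b.2) b.1)) *
      ((ratU (g := φ) (inf_le_left.trans inf_le_right) (inf_le_right.trans inf_le_right) ^ (1 : ℤ) :
        Γ(X, patch i (φ ⁻¹ᵁ chart F a.2) a.1 ⊓ patch i (φ ⁻¹ᵁ chart F b.2) b.1)ˣ) :
          Γ(X, patch i (φ ⁻¹ᵁ chart F a.2) a.1 ⊓ patch i (φ ⁻¹ᵁ chart F b.2) b.1)) ^ t := by
  change res _ (pull i _ ((twist F n e).g a.1 b.1)) *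
    res _ (pull φ _ ((twist F s 1).g a.2 b.2) ^ t) = _
  rw [map_pow]
  exact congrArg₂ (fun x y ↦ x * y ^ t) ((res_pull _ _ _ _).trans (pull_twist _ _))
    ((res_pull _ _ _ _).trans (pull_twist _ _))

omit [i.IsOver (Spec (.of F))] [φ.IsOver (Spec (.of F))] in
/-- The transition functions of `L^t(e)` between the patches over `D_+(x_k)`, `D_+(y_j)` and over
`D_+(x_l)`, `D_+(y_h)`. -/
lemma res_localSec {e : ℤ} {t : ℕ} (w : H0 F (twistedPower F i φ e t)) (k l : Fin (n + 1))
    (j h : Fin (s + 1)) {W : X.Opens} (hk : W ≤ patch i (φ ⁻¹ᵁ chart F j) k)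
    (hl : W ≤ patch i (φ ⁻¹ᵁ chart F h) l) : res hk (localSec i φ w k j) =
      ((ratU (hk.trans inf_le_left) (hl.trans inf_le_left) ^ e : Γ(X, W)ˣ) : Γ(X, W)) *
      ((ratU (hk.trans inf_le_right) (hl.trans inf_le_right) ^ t : Γ(X, W)ˣ) : Γ(X, W)) *
        res hl (localSec i φ w l h) := by
  have h₀ : res (V := patch i (φ ⁻¹ᵁ chart F j) k ⊓ patch i (φ ⁻¹ᵁ chart F h) l) inf_le_left
      (localSec i φ w k j) =
      ((ratU (g := i) (inf_le_left.trans inf_le_left) (inf_le_right.trans inf_le_left) ^ e :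
        Γ(X, patch i (φ ⁻¹ᵁ chart F j) k ⊓ patch i (φ ⁻¹ᵁ chart F h) l)ˣ) :
          Γ(X, patch i (φ ⁻¹ᵁ chart F j) k ⊓ patch i (φ ⁻¹ᵁ chart F h) l)) *
      ((ratU (g := φ) (inf_le_left.trans inf_le_right) (inf_le_right.trans inf_le_right) ^ (1 : ℤ) :
        Γ(X, patch i (φ ⁻¹ᵁ chart F j) k ⊓ patch i (φ ⁻¹ᵁ chart F h) l)ˣ) :
          Γ(X, patch i (φ ⁻¹ᵁ chart F j) k ⊓ patch i (φ ⁻¹ᵁ chart F h) l)) ^ t *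
      res inf_le_right (localSec i φ w l h) := (w.2 (k, j) (l, h)).trans
    (congrArg (fun x ↦ x * res inf_le_right (localSec i φ w l h))
      (twistedPower_g i φ e t (k, j) (l, h)))
  have h₁ := congrArg (res (le_inf hk hl)) h₀
  rw [map_mul, map_mul, map_pow, res_ratU_zpow, res_ratU_zpow, zpow_one] at h₁
  rw [Units.val_pow_eq_pow_val]
  rw [res_res, res_res] at h₁
  exact h₁

omit [i.IsOver (Spec (.of F))] [φ.IsOver (Spec (.of F))] in
lemma isTwistSec_localSec {e : ℤ} {t : ℕ} (w : H0 F (twistedPower F i φ e t)) (j : Fin (s + 1)) :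
    IsTwistSec e fun k ↦ localSec i φ w k j := fun k l ↦ by
  rw [res_localSec i φ w k l j j _ inf_le_right, ratU_self, one_pow, Units.val_one, mul_one]

lemma localSec_multMap_tmul {e : ℤ} {t : ℕ} (a : H0 F (twist F n e))
    (v : SymPow F (linearSystem F φ) t) (k : Fin (n + 1)) (j : Fin (s + 1)) :
    localSec i φ (multMap F i φ e t (a ⊗ₜ v)) k j =
      pull i inf_le_left (a.1 k) *
        res inf_le_right (symAlgMap (lineBundle F φ) (linearSystem F φ) v.1 j) := by
  exact congrArg (fun x ↦ x * res inf_le_right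
    (symAlgMap (lineBundle F φ) (linearSystem F φ) v.1 j)) (res_pull i le_rfl inf_le_left (a.1 k))

/-- On `D_+(y_j)`, elements of the symmetric algebra of `V` are functions on the base. -/
lemma exists_baseMap_eq (v : SymmetricAlgebra F (linearSystem F φ)) (j : Fin (s + 1)) :
    ∃ c : Γ(PSpace F s, chart F j),
      symAlgMap (lineBundle F φ) (linearSystem F φ) v j = baseMap F φ j c := by
  induction v using SymmetricAlgebra.induction with
  | algebraMap r =>
    refine ⟨scalar (PSpace F s ↘ Spec (.of F)) (chart F j) r, ?_⟩
    refine (congrFun (AlgHom.commutes (symAlgMap (lineBundle F φ) (linearSystem F φ)) r) j).trans ?_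
    rw [pull_scalar, comp_over]
    rfl
  | ι v =>
    obtain ⟨a, ha⟩ := v.2
    refine ⟨a.1 j, ?_⟩
    rw [symAlgMap, SymmetricAlgebra.lift_ι_apply]
    change v.1.1 j = _
    rw [← ha]
    rfl
  | mul x y hx hy =>
    obtain ⟨c, hc⟩ := hx
    obtain ⟨d, hd⟩ := hy
    refine ⟨c * d, (congrFun (map_mul _ x y) j).trans ?_⟩
    rw [map_mul, ← hc, ← hd]
    rfl
  | add x y hx hy =>
    obtain ⟨c, hc⟩ := hx
    obtain ⟨d, hd⟩ := hy
    refine ⟨c + d, (congrFun (map_add _ x y) j).trans ?_⟩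
    rw [map_add, ← hc, ← hd]
    rfl

/-- The sections in the image of the multiplication map are polynomials over `D_+(y_j)`. -/
lemma exists_evAt_eq_multMap (hn : 1 ≤ n) {e : ℤ} {t : ℕ}
    (x : H0 F (twist F n e) ⊗[F] SymPow F (linearSystem F φ) t) (j : Fin (s + 1)) :
    ∃ p, HomZ p e ∧ ∀ k, localSec i φ (multMap F i φ e t x) k j = evAt i (baseMap F φ j) k p := by
  induction x with
  | zero =>
    refine ⟨0, homZ_zero _, fun k ↦ ?_⟩
    rw [map_zero, map_zero]
    rfl
  | tmul a v =>
    obtain ⟨P, hP, haP⟩ := exists_homZ_of_mem_H0 hn a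
    obtain ⟨c, hc⟩ := exists_baseMap_eq φ v.1 j
    refine ⟨C c * map (scalar (PSpace F s ↘ Spec (.of F)) (chart F j)) P, (hP.map _).C_mul c,
      fun k ↦ ?_⟩
    rw [localSec_multMap_tmul, hc, haP, map_mul, evAt_C, evAt_map_scalar, mul_comm]
    rfl
  | add x y hx hy =>
    obtain ⟨p, hp, hp'⟩ := hx
    obtain ⟨q, hq, hq'⟩ := hy
    refine ⟨p + q, hp.add hq, fun k ↦ ?_⟩
    have h := LinearMap.map_add (multMap F i φ e t) x y
    rw [h, localSec_add, hp', hq', map_add]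

omit [X.Over (Spec (.of F))] [i.IsOver (Spec (.of F))] [φ.IsOver (Spec (.of F))] in
lemma patch_inf_patch_eq (k l : Fin (n + 1)) (j h : Fin (s + 1)) :
    patch i (φ ⁻¹ᵁ chart F j) k ⊓ patch i (φ ⁻¹ᵁ chart F h) l =
      i ⁻¹ᵁ chart F l ⊓ (patch i (φ ⁻¹ᵁ chart F j) k ⊓ φ ⁻¹ᵁ chart F h) := by
  ext x
  exact ⟨fun hx ↦ ⟨hx.2.1, hx.1, hx.2.2⟩, fun hx ↦ ⟨hx.2.1, hx.1, hx.2.2⟩⟩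

/-- If the multiplication maps are surjective, then the sections over `D_+(y_j)` are polynomials,
since they extend to `X` after multiplication by a power of `y_j`. -/
lemma gen_of_surjective_multMap [IsClosedImmersion i] [IsFinite φ] (hn : 1 ≤ n) {e : ℤ}
    (h : ∀ᶠ t : ℕ in Filter.atTop, Function.Surjective (multMap F i φ e t)) (j : Fin (s + 1)) :
    (xSystem i φ j).Gen e := by
  intro f hf
  have hf' : IsTwistSec e f := hf
  have hD : ∀ a : Fin (n + 1) × Fin (s + 1), patch i (φ ⁻¹ᵁ chart F a.2) a.1 ⊓ φ ⁻¹ᵁ chart F j ≤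
      patch i (φ ⁻¹ᵁ chart F j) a.1 := fun a x hx ↦ ⟨hx.1.1, hx.2⟩
  have haff : ∀ a : Fin (n + 1) × Fin (s + 1), IsAffineOpen (patch i (φ ⁻¹ᵁ chart F a.2) a.1) :=
    fun a ↦ isAffineOpen_preimage_chart_inf i ((isAffineOpen_chart a.2).preimage φ) a.1
  have hvar : ∀ (a : Fin (n + 1) × Fin (s + 1)) (l : Fin (s + 1)),
      X.basicOpen (rat (g := φ) (W := patch i (φ ⁻¹ᵁ chart F a.2) a.1) inf_le_right l) =
      patch i (φ ⁻¹ᵁ chart F a.2) a.1 ⊓ φ ⁻¹ᵁ chart F l := fun a l ↦ basicOpen_pull_ratio _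
  obtain ⟨N₀, hN₀⟩ := exists_extension (D := φ ⁻¹ᵁ chart F j) haff
    (fun a b ↦ by
      rw [patch_inf_patch_eq, ← hvar]
      exact isAffineOpen_preimage_chart_inf i ((haff a).basicOpen _) b.1)
    (fun a b ↦ ((ratU (g := i) (inf_le_left.trans inf_le_left) (inf_le_right.trans inf_le_left) ^
      e : Γ(X, patch i (φ ⁻¹ᵁ chart F a.2) a.1 ⊓ patch i (φ ⁻¹ᵁ chart F b.2) b.1)ˣ) :
        Γ(X, patch i (φ ⁻¹ᵁ chart F a.2) a.1 ⊓ patch i (φ ⁻¹ᵁ chart F b.2) b.1)))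
    (fun a b ↦ ((ratU (g := φ) (inf_le_left.trans inf_le_right) (inf_le_right.trans inf_le_right) ^
      (1 : ℤ) : Γ(X, patch i (φ ⁻¹ᵁ chart F a.2) a.1 ⊓ patch i (φ ⁻¹ᵁ chart F b.2) b.1)ˣ) :
        Γ(X, patch i (φ ⁻¹ᵁ chart F a.2) a.1 ⊓ patch i (φ ⁻¹ᵁ chart F b.2) b.1)))
    (fun a ↦ rat (g := φ) inf_le_right j)
    (fun a b ↦ by
      rw [zpow_one, val_ratU, res_pull, res_pull]
      have hW : patch i (φ ⁻¹ᵁ chart F a.2) a.1 ⊓ patch i (φ ⁻¹ᵁ chart F b.2) b.1 ≤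
        φ ⁻¹ᵁ (chart F a.2 ⊓ chart F b.2) := fun _ hx ↦ ⟨hx.1.2, hx.2.2⟩
      have h := congrArg (pull φ hW) (ratio_cocycle F a.2 b.2 j (V := chart F a.2 ⊓ chart F b.2)
        inf_le_left inf_le_right)
      rw [map_mul, pull_res, pull_res, pull_res] at h
      exact h.symm)
    (fun a ↦ hvar a j) (fun a ↦ res (hD a) (f a.1))
    (fun a b ↦ by
      rw [res_res, res_res, res_ratU_zpow]
      exact hf'.res_eq _ _)
  obtain ⟨t, ht, hsurj⟩ := ((Filter.eventually_ge_atTop N₀).and h).exists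
  obtain ⟨w, hw, hwg⟩ := hN₀ t ht
  obtain ⟨x, hx⟩ := hsurj ⟨w, fun a b ↦ (hwg a b).trans
    (congrArg (fun x ↦ x * res inf_le_right (w b)) (twistedPower_g i φ e t a b)).symm⟩
  obtain ⟨p, hp, hp'⟩ := exists_evAt_eq_multMap i φ hn x j
  refine ⟨p, hp, funext fun k ↦ (hp' k).symm.trans ?_⟩
  rw [hx]
  have h₁ := congrArg (res (le_inf le_rfl inf_le_right : patch i (φ ⁻¹ᵁ chart F j) k ≤ _))
    (hw (k, j))
  rw [res_res, res_self, map_mul, map_pow, res_res, res_res, res_self, res_self, rat_self, one_pow,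
    one_mul] at h₁
  exact h₁

end MultMap

/-! ### Bihomogeneous expressions for sections -/

section Bihomogeneous

open MvPolynomial LineBundle

variable {F : Type u} [Field F] {n s : ℕ} {X : Scheme.{u}} (i : X ⟶ PSpace F n)
  (φ : X ⟶ PSpace F s)

lemma pull_evChart_eq {p : MvPolynomial (Fin (s + 1)) F} {z : ℤ} (hp : HomZ p z) {W : X.Opens}
    {j h : Fin (s + 1)} (hj : W ≤ φ ⁻¹ᵁ chart F j) (hh : W ≤ φ ⁻¹ᵁ chart F h) :
    pull φ hj (evChart j p) =
      ((ratU hj hh ^ z : Γ(X, W)ˣ) : Γ(X, W)) * pull φ hh (evChart h p) := by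
  have hW : W ≤ φ ⁻¹ᵁ (chart F j ⊓ chart F h) := fun _ hx ↦ ⟨hj hx, hh hx⟩
  have h₁ := congrArg (pull φ hW) (res_evChart hp j h)
  rw [map_mul, pull_res, pull_res] at h₁
  exact h₁.trans (congrArg (fun x ↦ x * pull φ hh (evChart h p)) (pull_twist hW z))

variable {r : ℕ} (α : Fin r → Fin (n + 1) →₀ ℕ)

/-- The value of `∑ a, x ^ α a * f a (y)` on `D_+(x_k)` and `D_+(y_j)`. -/
def bival (f : Fin r → MvPolynomial (Fin (s + 1)) F) (k : Fin (n + 1)) (j : Fin (s + 1)) :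
    Γ(X, patch i (φ ⁻¹ᵁ chart F j) k) :=
  ∑ a, pull i inf_le_left (evChart k (monomial (α a) 1)) * pull φ inf_le_right (evChart j (f a))

lemma bival_sub (f g : Fin r → MvPolynomial (Fin (s + 1)) F) (k : Fin (n + 1)) (j : Fin (s + 1)) :
    bival i φ α (f - g) k j = bival i φ α f k j - bival i φ α g k j := by
  rw [bival, bival, bival, ← Finset.sum_sub_distrib]
  refine Finset.sum_congr rfl fun a _ ↦ ?_
  rw [Pi.sub_apply, map_sub, map_sub, mul_sub]

lemma bival_smul (g : MvPolynomial (Fin (s + 1)) F) (f : Fin r → MvPolynomial (Fin (s + 1)) F)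
    (k : Fin (n + 1)) (j : Fin (s + 1)) :
    bival i φ α (g • f) k j = pull φ inf_le_right (evChart j g) * bival i φ α f k j := by
  rw [bival, bival, Finset.mul_sum]
  refine Finset.sum_congr rfl fun a _ ↦ ?_
  rw [Pi.smul_apply, smul_eq_mul, map_mul, map_mul, mul_left_comm]

lemma bival_X_pow_smul (l : Fin (s + 1)) (M : ℕ) (f : Fin r → MvPolynomial (Fin (s + 1)) F)
    (k : Fin (n + 1)) (j : Fin (s + 1)) :
    bival i φ α ((MvPolynomial.X l : MvPolynomial (Fin (s + 1)) F) ^ M • f) k j =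
      rat (g := φ) inf_le_right l ^ M * bival i φ α f k j := by
  rw [bival_smul, map_pow, evChart_X, map_pow]

lemma res_bival {f : Fin r → MvPolynomial (Fin (s + 1)) F} {z : ℤ} (hf : ∀ a, HomZ (f a) z)
    (k : Fin (n + 1)) {j h : Fin (s + 1)} {W : X.Opens} (hj : W ≤ patch i (φ ⁻¹ᵁ chart F j) k)
    (hh : W ≤ patch i (φ ⁻¹ᵁ chart F h) k) : res hj (bival i φ α f k j) =
      ((ratU (hj.trans inf_le_right) (hh.trans inf_le_right) ^ z : Γ(X, W)ˣ) : Γ(X, W)) *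
        res hh (bival i φ α f k h) := by
  rw [bival, bival, map_sum, map_sum, Finset.mul_sum]
  refine Finset.sum_congr rfl fun a _ ↦ ?_
  rw [map_mul, map_mul, res_pull, res_pull, res_pull, res_pull,
    pull_evChart_eq φ (hf a) (hj.trans inf_le_right) (hh.trans inf_le_right), mul_left_comm]

/-- The relations between the monomials `x ^ α a` on `X`, with coefficients polynomials in `y`. -/
def biKer : Submodule (MvPolynomial (Fin (s + 1)) F) (Fin r → MvPolynomial (Fin (s + 1)) F) where
  carrier := {f | ∀ k j, bival i φ α f k j = 0}
  zero_mem' k j := by simp [bival]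
  add_mem' {f g} hf hg k j := by
    have h := bival_sub i φ α (f + g) g k j
    rw [add_sub_cancel_right, hf, hg, sub_zero] at h
    exact h.symm
  smul_mem' g f hf k j := by rw [bival_smul, hf, mul_zero]

/-- An expression which vanishes over `D_+(y_j) ∩ D_+(y_l)` becomes a relation after multiplication
by a power of `y_j y_l`. -/
lemma exists_pow_smul_mem_biKer [IsAffineHom φ] {f : Fin r → MvPolynomial (Fin (s + 1)) F}
    {j l : Fin (s + 1)} (hf : ∀ k h, res (inf_le_left :
      patch i (φ ⁻¹ᵁ chart F h) k ⊓ (φ ⁻¹ᵁ chart F j ⊓ φ ⁻¹ᵁ chart F l) ≤ _)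
        (bival i φ α f k h) = 0) :
    ∃ M, (MvPolynomial.X j * MvPolynomial.X l : MvPolynomial (Fin (s + 1)) F) ^ M • f ∈
      biKer i φ α := by
  have h₀ : ∀ k h, ∃ M₀ : ℕ, ∀ M ≥ M₀,
      (rat (g := φ) (W := patch i (φ ⁻¹ᵁ chart F h) k) inf_le_right j *
        rat (g := φ) inf_le_right l) ^ M * bival i φ α f k h = 0 := fun k h ↦ by
    refine exists_pow_mul_eq_zero
      (isAffineOpen_preimage_chart_inf i ((isAffineOpen_chart h).preimage φ) k) ?_
      inf_le_left (hf k h)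
    rw [Scheme.basicOpen_mul, basicOpen_pull_ratio, basicOpen_pull_ratio]
    ext x
    exact ⟨fun hx ↦ ⟨hx.1.1, hx.1.2, hx.2.2⟩, fun hx ↦ ⟨⟨hx.1, hx.2.1⟩, hx.1, hx.2.2⟩⟩
  choose M₀ hM₀ using h₀
  refine ⟨∑ k, ∑ h, M₀ k h, fun k h ↦ ?_⟩
  rw [bival_smul, map_pow, map_mul, evChart_X, evChart_X, map_pow, map_mul]
  exact hM₀ k h _ ((Finset.single_le_sum (f := M₀ k) (fun _ _ ↦ Nat.zero_le _)
    (Finset.mem_univ h)).trans (Finset.single_le_sum (f := fun k ↦ ∑ h, M₀ k h)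
      (fun _ _ ↦ Nat.zero_le _) (Finset.mem_univ k)))

end Bihomogeneous

section Surjective

open MvPolynomial LineBundle

variable {F : Type u} [Field F] {n s : ℕ} {X : Scheme.{u}} [X.Over (Spec (.of F))]
  (i : X ⟶ PSpace F n) [i.IsOver (Spec (.of F))] (φ : X ⟶ PSpace F s) [φ.IsOver (Spec (.of F))]

/-- The section `y_j` of `L`. -/
def linearForm (j : Fin (s + 1)) : linearSystem F φ :=
  ⟨pullH0 (twist F s 1) φ (polySection F (homZ_X j)), _, rfl⟩

/-- The element of the symmetric algebra given by a polynomial in the `y_l`, as a function on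
`D_+(y_j)`. -/
lemma symAlgMap_aeval (p : MvPolynomial (Fin (s + 1)) F) (j : Fin (s + 1)) :
    symAlgMap (lineBundle F φ) (linearSystem F φ)
      (aeval (fun l ↦ SymmetricAlgebra.ι F _ (linearForm φ l)) p) j =
        baseMap F φ j (evChart j p) := by
  induction p using MvPolynomial.induction_on with
  | C a =>
    rw [aeval_C, evChart_C, pull_scalar, comp_over]
    exact congrFun (AlgHom.commutes (symAlgMap (lineBundle F φ) (linearSystem F φ)) a) j
  | add p q hp hq =>
    rw [map_add, map_add, map_add, map_add, ← hp, ← hq]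
    rfl
  | mul_X p l hp =>
    rw [map_mul, map_mul, map_mul, map_mul, ← hp, aeval_X, evChart_X]
    have h : symAlgMap (lineBundle F φ) (linearSystem F φ)
        (SymmetricAlgebra.ι F _ (linearForm φ l)) j = baseMap F φ j (ratio F j l) := by
      rw [symAlgMap, SymmetricAlgebra.lift_ι_apply]
      exact congrArg (pull φ le_rfl) (evChart_X j l)
    rw [← h]
    rfl

lemma aeval_mem_symPow {p : MvPolynomial (Fin (s + 1)) F} {t : ℕ} (hp : HomZ p t) :
    aeval (fun l ↦ SymmetricAlgebra.ι F _ (linearForm φ l)) p ∈ SymPow F (linearSystem F φ) t := by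
  rw [p.as_sum, map_sum]
  refine Submodule.sum_mem _ fun d hd ↦ ?_
  have hdt : d.degree = t := by exact_mod_cast hp d (mem_support_iff.1 hd)
  rw [aeval_monomial, ← Algebra.smul_def]
  refine Submodule.smul_mem _ _ ?_
  rw [← hdt, Finsupp.degree_apply, Finsupp.prod, SymPow]
  have h : ∀ σ : Finset (Fin (s + 1)),
      ∏ l ∈ σ, SymmetricAlgebra.ι F (linearSystem F φ) (linearForm φ l) ^ d l ∈
        LinearMap.range (SymmetricAlgebra.ι F (linearSystem F φ)) ^ (∑ l ∈ σ, d l) := fun σ ↦ by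
    classical
    induction σ using Finset.induction_on with
    | empty =>
      rw [Finset.prod_empty, Finset.sum_empty, pow_zero]
      exact Submodule.one_le.1 le_rfl
    | insert l σ hl ih =>
      rw [Finset.prod_insert hl, Finset.sum_insert hl, pow_add]
      exact Submodule.mul_mem_mul (Submodule.pow_mem_pow _ (LinearMap.mem_range_self _ _) _) ih
  exact h _

/-- A bihomogeneous expression of degree `(e, t)` is in the image of the multiplication map. -/
lemma exists_multMap_eq {r : ℕ} (α : Fin r → Fin (n + 1) →₀ ℕ) {e : ℤ} {t : ℕ}
    (hα : ∀ a, HomZ (monomial (α a) (1 : F)) e) {f : Fin r → MvPolynomial (Fin (s + 1)) F}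
    (hf : ∀ a, HomZ (f a) t) :
    ∃ x, ∀ k j, localSec i φ (multMap F i φ e t x) k j = bival i φ α f k j := by
  classical
  have h : ∀ σ : Finset (Fin r), ∃ x, ∀ k j, localSec i φ (multMap F i φ e t x) k j =
      ∑ a ∈ σ, pull i inf_le_left (evChart k (monomial (α a) 1)) *
        pull φ inf_le_right (evChart j (f a)) := fun σ ↦ by
    induction σ using Finset.induction_on with
    | empty =>
      refine ⟨0, fun k j ↦ ?_⟩
      rw [LinearMap.map_zero, Finset.sum_empty]
      rfl
    | insert a σ ha ih =>
      obtain ⟨x, hx⟩ := ih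
      refine ⟨polySection F (hα a) ⊗ₜ ⟨_, aeval_mem_symPow φ (hf a)⟩ + x, fun k j ↦ ?_⟩
      rw [LinearMap.map_add, localSec_add, hx, Finset.sum_insert ha, localSec_multMap_tmul,
        symAlgMap_aeval]
      exact congrArg (fun z ↦ _ * z + _) (res_pull _ _ _ _)
  exact h Finset.univ

/-- Functions on the sets `D_+(y_j)` have numerators of a common degree `t + M`. -/
lemma exists_homZ_evChart_eq {r : ℕ} (c : ∀ j, Fin r → Γ(PSpace F s, chart F j)) (t : ℕ) :
    ∃ (M : ℕ) (q : Fin (s + 1) → Fin r → MvPolynomial (Fin (s + 1)) F),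
      (∀ j a, HomZ (q j a) (t + M)) ∧ ∀ j a, evChart j (q j a) = c j a := by
  choose N P hP hPp using fun j a ↦ exists_eval₂_ratio j (c j a)
  have hN : ∀ j a, N j a ≤ t + ∑ j, ∑ a, N j a := fun j a ↦ ((Finset.single_le_sum (f := N j)
    (fun _ _ ↦ Nat.zero_le _) (Finset.mem_univ a)).trans (Finset.single_le_sum
      (f := fun j ↦ ∑ a, N j a) (fun _ _ ↦ Nat.zero_le _) (Finset.mem_univ j))).trans
        (Nat.le_add_left _ _)
  refine ⟨∑ j, ∑ a, N j a, fun j a ↦ MvPolynomial.X j ^ (t + ∑ j, ∑ a, N j a - N j a) * P j a,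
    fun j a ↦ ?_, fun j a ↦ ?_⟩
  · have h := (homZ_X_pow (B := F) j (t + ∑ j, ∑ a, N j a - N j a)).mul (homZ_natCast.2 (hP j a))
    rwa [← Nat.cast_add, Nat.sub_add_cancel (hN j a), Nat.cast_add] at h
  · rw [map_mul, map_pow, evChart_X, ratio_self, one_pow, one_mul]
    exact hPp j a

lemma evAt_sum_monomial {r : ℕ} (α : Fin r → Fin (n + 1) →₀ ℕ) (j : Fin (s + 1))
    (q : Fin r → MvPolynomial (Fin (s + 1)) F) (k : Fin (n + 1)) :
    evAt i (baseMap F φ j) k (∑ a, monomial (α a) (evChart j (q a))) = bival i φ α q k j := by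
  rw [map_sum, bival]
  refine Finset.sum_congr rfl fun a _ ↦ ?_
  have h : monomial (α a) (evChart j (q a)) = C (evChart j (q a)) *
      map (scalar (PSpace F s ↘ Spec (.of F)) (chart F j)) (monomial (α a) 1) := by
    rw [map_monomial, map_one, C_mul_monomial, mul_one]
  rw [h, map_mul, evAt_C, evAt_map_scalar, mul_comm, res_pull]

omit [i.IsOver (Spec (.of F))] [φ.IsOver (Spec (.of F))] in
/-- If `q j / y_j ^ M` represents the section `w` over `D_+(y_j)`, then it does so in the
trivialisation of `L` over any other `D_+(y_h)`. -/
lemma res_bival_eq {r : ℕ} {α : Fin r → Fin (n + 1) →₀ ℕ} {e : ℤ}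
    {t : ℕ} {w : H0 F (twistedPower F i φ e t)} {M : ℕ}
    {q : Fin (s + 1) → Fin r → MvPolynomial (Fin (s + 1)) F} (hq : ∀ j a, HomZ (q j a) (t + M))
    (hqw : ∀ j k, bival i φ α (q j) k j = localSec i φ w k j) (j : Fin (s + 1)) (k : Fin (n + 1))
    (h : Fin (s + 1)) {W : X.Opens} (hW : W ≤ patch i (φ ⁻¹ᵁ chart F h) k)
    (hj : W ≤ φ ⁻¹ᵁ chart F j) : res hW (bival i φ α (q j) k h) =
      rat (hW.trans inf_le_right) j ^ M * res hW (localSec i φ w k h) := by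
  have hj' : W ≤ patch i (φ ⁻¹ᵁ chart F j) k := fun x hx ↦ ⟨(hW hx).1, hj hx⟩
  rw [res_bival i φ α (hq j) k hW hj', hqw, res_localSec i φ w k k h j hW hj', ratU_self,
    one_zpow, Units.val_one, one_mul, zpow_add, zpow_natCast, zpow_natCast, Units.val_mul,
    Units.val_pow_eq_pow_val, Units.val_pow_eq_pow_val, val_ratU]
  ring

omit [i.IsOver (Spec (.of F))] [φ.IsOver (Spec (.of F))] in
/-- The local lifts of a section of `L^t(e)` to bihomogeneous fractions agree on the intersections,
up to the relations between the monomials. -/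
lemma exists_pow_smul_sub_mem_biKer [IsAffineHom φ] {r : ℕ} {α : Fin r → Fin (n + 1) →₀ ℕ} {e : ℤ}
    {t : ℕ} {w : H0 F (twistedPower F i φ e t)} {M : ℕ}
    {q : Fin (s + 1) → Fin r → MvPolynomial (Fin (s + 1)) F} (hq : ∀ j a, HomZ (q j a) (t + M))
    (hqw : ∀ j k, bival i φ α (q j) k j = localSec i φ w k j) (j l : Fin (s + 1)) :
    ∃ M', (MvPolynomial.X j * MvPolynomial.X l : MvPolynomial (Fin (s + 1)) F) ^ M' •
      ((MvPolynomial.X l : MvPolynomial (Fin (s + 1)) F) ^ M • q j -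
        (MvPolynomial.X j : MvPolynomial (Fin (s + 1)) F) ^ M • q l) ∈ biKer i φ α := by
  have hres := fun j k h {W} ↦ res_bival_eq (W := W) i φ hq hqw j k h
  refine exists_pow_smul_mem_biKer i φ α fun k h ↦ ?_
  rw [bival_sub, bival_X_pow_smul, bival_X_pow_smul, map_sub,
    map_mul _ (rat (g := φ) inf_le_right l ^ M), map_mul _ (rat (g := φ) inf_le_right j ^ M),
    map_pow, map_pow, res_pull, res_pull, hres j k h inf_le_left (inf_le_right.trans inf_le_left),
    hres l k h inf_le_left (inf_le_right.trans inf_le_right), mul_left_comm]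
  exact sub_self _

/-- The monomials of degree `e`, numbered, with the same exponents for all rings of coefficients. -/
lemma exists_eq_sum_monomial (n e : ℕ) : ∃ (r : ℕ) (α : Fin r → Fin (n + 1) →₀ ℕ),
    (∀ a, (α a).degree = e) ∧ ∀ {B : Type u} [CommRing B] {p : MvPolynomial (Fin (n + 1)) B},
      HomZ p e → p = ∑ a, monomial (α a) (coeff (α a) p) := by
  let A := Finset.finsuppAntidiag (Finset.univ : Finset (Fin (n + 1))) e
  refine ⟨A.card, fun a ↦ A.equivFin.symm a, fun a ↦ ?_, fun {B} _ p hp ↦ ?_⟩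
  · have h := (Finset.mem_finsuppAntidiag.1 (A.equivFin.symm a).2).1
    rw [Finsupp.degree_eq_sum]
    exact h
  · conv_lhs => rw [p.as_sum]
    have h₁ : p.support ⊆ A := fun d hd ↦ by
      have h := hp d (mem_support_iff.1 hd)
      rw [Finsupp.degree_eq_sum] at h
      exact Finset.mem_finsuppAntidiag.2 ⟨by exact_mod_cast h, Finset.subset_univ _⟩
    rw [Finset.sum_subset h₁ fun d _ hd ↦ by rw [notMem_support_iff.1 hd, monomial_zero],
      ← Finset.sum_coe_sort A]
    exact (Equiv.sum_comp A.equivFin.symm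
      fun d : A ↦ monomial (d : Fin (n + 1) →₀ ℕ) (coeff (d : Fin (n + 1) →₀ ℕ) p)).symm

lemma exists_evAt_eq_localSec [IsClosedImmersion i] [IsFinite φ] {e : ℤ} {t : ℕ} {j : Fin (s + 1)}
    (hgen : (xSystem i φ j).Gen e) (w : H0 F (twistedPower F i φ e t)) :
    ∃ p, HomZ p e ∧ ∀ k, evAt i (baseMap F φ j) k p = localSec i φ w k j := by
  obtain ⟨p, hp, hpw⟩ := hgen _ (isTwistSec_localSec i φ w j)
  exact ⟨p, hp, fun k ↦ congrFun hpw k⟩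

set_option maxHeartbeats 400000 in
/-- If the sections over all the `D_+(y_j)` are polynomials, then the multiplication maps are
surjective for large `t`: the local expressions of a section of `L^t(e)` as bihomogeneous fractions
are glued by means of `exists_forall_lift`. -/
lemma surjective_multMap_of_gen [IsClosedImmersion i] [IsFinite φ] {e : ℤ} (he : 0 ≤ e)
    (hgen : ∀ j, (xSystem i φ j).Gen e) :
    ∀ᶠ t : ℕ in Filter.atTop, Function.Surjective (multMap F i φ e t) := by
  obtain ⟨e, rfl⟩ := Int.eq_ofNat_of_zero_le he
  obtain ⟨r, α, hα, hsum⟩ := exists_eq_sum_monomial.{u} n e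
  obtain ⟨t₀, ht₀⟩ := exists_forall_lift r (biKer i φ α)
  filter_upwards [Filter.eventually_ge_atTop t₀.toNat] with t ht
  intro w
  choose p hp hpw using fun j ↦ exists_evAt_eq_localSec i φ (hgen j) w
  obtain ⟨M, q, hq, hqp⟩ := exists_homZ_evChart_eq (fun j a ↦ coeff (α a) (p j)) t
  have hqw : ∀ j k, bival i φ α (q j) k j = localSec i φ w k j := fun j k ↦ by
    rw [← evAt_sum_monomial]
    simp only [hqp]
    rw [← hsum (hp j)]
    exact hpw j k
  have hlift := ht₀ t (Int.toNat_le.1 ht) (Int.natCast_nonneg t) M q hq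
    (exists_pow_smul_sub_mem_biKer i φ hq hqw)
  clear ht₀
  obtain ⟨f, hf, hfq⟩ := hlift
  have hfw : ∀ k j, bival i φ α f k j = localSec i φ w k j := fun k j ↦ by
    obtain ⟨M', hM'⟩ := hfq j
    have h := hM' k j
    rw [bival_X_pow_smul, bival_sub, bival_X_pow_smul, rat_self, one_pow, one_pow, one_mul, one_mul,
      hqw, sub_eq_zero] at h
    exact h.symm
  have hmono : ∀ a, HomZ (monomial (α a) (1 : F)) e := fun a ↦ by
    have h := homZ_monomial (α a) (1 : F)
    rwa [hα] at h
  obtain ⟨x, hx⟩ := exists_multMap_eq i φ α hmono hf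
  exact ⟨x, H0_ext fun k j ↦ (hx k j).trans (hfw k j)⟩

end Surjective

/-! ### Regularity of the fibres and surjectivity of the multiplication maps -/

section Main

variable {F : Type u} [Field F] {n s : ℕ} {X : Scheme.{u}} [X.Over (Spec (.of F))]
  (i : X ⟶ PSpace F n) [i.IsOver (Spec (.of F))] [IsClosedImmersion i]
  (φ : X ⟶ PSpace F s) [φ.IsOver (Spec (.of F))] [IsFinite φ]

lemma exists_mem_chart (y : PSpace F s) : ∃ j, y ∈ chart F j :=
  Opens.mem_iSup.1 ((iSup_chart F).ge (Opens.mem_top y))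

/-- In negative degrees there are no polynomials, while `X` is not empty. -/
lemma nonneg_of_gen [Nonempty X] {e : ℤ} (h : ∀ j, (xSystem i φ j).Gen e) : 0 ≤ e := by
  by_contra he
  obtain ⟨x⟩ := ‹Nonempty X›
  obtain ⟨j, hj⟩ := exists_mem_chart (φ x)
  obtain ⟨k, hk⟩ := exists_mem_chart (i x)
  have h₀ := SectionSystem.Gen.one_eq_zero (xSystem i φ j) (h j) (not_le.1 he)
  have h₁ : (1 : Γ(X, patch i (φ ⁻¹ᵁ chart F j) k)) = 0 := congrFun h₀ k
  have h₂ := Scheme.basicOpen_of_isUnit X (isUnit_one (M := Γ(X, patch i (φ ⁻¹ᵁ chart F j) k)))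
  rw [h₁, Scheme.basicOpen_zero] at h₂
  exact (h₂.ge ⟨hk, hj⟩ : x ∈ (⊥ : X.Opens))

lemma eventually_surjective_multMap_iff [Nonempty X] (hn : 1 ≤ n) (e : ℤ) :
    (∀ᶠ t : ℕ in Filter.atTop, Function.Surjective (multMap F i φ e t)) ↔
      ∀ j, (xSystem i φ j).Gen e :=
  ⟨gen_of_surjective_multMap i φ hn, fun h ↦
    surjective_multMap_of_gen i φ (nonneg_of_gen i φ h) h⟩

lemma exists_forall_xSystem_gen : ∃ e, ∀ j, (xSystem i φ j).Gen e := by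
  choose e₀ he₀ using fun j ↦
    (xSystem i φ j).exists_forall_gen (geomSystem_sec_zero_fg (finite_baseMap φ j))
  obtain ⟨e, he⟩ := Finite.bddAbove_range e₀
  exact ⟨e, fun j ↦ he₀ j e (he ⟨j, rfl⟩)⟩

end Main

end FiberRegularity

end

theorem mainTheorem2 (F : Type u) [Field F] (n s : ℕ) (hn : 1 ≤ n)
    (X : Scheme.{u}) [X.Over (Spec (.of F))] [Nonempty X]
    (i : X ⟶ PSpace F n) [i.IsOver (Spec (.of F))] [IsClosedImmersion i]
    (φ : X ⟶ PSpace F s) [φ.IsOver (Spec (.of F))] [IsFinite φ] :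
    (∀ y : PSpace F s, IsClosed {y} → ∃ r : ℤ, IsRegularity (fiberIdeal i φ y) r) ∧
    ∃ ε : ℤ,
      IsLeast {e : ℤ | ∀ᶠ t : ℕ in Filter.atTop, Function.Surjective (multMap F i φ e t)} ε ∧
      IsGreatest {r : ℤ | ∃ y : PSpace F s, IsClosed {y} ∧ IsRegularity (fiberIdeal i φ y) r}
        (ε + 1) := by
  obtain ⟨ε, hε, hε'⟩ := Int.exists_least_of_bdd (P := fun e ↦ ∀ j, (xSystem i φ j).Gen e)
    ⟨0, fun e he ↦ nonneg_of_gen i φ he⟩ (exists_forall_xSystem_gen i φ)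
  have hε0 := nonneg_of_gen i φ hε
  refine ⟨fun y hy ↦ ?_, ε, ⟨?_, fun e he ↦ ?_⟩, ?_, ?_⟩
  · obtain ⟨j, hyj⟩ := exists_mem_chart y
    obtain ⟨r, hr, hr'⟩ := Int.exists_least_of_bdd
      (P := fun r ↦ 0 ≤ r ∧ (fibreSystem i φ hyj hy).Gen (r - 1)) ⟨0, fun r hr ↦ hr.1⟩
      ⟨ε + 1, by omega, by simpa using gen_fibreSystem i φ hyj hy (hε j)⟩
    exact ⟨r, (isRegularity_fiberIdeal_iff i φ hyj hy hn r).2 ⟨hr, hr'⟩⟩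
  · exact (eventually_surjective_multMap_iff i φ hn ε).2 hε
  · exact hε' e ((eventually_surjective_multMap_iff i φ hn e).1 he)
  · -- a closed point witnessing that `ε - 1` is too small has a fibre of regularity `ε + 1`
    have h : ∃ (j : _) (y : PSpace F s) (hyj : y ∈ chart F j) (hy : IsClosed {y}),
        ¬ (fibreSystem i φ hyj hy).Gen (ε - 1) := by
      by_contra! h
      have := hε' (ε - 1) fun j ↦ gen_xSystem i φ (h j)
      omega
    obtain ⟨j, y, hyj, hy, hyε⟩ := h
    refine ⟨y, hy, (isRegularity_fiberIdeal_iff i φ hyj hy hn _).2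
      ⟨⟨by omega, by simpa using gen_fibreSystem i φ hyj hy (hε j)⟩, fun r hr ↦ ?_⟩⟩
    by_contra hlt
    exact hyε (SectionSystem.Gen.mono _ hr.2 (by omega))
  · rintro r ⟨y, hy, hr⟩
    obtain ⟨j, hyj⟩ := exists_mem_chart y
    exact ((isRegularity_fiberIdeal_iff i φ hyj hy hn r).1 hr).2
      ⟨by omega, by simpa using gen_fibreSystem i φ hyj hy (hε j)⟩
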